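/- For $n\ge 1$ and $\beta>0$ let $\mu_n(\sigma)=Z^{-1}\exp\bigl(\tfrac{\beta}{n}\sum_{1\le i<j\le n}\sigma(i)\sigma(j)\bigr)$ be the Ising (Curie–Weiss) measure on $\{-1,1\}^n$, let $S(\sigma)=\tfrac1n\sum_{i}\sigma(i)$ and $\Omega_n^+=\{\sigma\in\{-1,1\}^n: S(\sigma)\ge 0\}$. The Glauber dynamics chooses a site uniformly at random and resamples its spin from $\mu_n$ conditioned on all other spins. The restricted Glauber dynamics on $\Omega_n^+$ generates a candidate $\eta$ by one step of the Glauber dynamics and moves to $\eta$ if $S(\eta)\ge0$ and to $-\eta$ if $S(\eta)<0$. Let $P_n^+$ be its transition matrix, and let $\mu_n^+$ be the image of $\mu_n$ under the map $\sigma\mapsto\sigma$ if $S(\sigma)\ge 0$, $\sigma\mapsto-\sigma$ if $S(\sigma)<0$. Put $$d_n(t)=\max_{\sigma\in\Omega_n^+}\bigl\|(P_n^+)^t(\sigma,\cdot)-\mu_n^+\bigr\|_{\mathrm{TV}},\qquad t_{\mathrm{mix}}(n)=\min\{t\in\mathbb{N}: d_n(t)\le 1/4\}.$$ **Theorem.**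 Let $\beta>1$. For every $n\ge1$, $\mu_n^+$ is the unique stationary distribution of the restricted Glauber dynamics, and $t_{\mathrm{mix}}(n)$ is well defined (the set of $t$ with $d_n(t)\le 1/4$ is non-empty). There are constants $C_3(\beta),C_4(\beta)>0$, depending only on $\beta$, such that for all $n\ge1$ $$C_3(\beta)\,n\log n\le t_{\mathrm{mix}}(n)\le C_4(\beta)\,n\log n .$$ Moreover $t_{\mathrm{mix}}(n)\ge \tfrac14\,n\log n$ for all sufficiently large $n$ (depending on $\beta$). -/

import Mathlib

open Finset

noncomputable section

namespace CurieWeiss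

/-! ### Finite Markov chains given by a transition matrix -/

section MarkovChain

variable {X : Type*} [Fintype X]

/-- `π` is a stationary probability distribution of the transition matrix `P`. -/
def IsStationary (P : Matrix X X ℝ) (π : X → ℝ) : Prop :=
  (∀ x, 0 ≤ π x) ∧ ∑ x, π x = 1 ∧ ∀ y, ∑ x, π x * P x y = π y

/-- Total variation distance between two probability distributions on a finite set. -/
def tvDist (μ ν : X → ℝ) : ℝ := (1 / 2) * ∑ x, |μ x - ν x|

/-- Worst-case total variation distance, over the starting state, between the law of the chain
after `t` steps and the distribution `π`. -/
def worstDist [DecidableEq X] (P : Matrix X X ℝ) (π : X → ℝ) (t : ℕ) : ℝ :=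
  ⨆ x, tvDist (fun y => (P ^ t) x y) π

end MarkovChain

/-! ### The Ising model on the complete graph -/

/-- Spin configurations on `n` sites; `ℤˣ = {1, -1}` is the set of spins. -/
abbrev Config (n : ℕ) := Fin n → ℤˣ

/-- The numerical value `±1` of a spin. -/
def spin (s : ℤˣ) : ℝ := ((s : ℤ) : ℝ)

/-- Normalized magnetization `S(σ) = n⁻¹ ∑ i, σ(i)`. -/
def mag {n : ℕ} (σ : Config n) : ℝ := (n : ℝ)⁻¹ * ∑ i, spin (σ i)

/-- Unnormalized Gibbs weight `exp ((β / n) ∑_{i < j} σ(i) σ(j))`. -/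
def gibbsWeight {n : ℕ} (β : ℝ) (σ : Config n) : ℝ :=
  Real.exp (β / n * ∑ i, ∑ j ∈ Finset.Ioi i, spin (σ i) * spin (σ j))

/-- The Ising (Gibbs) measure on configurations. -/
def gibbs {n : ℕ} (β : ℝ) (σ : Config n) : ℝ :=
  gibbsWeight β σ / ∑ τ : Config n, gibbsWeight β τ

/-- The local field `n⁻¹ ∑_{w ≠ v} σ(w)` at the site `v`. -/
def localField {n : ℕ} (σ : Config n) (v : Fin n) : ℝ :=
  (n : ℝ)⁻¹ * ∑ w ∈ univ.erase v, spin (σ w)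

/-- The probability that the updated site `v` receives the spin `s`, that is, the conditional
probability under the Gibbs measure of spin `s` at `v` given the spins at all other sites. -/
def updateProb {n : ℕ} (β : ℝ) (σ : Config n) (v : Fin n) (s : ℤˣ) : ℝ :=
  Real.exp (β * spin s * localField σ v) /
    (Real.exp (β * localField σ v) + Real.exp (-(β * localField σ v)))

/-- Transition matrix of the Glauber dynamics: choose a site uniformly at random and resample
its spin. -/
def glauber (n : ℕ) (β : ℝ) : Matrix (Config n) (Config n) ℝ := fun σ η =>
  (n : ℝ)⁻¹ * ∑ v, ∑ s : ℤˣ, if Function.update σ v s = η then updateProb β σ v s else 0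

/-! ### Restriction to non-negative magnetization -/

/-- The set `Ω⁺` of configurations of non-negative magnetization. -/
abbrev ConfigPlus (n : ℕ) := {σ : Config n // 0 ≤ mag σ}

theorem mag_neg {n : ℕ} (σ : Config n) : mag (-σ) = -mag σ := by
  simp [mag, spin]

/-- The acceptance rule: keep `η` if `S(η) ≥ 0` and replace it by `-η` if `S(η) < 0`. -/
def reflect {n : ℕ} (η : Config n) : ConfigPlus n :=
  if h : 0 ≤ mag η then ⟨η, h⟩
  else ⟨-η, by rw [mag_neg]; linarith [not_le.mp h]⟩

/-- Transition matrix of the restricted Glauber dynamics on `Ω⁺`. -/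
def restrictedGlauber (n : ℕ) (β : ℝ) : Matrix (ConfigPlus n) (ConfigPlus n) ℝ := fun σ η =>
  ∑ ζ : Config n, if reflect ζ = η then glauber n β σ.1 ζ else 0

/-- The image of the Gibbs measure under the acceptance rule `reflect`. -/
def gibbsPlus (n : ℕ) (β : ℝ) : ConfigPlus n → ℝ := fun η =>
  ∑ ζ : Config n, if reflect ζ = η then gibbs β ζ else 0

/-- The set of times at which the restricted dynamics is within `1/4` of equilibrium from every
starting state. -/
def mixedTimes (n : ℕ) (β : ℝ) : Set ℕ :=
  {t | worstDist (restrictedGlauber n β) (gibbsPlus n β) t ≤ 1 / 4}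

/-- Mixing time of the restricted Glauber dynamics. -/
def tmix (n : ℕ) (β : ℝ) : ℕ := sInf (mixedTimes n β)

end CurieWeiss

end

open Finset

noncomputable section

namespace CurieWeiss

/-! ### The Glauber operator on functions -/

/-! The proof works with operators on functions. On functions invariant under σ ↦ -σ the restricted
chain acts exactly as the unrestricted one (`restrictedOp_iterate_even`), so such functions do not
see the bottleneck at zero magnetization, and the reversibility and positivity of the Glauber
dynamics can be used directly.

Upper bound. A bounded test function is evolved in two stages. First, the effect of exchanging the
spins at two sites shrinks by the factor 1 - e^{-2β}/n per step (`SwapBound.glauberOp`), so after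
order n log n steps the function is almost constant on each magnetization level and hence close to
an even function of the magnetization. On such functions the dynamics is a birth-and-death chain. If
one level A is reached quickly from everywhere, then P^{2U} φ ≥ π(φ)/4 for all nonnegative φ of this
kind (`quarter_le_iterate`): positive semidefiniteness gives P^u 1_A ≥ π(A) on A, hitting A spreads
this to all states, reversibility transfers it to φ, and hitting A once more finishes. The
oscillation therefore contracts by 3/4 every 2U steps.

That some level is hit within mean time of order n log n is `exists_supersolution`. The logarithm of
the up/down ratio across an edge is concave in the magnetization, vanishes at 0, and for β > 1 is
positive at a fixed fraction of n. Chords then give a drift that is linear in the distance from 0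
and in the distance to the attracting level, so a crossing time is at most of order n times the sum
of the inverses of these distances, and the harmonic series gives the logarithm.

Lower bound. A linear statistic whose weights sum to zero does not feel the mean field. It decays by
a factor of about 1 - 1/n per step, starting near n, while its equilibrium fluctuations are of order
√n. Before time (n log n)/4 it is still of order at least n^{5/8}, and a second-moment argument
separates the laws (`half_le_worstDist`).

Stationarity is checked by splitting into even and odd parts (`gibbsPlus_restrictedOp`); uniqueness
and finiteness of the mixing time come from Doeblin's condition at the all-plus state. -/

theorem sum_units (f : ℤˣ → ℝ) : ∑ s : ℤˣ, f s = f 1 + f (-1) := by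
  have : (univ : Finset ℤˣ) = {1, -1} := by decide
  rw [this, sum_pair (by decide)]

@[simp] theorem spin_one : spin 1 = 1 := by simp [spin]

@[simp] theorem spin_neg (s : ℤˣ) : spin (-s) = -spin s := by simp [spin]

theorem spin_eq_or (s : ℤˣ) : spin s = 1 ∨ spin s = -1 := by
  rcases Int.units_eq_one_or s with rfl | rfl <;> simp

theorem spin_sq (s : ℤˣ) : spin s ^ 2 = 1 := by
  rcases spin_eq_or s with h | h <;> rw [h] <;> norm_num

theorem abs_spin (s : ℤˣ) : |spin s| = 1 := by
  rcases spin_eq_or s with h | h <;> rw [h] <;> norm_num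

/-- The probability of updating to a plus spin when the field is `θ`. -/
def plusProb (θ : ℝ) : ℝ := Real.exp θ / (Real.exp θ + Real.exp (-θ))

theorem plusProb_pos (θ : ℝ) : 0 < plusProb θ := by unfold plusProb; positivity

theorem plusProb_add_neg (θ : ℝ) : plusProb θ + plusProb (-θ) = 1 := by
  unfold plusProb
  rw [neg_neg, add_comm (Real.exp (-θ)), ← add_div, div_self (by positivity)]

theorem plusProb_le_one (θ : ℝ) : plusProb θ ≤ 1 := by
  linarith [plusProb_add_neg θ, plusProb_pos (-θ)]

theorem plusProb_eq (θ : ℝ) : plusProb θ = 1 / (1 + Real.exp (-(2 * θ))) := by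
  unfold plusProb
  rw [div_eq_div_iff (by positivity) (by positivity), mul_add, ← Real.exp_add]
  ring_nf

theorem plusProb_mono : Monotone plusProb := by
  intro a b h
  rw [plusProb_eq, plusProb_eq]
  gcongr

theorem plusProb_lipschitz {a b : ℝ} (h : a ≤ b) : plusProb b - plusProb a ≤ 2 * (b - a) := by
  rw [plusProb_eq, plusProb_eq, div_sub_div _ _ (by positivity) (by positivity),
    div_le_iff₀ (by positivity)]
  have h1 := Real.add_one_le_exp (-(2 * (b - a)))
  have h2 : Real.exp (-(2 * b)) = Real.exp (-(2 * a)) * Real.exp (-(2 * (b - a))) := by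
    rw [← Real.exp_add]; ring_nf
  have ha := Real.exp_pos (-(2 * a))
  have hb := Real.exp_pos (-(2 * b))
  have h3 : Real.exp (-(2 * a)) - Real.exp (-(2 * b)) ≤ Real.exp (-(2 * a)) * (2 * (b - a)) := by
    rw [h2]; nlinarith
  have h4 : 0 ≤ b - a := by linarith
  nlinarith [mul_nonneg h4 hb.le, mul_nonneg (mul_nonneg h4 hb.le) ha.le]

theorem plusProb_ge {θ b : ℝ} (hb : 0 ≤ b) (h : -b ≤ θ) : Real.exp (-(2 * b)) / 2 ≤ plusProb θ := by
  refine le_trans ?_ (plusProb_mono h)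
  rw [plusProb_eq, div_le_div_iff₀ (by norm_num) (by positivity), mul_add, ← Real.exp_add]
  have : Real.exp (-(2 * b)) ≤ 1 := Real.exp_le_one_iff.mpr (by linarith)
  ring_nf at this ⊢
  simp; linarith

variable {n : ℕ} {β : ℝ}

theorem updateProb_eq (σ : Config n) (v : Fin n) (s : ℤˣ) :
    updateProb β σ v s = plusProb (β * spin s * localField σ v) := by
  unfold updateProb plusProb
  rcases Int.units_eq_one_or s with rfl | rfl
  · simp
  · simp [add_comm]

theorem updateProb_pos (σ : Config n) (v : Fin n) (s : ℤˣ) : 0 < updateProb β σ v s := by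
  rw [updateProb_eq]; exact plusProb_pos _

theorem sum_updateProb (σ : Config n) (v : Fin n) : ∑ s, updateProb β σ v s = 1 := by
  rw [sum_units, updateProb_eq, updateProb_eq, ← plusProb_add_neg (β * localField σ v)]
  simp

theorem localField_update (σ : Config n) (v : Fin n) (s : ℤˣ) :
    localField (Function.update σ v s) v = localField σ v := by
  unfold localField
  congr 1
  refine sum_congr rfl fun w hw => ?_
  rw [Function.update_of_ne (ne_of_mem_erase hw)]

theorem updateProb_update (σ : Config n) (v : Fin n) (s t : ℤˣ) :
    updateProb β (Function.update σ v s) v t = updateProb β σ v t := by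
  rw [updateProb_eq, updateProb_eq, localField_update]

/-- Averaging a function over the resampling of the spin at `v`. -/
def siteAvg (β : ℝ) (v : Fin n) (f : Config n → ℝ) (σ : Config n) : ℝ :=
  ∑ s, updateProb β σ v s * f (Function.update σ v s)

/-- The Glauber dynamics acting on functions. -/
def glauberOp (β : ℝ) (f : Config n → ℝ) (σ : Config n) : ℝ :=
  (n : ℝ)⁻¹ * ∑ v, siteAvg β v f σ

theorem glauberOp_eq_sum (f : Config n → ℝ) (σ : Config n) :
    glauberOp β f σ = ∑ η, glauber n β σ η * f η := by
  have h : ∀ η, glauber n β σ η * f η = ∑ v, ∑ s : ℤˣ, (n : ℝ)⁻¹ *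
      if Function.update σ v s = η then updateProb β σ v s * f η else 0 := by
    intro η
    unfold glauber
    simp_rw [← mul_sum]
    rw [mul_assoc, sum_mul]
    congr 1
    refine sum_congr rfl fun v _ => ?_
    rw [sum_mul]
    exact sum_congr rfl fun s _ => by rw [ite_mul, zero_mul]
  unfold glauberOp siteAvg
  simp only [h]
  rw [eq_comm, sum_comm, mul_sum]
  refine sum_congr rfl fun v _ => ?_
  rw [sum_comm, mul_sum]
  refine sum_congr rfl fun s _ => ?_
  rw [← mul_sum, sum_ite_eq, if_pos (mem_univ _)]

theorem siteAvg_const (v : Fin n) (c : ℝ) (σ : Config n) : siteAvg β v (fun _ => c) σ = c := by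
  unfold siteAvg
  rw [← sum_mul, sum_updateProb, one_mul]

theorem siteAvg_mono (v : Fin n) {f g : Config n → ℝ} (h : f ≤ g) :
    siteAvg β v f ≤ siteAvg β v g := by
  intro σ
  unfold siteAvg
  exact sum_le_sum fun s _ => mul_le_mul_of_nonneg_left (h _) (updateProb_pos σ v s).le

theorem glauberOp_mono {f g : Config n → ℝ} (h : f ≤ g) :
    glauberOp β f ≤ glauberOp β g := by
  intro σ
  unfold glauberOp
  exact mul_le_mul_of_nonneg_left (sum_le_sum fun v _ => siteAvg_mono v h σ) (by positivity)

theorem glauberOp_const (hn : 1 ≤ n) (c : ℝ) : glauberOp β (fun _ : Config n => c) = fun _ => c := by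
  ext σ
  have : (n : ℝ) ≠ 0 := by positivity
  simp [glauberOp, siteAvg_const, this]

theorem glauberOp_add (f g : Config n → ℝ) :
    glauberOp β (f + g) = glauberOp β f + glauberOp β g := by
  ext σ
  simp [glauberOp, siteAvg, mul_add, sum_add_distrib]

theorem glauberOp_smul (c : ℝ) (f : Config n → ℝ) :
    glauberOp β (c • f) = c • glauberOp β f := by
  ext σ
  simp only [glauberOp, siteAvg, Pi.smul_apply, smul_eq_mul, mul_sum]
  refine sum_congr rfl fun v _ => sum_congr rfl fun s _ => ?_
  ring

theorem localField_neg (σ : Config n) (v : Fin n) : localField (-σ) v = -localField σ v := by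
  unfold localField
  simp only [Pi.neg_apply, spin_neg, sum_neg_distrib, mul_neg]

theorem update_neg (σ : Config n) (v : Fin n) (s : ℤˣ) :
    Function.update (-σ) v s = -Function.update σ v (-s) := by
  ext w
  by_cases h : w = v
  · subst h; simp
  · simp [h]

theorem glauberOp_neg (f : Config n → ℝ) (σ : Config n) :
    glauberOp β f (-σ) = glauberOp β (fun η => f (-η)) σ := by
  unfold glauberOp siteAvg
  congr 1
  refine sum_congr rfl fun v _ => ?_
  rw [sum_units, sum_units]
  simp only [updateProb_eq, localField_neg, update_neg, spin_neg, neg_neg, spin_one]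
  rw [add_comm]
  ring_nf

theorem localField_comp (σ : Config n) (e : Equiv.Perm (Fin n)) (v : Fin n) :
    localField (σ ∘ e) v = localField σ (e v) := by
  unfold localField
  congr 1
  refine sum_bij' (fun w _ => e w) (fun w _ => e.symm w) ?_ ?_ ?_ ?_ ?_ <;> simp
  intro a h h2; apply h; simp [← h2]

theorem update_comp (σ : Config n) (e : Equiv.Perm (Fin n)) (v : Fin n) (s : ℤˣ) :
    Function.update (σ ∘ e) v s = Function.update σ (e v) s ∘ e := by
  ext w
  by_cases h : w = v
  · subst h; simp
  · simp [h]

theorem siteAvg_comp (f : Config n → ℝ) (σ : Config n) (e : Equiv.Perm (Fin n)) (v : Fin n) :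
    siteAvg β v f (σ ∘ e) = siteAvg β (e v) (fun η => f (η ∘ e)) σ := by
  unfold siteAvg
  simp only [updateProb_eq, localField_comp, update_comp]

theorem glauberOp_comp (f : Config n → ℝ) (σ : Config n) (e : Equiv.Perm (Fin n)) :
    glauberOp β f (σ ∘ e) = glauberOp β (fun η => f (η ∘ e)) σ := by
  unfold glauberOp
  simp only [siteAvg_comp]
  rw [Equiv.sum_comp e (fun v => siteAvg β v (fun η => f (η ∘ e)) σ)]

/-! ### Reversibility and positivity -/

/-- One of the two values of s returns σ and the other flips the spin at v; the flip is an
involution, so every configuration is counted twice. -/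
theorem sum_update_avg (F : Config n → ℝ) (v : Fin n) :
    ∑ σ, ∑ s, F (Function.update σ v s) = 2 * ∑ σ, F σ := by
  have h : ∀ σ : Config n, ∑ s, F (Function.update σ v s) =
      F σ + F (Function.update σ v (-σ v)) := by
    intro σ
    rw [sum_units]
    have := Function.update_eq_self v σ
    rcases Int.units_eq_one_or (σ v) with h | h <;> rw [h] at this ⊢
    · rw [this]
    · rw [this, neg_neg, add_comm]
  simp_rw [h]
  rw [sum_add_distrib, two_mul]
  congr 1
  let e : Config n ≃ Config n := Function.Involutive.toPerm
    (fun σ : Config n => Function.update σ v (-σ v)) (fun σ => by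
      show Function.update (Function.update σ v (-σ v)) v (-(Function.update σ v (-σ v) v)) = σ
      rw [Function.update_self, neg_neg, Function.update_idem, Function.update_eq_self])
  exact Equiv.sum_comp e F

theorem sum_spin_pairs (σ : Config n) :
    ∑ i, ∑ j ∈ Finset.Ioi i, spin (σ i) * spin (σ j) = ((∑ i, spin (σ i)) ^ 2 - n) / 2 := by
  have h : (∑ i, spin (σ i)) ^ 2 = ∑ i, ∑ j, spin (σ i) * spin (σ j) := by
    rw [sq, sum_mul_sum]
  have h1 : ∀ i : Fin n, ∑ j, spin (σ i) * spin (σ j) =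
      ∑ j ∈ Ioi i, spin (σ i) * spin (σ j) + ∑ j ∈ Iio i, spin (σ i) * spin (σ j) + 1 := by
    intro i
    have hu : (univ : Finset (Fin n)) = insert i (Ioi i ∪ Iio i) := by
      ext j
      have := lt_trichotomy i j
      simp only [mem_univ, mem_insert, mem_union, mem_Ioi, mem_Iio, true_iff]
      tauto
    rw [hu, sum_insert (by simp), sum_union]
    · have := spin_sq (σ i); linarith
    · rw [Finset.disjoint_left]; intro j; simp; intro h; exact h.le
  have h2 : ∑ i : Fin n, ∑ j ∈ Iio i, spin (σ i) * spin (σ j) =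
      ∑ i, ∑ j ∈ Ioi i, spin (σ i) * spin (σ j) := by
    rw [sum_comm' (t' := univ) (s' := fun j => Ioi j) (by intro i j; simp)]
    exact sum_congr rfl fun i _ => sum_congr rfl fun j _ => mul_comm _ _
  rw [h]
  simp_rw [h1]
  rw [sum_add_distrib, sum_add_distrib, h2]
  simp

theorem sum_spin_update (σ : Config n) (v : Fin n) (s : ℤˣ) :
    ∑ i, spin (Function.update σ v s i) = spin s + ∑ w ∈ univ.erase v, spin (σ w) := by
  rw [← add_sum_erase _ _ (mem_univ v)]
  congr 1
  · simp
  · exact sum_congr rfl fun w hw => by rw [Function.update_of_ne (ne_of_mem_erase hw)]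

theorem gibbsWeight_pos (σ : Config n) : 0 < gibbsWeight β σ := Real.exp_pos _

/-- The energy depends only on the square of the spin sum (`sum_spin_pairs`), so the weight is a
factor free of the spin at v times an exponential linear in that spin. -/
theorem gibbsWeight_update (hn : 1 ≤ n) (σ : Config n) (v : Fin n) (s : ℤˣ) :
    gibbsWeight β (Function.update σ v s) =
      (∑ t, gibbsWeight β (Function.update σ v t)) * updateProb β σ v s := by
  have hn' : (n : ℝ) ≠ 0 := by positivity
  set R := ∑ w ∈ univ.erase v, spin (σ w) with hR
  have hw : ∀ t : ℤˣ, gibbsWeight β (Function.update σ v t) =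
      Real.exp (β / n * ((1 + R ^ 2 - n) / 2)) * Real.exp (β * spin t * localField σ v) := by
    intro t
    unfold gibbsWeight
    rw [sum_spin_pairs, sum_spin_update, ← Real.exp_add]
    congr 1
    have := spin_sq t
    unfold localField
    rw [← hR]
    field_simp
    ring_nf
    rw [this]; ring
  have hp : updateProb β σ v s = Real.exp (β * spin s * localField σ v) /
    (Real.exp (β * localField σ v) + Real.exp (-(β * localField σ v))) := rfl
  rw [sum_units]
  simp only [hw, hp]
  simp only [spin_one, spin_neg, mul_one, mul_neg, neg_mul]
  field_simp

/-- The conditional-expectation identity behind reversibility and positivity. -/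
theorem sum_mul_siteAvg (hn : 1 ≤ n) (v : Fin n) (f g : Config n → ℝ) :
    ∑ σ, gibbsWeight β σ * f σ * siteAvg β v g σ =
      (1 / 2) * ∑ σ, (∑ t, gibbsWeight β (Function.update σ v t)) *
        (siteAvg β v f σ * siteAvg β v g σ) := by
  have hg : ∀ σ s, siteAvg β v g (Function.update σ v s) = siteAvg β v g σ := by
    intro σ s
    simp [siteAvg, updateProb_update]
  have := sum_update_avg (fun σ => gibbsWeight β σ * f σ * siteAvg β v g σ) v
  rw [eq_comm, ← mul_right_inj' (two_ne_zero (α := ℝ)), ← this, ← mul_assoc,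
    mul_one_div_cancel two_ne_zero, one_mul]
  refine sum_congr rfl fun σ _ => ?_
  simp_rw [hg]
  rw [← sum_mul, ← mul_assoc]
  congr 1
  rw [siteAvg, mul_sum]
  refine sum_congr rfl fun s _ => ?_
  rw [gibbsWeight_update hn σ v s]
  ring

theorem partition_pos : 0 < ∑ τ : Config n, gibbsWeight β τ :=
  sum_pos (fun τ _ => gibbsWeight_pos τ) univ_nonempty

theorem gibbs_pos (σ : Config n) : 0 < gibbs β σ := div_pos (gibbsWeight_pos σ) partition_pos

theorem sum_gibbs : ∑ σ : Config n, gibbs β σ = 1 := by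
  unfold gibbs
  rw [← sum_div, div_self partition_pos.ne']

theorem sum_gibbs_mul_glauberOp (hn : 1 ≤ n) (f g : Config n → ℝ) :
    ∑ σ : Config n, gibbs β σ * f σ * glauberOp β g σ = (n : ℝ)⁻¹ * ∑ v, (1 / 2) *
      ∑ σ, (∑ t, gibbs β (Function.update σ v t)) * (siteAvg β v f σ * siteAvg β v g σ) := by
  set Z := ∑ τ : Config n, gibbsWeight β τ with hZ
  have h2 : ∀ v, (1 / 2) * ∑ σ, (∑ t, gibbs β (Function.update σ v t)) *
      (siteAvg β v f σ * siteAvg β v g σ) =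
      ∑ σ, Z⁻¹ * (gibbsWeight β σ * f σ * siteAvg β v g σ) := by
    intro v
    rw [← mul_sum, sum_mul_siteAvg hn v f g, mul_left_comm, mul_sum (a := Z⁻¹)]
    congr 1
    refine sum_congr rfl fun σ _ => ?_
    unfold gibbs
    rw [← hZ, ← sum_div]
    ring
  simp only [h2]
  rw [sum_comm, mul_sum]
  refine sum_congr rfl fun σ _ => ?_
  unfold glauberOp gibbs
  rw [← mul_sum, ← mul_sum, ← hZ]
  ring

theorem gibbs_symm (hn : 1 ≤ n) (f g : Config n → ℝ) :
    ∑ σ : Config n, gibbs β σ * f σ * glauberOp β g σ = ∑ σ, gibbs β σ * glauberOp β f σ * g σ := by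
  have : ∑ σ, gibbs β σ * glauberOp β f σ * g σ = ∑ σ, gibbs β σ * g σ * glauberOp β f σ :=
    sum_congr rfl fun σ _ => by ring
  rw [this, sum_gibbs_mul_glauberOp hn, sum_gibbs_mul_glauberOp hn]
  simp only [mul_comm (siteAvg β _ f _)]

/-- Each `siteAvg` is a conditional expectation, so the quadratic form of the dynamics is an average
of squared norms of projections. -/
theorem gibbs_psd (hn : 1 ≤ n) (f : Config n → ℝ) :
    0 ≤ ∑ σ, gibbs β σ * f σ * glauberOp β f σ := by
  rw [sum_gibbs_mul_glauberOp hn]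
  refine mul_nonneg (by positivity) (sum_nonneg fun v _ => mul_nonneg (by norm_num)
    (sum_nonneg fun σ _ => mul_nonneg (sum_nonneg fun t _ => (gibbs_pos _).le) (mul_self_nonneg _)))

theorem gibbs_glauberOp (hn : 1 ≤ n) (f : Config n → ℝ) :
    ∑ σ, gibbs β σ * glauberOp β f σ = ∑ σ, gibbs β σ * f σ := by
  have := gibbs_symm (β := β) hn (fun _ => 1) f
  rw [glauberOp_const hn] at this
  simpa using this

theorem gibbs_neg (σ : Config n) : gibbs β (-σ) = gibbs β σ := by
  simp [gibbs, gibbsWeight]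

/-! ### Functions of the number of plus spins -/

/-- The number of plus spins. -/
def plusCount (σ : Config n) : ℕ := #{i | σ i = 1}

theorem plusCount_le (σ : Config n) : plusCount σ ≤ n := by
  simpa [plusCount] using card_filter_le (univ : Finset (Fin n)) (fun i => σ i = 1)

theorem sum_spin (σ : Config n) : ∑ i, spin (σ i) = 2 * plusCount σ - n := by
  have h : ∀ i, spin (σ i) = 2 * (if σ i = 1 then 1 else 0) - 1 := by
    intro i
    rcases Int.units_eq_one_or (σ i) with h | h <;> rw [h]
    · norm_num
    · rw [if_neg (by decide)]; norm_num
  simp_rw [h, sum_sub_distrib, ← mul_sum]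
  simp [plusCount]

theorem mag_eq (σ : Config n) : mag σ = (n : ℝ)⁻¹ * (2 * plusCount σ - n) := by
  rw [mag, sum_spin]

theorem mag_nonneg_iff (σ : Config n) : 0 ≤ mag σ ↔ n ≤ 2 * plusCount σ := by
  rcases Nat.eq_zero_or_pos n with rfl | hn
  · simp [mag]
  · rw [mag_eq, mul_nonneg_iff_of_pos_left (by positivity), sub_nonneg]
    exact_mod_cast Iff.rfl

theorem plusCount_comp (σ : Config n) (e : Equiv.Perm (Fin n)) :
    plusCount (σ ∘ e) = plusCount σ := by
  have h := sum_spin (σ ∘ e)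
  have h2 : ∑ i, spin ((σ ∘ e) i) = ∑ i, spin (σ i) := Equiv.sum_comp e (fun i => spin (σ i))
  rw [h2, sum_spin] at h
  have : (plusCount σ : ℝ) = plusCount (σ ∘ e) := by linarith
  exact_mod_cast this.symm

theorem plusCount_neg (σ : Config n) : plusCount (-σ) + plusCount σ = n := by
  have h := sum_spin (-σ)
  simp only [Pi.neg_apply, spin_neg, sum_neg_distrib, sum_spin] at h
  have : (plusCount (-σ) : ℝ) + plusCount σ = n := by linarith
  exact_mod_cast this

theorem localField_eq (σ : Config n) (v : Fin n) :
    localField σ v = (n : ℝ)⁻¹ * (2 * plusCount σ - n - spin (σ v)) := by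
  unfold localField
  rw [← sum_spin, ← add_sum_erase _ _ (mem_univ v)]
  ring

theorem spin_update_sum (σ : Config n) (v : Fin n) (s : ℤˣ) :
    2 * (plusCount (Function.update σ v s) : ℝ) = 2 * plusCount σ + spin s - spin (σ v) := by
  have h := sum_spin (Function.update σ v s)
  have h2 := add_sum_erase univ (fun i => spin (σ i)) (mem_univ v)
  rw [sum_spin_update] at h
  rw [sum_spin] at h2
  linarith

theorem plusCount_update_plus {σ : Config n} {v : Fin n} (h : σ v = -1) :
    plusCount (Function.update σ v 1) = plusCount σ + 1 := by
  have := spin_update_sum σ v 1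
  rw [h] at this
  simp only [spin_neg, spin_one] at this
  have : (plusCount (Function.update σ v 1) : ℝ) = plusCount σ + 1 := by linarith
  exact_mod_cast this

theorem plusCount_update_minus {σ : Config n} {v : Fin n} (h : σ v = 1) :
    plusCount (Function.update σ v (-1)) = plusCount σ - 1 := by
  have := spin_update_sum σ v (-1)
  rw [h] at this
  simp only [spin_neg, spin_one] at this
  have : (plusCount (Function.update σ v (-1)) : ℝ) + 1 = plusCount σ := by linarith
  have : plusCount (Function.update σ v (-1)) + 1 = plusCount σ := by exact_mod_cast this
  omega

/-- Probability that the number of plus spins increases. -/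
def upProb (n : ℕ) (β : ℝ) (K : ℕ) : ℝ := (n - K) / n * plusProb (β * (2 * K + 1 - n) / n)

/-- Probability that the number of plus spins decreases. -/
def downProb (n : ℕ) (β : ℝ) (K : ℕ) : ℝ := K / n * plusProb (-(β * (2 * K - 1 - n) / n))

theorem siteAvg_level (γ : ℕ → ℝ) (σ : Config n) (v : Fin n) :
    siteAvg β v (fun η => γ (plusCount η)) σ = γ (plusCount σ) + if σ v = 1
      then plusProb (-(β * (2 * plusCount σ - 1 - n) / n)) *
        (γ (plusCount σ - 1) - γ (plusCount σ))
      else plusProb (β * (2 * plusCount σ + 1 - n) / n) *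
        (γ (plusCount σ + 1) - γ (plusCount σ)) := by
  have hs := Function.update_eq_self v σ
  unfold siteAvg
  rw [sum_units]
  simp only [updateProb_eq, localField_eq]
  rcases Int.units_eq_one_or (σ v) with h | h
  · rw [h] at hs ⊢
    rw [plusCount_update_minus h, hs, if_pos rfl]
    simp only [spin_neg, spin_one]
    have := plusProb_add_neg (β * (2 * plusCount σ - 1 - n) / n)
    have e1 : β * 1 * ((n : ℝ)⁻¹ * (2 * plusCount σ - n - 1)) =
      β * (2 * plusCount σ - 1 - n) / n := by ring
    have e2 : β * -1 * ((n : ℝ)⁻¹ * (2 * plusCount σ - n - 1)) =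
      -(β * (2 * plusCount σ - 1 - n) / n) := by ring
    rw [e1, e2]
    linear_combination γ (plusCount σ) * this
  · rw [h] at hs ⊢
    rw [plusCount_update_plus h, hs, if_neg (by decide)]
    simp only [spin_neg, spin_one]
    have := plusProb_add_neg (β * (2 * plusCount σ + 1 - n) / n)
    have e1 : β * 1 * ((n : ℝ)⁻¹ * (2 * plusCount σ - n - -1)) =
      β * (2 * plusCount σ + 1 - n) / n := by ring
    have e2 : β * -1 * ((n : ℝ)⁻¹ * (2 * plusCount σ - n - -1)) =
      -(β * (2 * plusCount σ + 1 - n) / n) := by ring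
    rw [e1, e2]
    linear_combination γ (plusCount σ) * this

/-- The plus count is a birth-and-death chain. The truncated subtraction at count 0 is harmless
because `downProb` vanishes there. -/
theorem glauberOp_level (hn : 1 ≤ n) (γ : ℕ → ℝ) (σ : Config n) :
    glauberOp β (fun η => γ (plusCount η)) σ = γ (plusCount σ) +
      upProb n β (plusCount σ) * (γ (plusCount σ + 1) - γ (plusCount σ)) +
      downProb n β (plusCount σ) * (γ (plusCount σ - 1) - γ (plusCount σ)) := by
  have hn' : (n : ℝ) ≠ 0 := by positivity
  unfold glauberOp
  simp only [siteAvg_level]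
  rw [sum_add_distrib, sum_ite, sum_const, sum_const, sum_const]
  have h1 : #{i | σ i = 1} = plusCount σ := rfl
  have h2 : (#{i | ¬ σ i = 1} : ℝ) = n - plusCount σ := by
    have := card_filter_add_card_filter_not (s := (univ : Finset (Fin n))) (fun i => σ i = 1)
    rw [card_univ, Fintype.card_fin, h1] at this
    have : (plusCount σ : ℝ) + #{i | ¬ σ i = 1} = n := by exact_mod_cast this
    linarith
  simp only [nsmul_eq_mul, h1, h2, card_univ, Fintype.card_fin]
  unfold upProb downProb
  field_simp
  ring

/-! ### Reflection and the restricted operator -/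

theorem reflect_coe (σ : ConfigPlus n) : reflect σ.1 = σ := by
  unfold reflect
  rw [dif_pos σ.2]

theorem reflect_eq_or (ζ : Config n) : (reflect ζ).1 = ζ ∨ (reflect ζ).1 = -ζ := by
  unfold reflect
  split_ifs <;> simp

theorem mag_comp (σ : Config n) (e : Equiv.Perm (Fin n)) : mag (σ ∘ e) = mag σ := by
  rw [mag_eq, mag_eq, plusCount_comp]

theorem reflect_comp (ζ : Config n) (e : Equiv.Perm (Fin n)) :
    (reflect (ζ ∘ e)).1 = (reflect ζ).1 ∘ e := by
  unfold reflect
  simp only [mag_comp]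
  split_ifs <;> rfl

/-- The restricted dynamics acting on functions. -/
def restrictedOp (β : ℝ) (F : ConfigPlus n → ℝ) (σ : ConfigPlus n) : ℝ :=
  glauberOp β (fun ζ => F (reflect ζ)) σ.1

theorem restrictedGlauber_mulVec (F : ConfigPlus n → ℝ) :
    (restrictedGlauber n β).mulVec F = restrictedOp β F := by
  ext σ
  unfold restrictedOp restrictedGlauber Matrix.mulVec dotProduct
  rw [glauberOp_eq_sum]
  simp_rw [sum_mul]
  rw [sum_comm]
  refine sum_congr rfl fun ζ _ => ?_
  simp [ite_mul]

theorem restrictedGlauber_pow_mulVec (F : ConfigPlus n → ℝ) (t : ℕ) :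
    ((restrictedGlauber n β) ^ t).mulVec F = (restrictedOp β)^[t] F := by
  induction t generalizing F with
  | zero => simp
  | succ t ih =>
    rw [pow_succ, ← Matrix.mulVec_mulVec, ih, restrictedGlauber_mulVec, Function.iterate_succ_apply]

theorem gibbsPlus_sum (F : ConfigPlus n → ℝ) :
    ∑ σ, gibbsPlus n β σ * F σ = ∑ ζ : Config n, gibbs β ζ * F (reflect ζ) := by
  unfold gibbsPlus
  simp_rw [sum_mul]
  rw [sum_comm]
  refine sum_congr rfl fun ζ _ => ?_
  simp [ite_mul]

/-- On even functions the restricted dynamics acts as the Glauber dynamics. -/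
theorem restrictedOp_iterate_even {h : Config n → ℝ} (hh : ∀ σ, h (-σ) = h σ) (t : ℕ) :
    (restrictedOp β)^[t] (fun σ => h σ.1) = fun σ => (glauberOp β)^[t] h σ.1 := by
  induction t generalizing h with
  | zero => rfl
  | succ t ih =>
    rw [Function.iterate_succ_apply, Function.iterate_succ_apply, ← ih]
    · congr 1
      ext σ
      unfold restrictedOp
      congr 1
      ext ζ
      show h (reflect ζ).1 = h ζ
      rcases reflect_eq_or ζ with h1 | h1 <;> rw [h1]
      exact hh ζ
    · intro σ
      rw [glauberOp_neg]
      congr 1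
      ext ζ
      exact hh ζ

/-! ### Contraction under transpositions of sites -/

theorem abs_localField_le (σ : Config n) (v : Fin n) : |localField σ v| ≤ 1 := by
  have hn : 0 < n := Fin.pos v
  unfold localField
  rw [abs_mul, abs_of_nonneg (by positivity : (0 : ℝ) ≤ (n : ℝ)⁻¹), inv_mul_le_iff₀ (by positivity)]
  refine (abs_sum_le_sum_abs _ _).trans ?_
  simp only [abs_spin, sum_const, nsmul_eq_mul, mul_one]
  exact_mod_cast (card_le_univ _).trans (by simp)

theorem updateProb_ge (hβ : 0 ≤ β) (σ : Config n) (v : Fin n) (s : ℤˣ) :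
    Real.exp (-(2 * β)) / 2 ≤ updateProb β σ v s := by
  rw [updateProb_eq]
  apply plusProb_ge hβ
  have h : |β * spin s * localField σ v| ≤ β := by
    rw [abs_mul, abs_mul, abs_spin, mul_one, abs_of_nonneg hβ]
    exact mul_le_of_le_one_right hβ (abs_localField_le σ v)
  exact (abs_le.mp h).1

theorem abs_siteAvg_le {H : Config n → ℝ} {δ : ℝ} (hH : ∀ η, |H η| ≤ δ) (σ : Config n)
    (v : Fin n) : |siteAvg β v H σ| ≤ δ := by
  unfold siteAvg
  refine (abs_sum_le_sum_abs _ _).trans ?_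
  rw [← one_mul δ, ← sum_updateProb σ v, sum_mul]
  refine sum_le_sum fun s _ => ?_
  rw [abs_mul, abs_of_pos (updateProb_pos _ _ _)]
  exact mul_le_mul_of_nonneg_left (hH _) (updateProb_pos _ _ _).le

theorem abs_siteAvg_le_of_eq_zero (hβ : 0 ≤ β) {H : Config n → ℝ} {δ : ℝ} (hH : ∀ η, |H η| ≤ δ)
    (σ : Config n) (v : Fin n) (s : ℤˣ) (h0 : H (Function.update σ v s) = 0) :
    |siteAvg β v H σ| ≤ δ * (1 - Real.exp (-(2 * β)) / 2) := by
  have hδ : 0 ≤ δ := (abs_nonneg _).trans (hH σ)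
  have h1 : siteAvg β v H σ = updateProb β σ v (-s) * H (Function.update σ v (-s)) := by
    unfold siteAvg
    rw [sum_units]
    rcases Int.units_eq_one_or s with rfl | rfl
    · rw [h0]; ring
    · rw [h0, neg_neg]; ring
  have h2 : updateProb β σ v (-s) = 1 - updateProb β σ v s := by
    rw [← sum_updateProb σ v, sum_units]
    rcases Int.units_eq_one_or s with rfl | rfl
    · ring
    · rw [neg_neg]; ring
  rw [h1, abs_mul, abs_of_pos (updateProb_pos _ _ _), mul_comm]
  have := updateProb_ge hβ σ v s
  exact mul_le_mul (hH _) (by linarith) (updateProb_pos _ _ _).le hδ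

/-- The function changes by at most `δ` when the spins at two sites are exchanged. -/
def SwapBound (δ : ℝ) (G : Config n → ℝ) : Prop :=
  ∀ (σ : Config n) (v w : Fin n), |G (σ ∘ Equiv.swap v w) - G σ| ≤ δ

theorem comp_swap_of_eq {σ : Config n} {v w : Fin n} (h : σ v = σ w) :
    σ ∘ Equiv.swap v w = σ := by
  ext i
  simp only [Function.comp_apply, Equiv.swap_apply_def]
  split_ifs with h1 h2
  · rw [h1, h]
  · rw [h2, h]
  · rfl

/-- Let H be the change of G under the swap. H vanishes as soon as the spins at v and w agree. An
update at v or at w makes them agree with probability at least e^{-2β}/2, and each of the two sites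
is chosen with probability 1/n; all other updates keep |H| ≤ δ. -/
theorem SwapBound.glauberOp (hn : 1 ≤ n) (hβ : 0 ≤ β) {δ : ℝ} {G : Config n → ℝ}
    (hG : SwapBound δ G) :
    SwapBound (δ * (1 - Real.exp (-(2 * β)) / n)) (glauberOp β G) := by
  intro σ v w
  have hn' : (1 : ℝ) ≤ n := by exact_mod_cast hn
  have hδ : 0 ≤ δ := (abs_nonneg _).trans (hG σ v w)
  have he : Real.exp (-(2 * β)) ≤ 1 := Real.exp_le_one_iff.mpr (by linarith)
  have he0 := Real.exp_pos (-(2 * β))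
  by_cases hvw : σ v = σ w
  · rw [comp_swap_of_eq hvw, sub_self, abs_zero]
    refine mul_nonneg hδ (sub_nonneg.mpr ?_)
    rw [div_le_one (by linarith)]
    linarith
  · have hne : v ≠ w := fun h => hvw (by rw [h])
    set H : Config n → ℝ := fun η => G (η ∘ Equiv.swap v w) - G η with hH
    have h1 : CurieWeiss.glauberOp β G (σ ∘ Equiv.swap v w) - CurieWeiss.glauberOp β G σ =
        (n : ℝ)⁻¹ * ∑ u, siteAvg β u H σ := by
      rw [glauberOp_comp]
      unfold CurieWeiss.glauberOp
      rw [← mul_sub, ← sum_sub_distrib]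
      congr 1
      refine sum_congr rfl fun u _ => ?_
      unfold siteAvg
      rw [← sum_sub_distrib]
      exact sum_congr rfl fun s _ => by rw [hH]; ring
    have h0 : ∀ η : Config n, η v = η w → H η = 0 := by
      intro η h
      simp only [hH]
      rw [comp_swap_of_eq h, sub_self]
    have hb : ∀ u, |siteAvg β u H σ| ≤ δ * (1 -
        ((if u = v then Real.exp (-(2 * β)) / 2 else 0) +
          (if u = w then Real.exp (-(2 * β)) / 2 else 0))) := by
      intro u
      by_cases huv : u = v
      · subst huv
        rw [if_pos rfl, if_neg hne, add_zero]
        refine abs_siteAvg_le_of_eq_zero hβ (fun η => hG η _ _) σ u (σ w) (h0 _ ?_)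
        rw [Function.update_self, Function.update_of_ne hne.symm]
      · by_cases huw : u = w
        · subst huw
          rw [if_pos rfl, if_neg huv, zero_add]
          refine abs_siteAvg_le_of_eq_zero hβ (fun η => hG η _ _) σ u (σ v) (h0 _ ?_)
          rw [Function.update_self, Function.update_of_ne hne]
        · rw [if_neg huv, if_neg huw, add_zero, sub_zero, mul_one]
          exact abs_siteAvg_le (fun η => hG η _ _) σ u
    rw [h1, abs_mul, abs_of_nonneg (by positivity), inv_mul_le_iff₀ (by linarith)]
    refine (abs_sum_le_sum_abs _ _).trans ((sum_le_sum fun u _ => hb u).trans (le_of_eq ?_))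
    rw [← mul_sum, sum_sub_distrib, sum_add_distrib, sum_ite_eq', sum_ite_eq', if_pos (mem_univ _),
      if_pos (mem_univ _)]
    simp only [sum_const, card_univ, Fintype.card_fin, nsmul_eq_mul, mul_one]
    field_simp
    ring

theorem SwapBound.reflect {δ : ℝ} {G : Config n → ℝ} (hG : SwapBound δ G) :
    SwapBound δ (fun ζ => G (CurieWeiss.reflect ζ).1) := by
  intro σ v w
  simp only [reflect_comp]
  exact hG _ v w

theorem SwapBound.restrictedOp_iterate (hn : 1 ≤ n) (hβ : 0 ≤ β) {δ : ℝ} {F : ConfigPlus n → ℝ}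
    (hF : SwapBound δ (fun ζ => F (CurieWeiss.reflect ζ))) (t : ℕ) :
    SwapBound (δ * (1 - Real.exp (-(2 * β)) / n) ^ t)
      (fun ζ => (restrictedOp β)^[t] F (CurieWeiss.reflect ζ)) := by
  induction t with
  | zero => simpa using hF
  | succ t ih =>
    rw [pow_succ, ← mul_assoc, Function.iterate_succ']
    exact (ih.glauberOp hn hβ).reflect

/-- Distinct configurations with equally many pluses disagree in both directions, at some v and some
w. Swapping these two sites removes disagreements and creates none, so at most k swaps lead from one
to the other. -/
theorem SwapBound.abs_sub_le {δ : ℝ} (hδ : 0 ≤ δ) {G : Config n → ℝ} (hG : SwapBound δ G) (k : ℕ)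
    (σ τ : Config n) (hc : plusCount σ = plusCount τ) (hd : #{i | σ i ≠ τ i} ≤ k) :
    |G σ - G τ| ≤ k * δ := by
  have hsub : ∀ σ τ : Config n, plusCount σ = plusCount τ → σ ≠ τ →
      ∃ v, σ v = 1 ∧ τ v ≠ 1 := by
    intro σ τ hc hne
    by_contra! hcon
    have hs : ({i | σ i = 1} : Finset (Fin n)) ⊆ ({i | τ i = 1} : Finset (Fin n)) := by
      intro i hi
      simp only [mem_filter, mem_univ, true_and] at hi ⊢
      exact hcon i hi
    have heq := eq_of_subset_of_card_le hs hc.ge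
    apply hne
    ext i
    have hi : σ i = 1 ↔ τ i = 1 := by
      have := congrArg (fun s => i ∈ s) heq
      simpa using this
    rcases Int.units_eq_one_or (σ i) with h | h <;> rcases Int.units_eq_one_or (τ i) with h' | h'
    · rw [h, h']
    · have := hi.mp h; rw [this, h]
    · have := hi.mpr h'; rw [this, h']
    · rw [h, h']
  induction k generalizing σ with
  | zero =>
    have : σ = τ := by
      ext i
      by_contra hi
      have hm : i ∈ ({i | σ i ≠ τ i} : Finset (Fin n)) := by
        simp only [mem_filter, mem_univ, true_and]
        exact fun h => hi (by rw [h])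
      have := card_pos.mpr ⟨i, hm⟩
      omega
    simp [this]
  | succ k ih =>
    by_cases hne : σ = τ
    · rw [hne, sub_self, abs_zero]
      positivity
    · obtain ⟨v, hv, hv'⟩ := hsub σ τ hc hne
      obtain ⟨w, hw, hw'⟩ := hsub τ σ hc.symm (Ne.symm hne)
      have hvw : v ≠ w := fun h => hv' (by rw [h, hw])
      have h1 := ih (σ ∘ Equiv.swap v w) (by rw [plusCount_comp, hc]) ?_
      · have h2 := hG σ v w
        rw [abs_sub_comm] at h2
        have h3 := _root_.abs_sub_le (G σ) (G (σ ∘ Equiv.swap v w)) (G τ)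
        push_cast
        linarith
      · rw [← Nat.lt_succ_iff]
        refine lt_of_lt_of_le (card_lt_card ?_) hd
        rw [ssubset_iff_of_subset]
        · refine ⟨v, ?_, ?_⟩
          · simp only [mem_filter, mem_univ, true_and, hv]; exact fun h => hv' h.symm
          · have h1 := (Int.units_eq_one_or (τ v)).resolve_left hv'
            have h2 := (Int.units_eq_one_or (σ w)).resolve_left hw'
            simp [h1, h2]
        · intro i
          simp only [mem_filter, mem_univ, true_and, Function.comp_apply]
          intro hi
          by_cases hiv : i = v
          · subst hiv; rw [hv]; exact fun h => hv' h.symm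
          · by_cases hiw : i = w
            · subst hiw; rw [hw]; exact hw'
            · rwa [Equiv.swap_apply_of_ne_of_ne hiv hiw] at hi

/-! ### Iterates of the Glauber operator -/

theorem glauberOp_iterate_add (t : ℕ) (f g : Config n → ℝ) :
    (glauberOp β)^[t] (f + g) = (glauberOp β)^[t] f + (glauberOp β)^[t] g := by
  induction t generalizing f g with
  | zero => rfl
  | succ t ih => simp only [Function.iterate_succ_apply, glauberOp_add, ih]

theorem glauberOp_iterate_smul (t : ℕ) (c : ℝ) (f : Config n → ℝ) :
    (glauberOp β)^[t] (c • f) = c • (glauberOp β)^[t] f := by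
  induction t generalizing f with
  | zero => rfl
  | succ t ih => simp only [Function.iterate_succ_apply, glauberOp_smul, ih]

theorem glauberOp_iterate_const (hn : 1 ≤ n) (t : ℕ) (c : ℝ) :
    (glauberOp β)^[t] (fun _ : Config n => c) = fun _ => c := by
  induction t with
  | zero => rfl
  | succ t ih => rw [Function.iterate_succ_apply, glauberOp_const hn, ih]

theorem glauberOp_iterate_mono (t : ℕ) {f g : Config n → ℝ} (h : f ≤ g) :
    (glauberOp β)^[t] f ≤ (glauberOp β)^[t] g := by
  induction t generalizing f g with
  | zero => exact h
  | succ t ih => exact ih (glauberOp_mono h)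

theorem gibbs_iterate (hn : 1 ≤ n) (t : ℕ) (f : Config n → ℝ) :
    ∑ σ, gibbs β σ * (glauberOp β)^[t] f σ = ∑ σ, gibbs β σ * f σ := by
  induction t generalizing f with
  | zero => rfl
  | succ t ih => rw [Function.iterate_succ_apply, ih, gibbs_glauberOp hn]

theorem gibbs_iterate_symm (hn : 1 ≤ n) (t : ℕ) (f g : Config n → ℝ) :
    ∑ σ, gibbs β σ * f σ * (glauberOp β)^[t] g σ =
      ∑ σ, gibbs β σ * (glauberOp β)^[t] f σ * g σ := by
  induction t generalizing f g with
  | zero => rfl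
  | succ t ih =>
    rw [Function.iterate_succ_apply, ih, gibbs_symm hn, Function.iterate_succ_apply']

/-- Symmetry moves one factor of P to each side, which lowers the exponent by two; the exponents 0
and 1 are a square and `gibbs_psd`. -/
theorem gibbs_iterate_psd (hn : 1 ≤ n) (t : ℕ) (f : Config n → ℝ) :
    0 ≤ ∑ σ, gibbs β σ * f σ * (glauberOp β)^[t] f σ := by
  induction t using Nat.twoStepInduction generalizing f with
  | zero =>
    exact sum_nonneg fun σ _ => by
      rw [mul_assoc]; exact mul_nonneg (gibbs_pos _).le (mul_self_nonneg _)
  | one => exact gibbs_psd hn f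
  | more t ih _ =>
    rw [Function.iterate_succ_apply', gibbs_symm hn, Function.iterate_succ_apply]
    exact ih _

/-- This is positivity of the quadratic form at f minus its mean. -/
theorem sq_gibbs_le (hn : 1 ≤ n) (t : ℕ) (f : Config n → ℝ) :
    (∑ σ, gibbs β σ * f σ) ^ 2 ≤ ∑ σ, gibbs β σ * f σ * (glauberOp β)^[t] f σ := by
  set c := ∑ σ, gibbs β σ * f σ with hc
  set g : Config n → ℝ := f + fun _ => -c with hg
  have h1 := gibbs_iterate_psd (β := β) hn t g
  have h2 : ∀ σ, gibbs β σ * g σ * (glauberOp β)^[t] g σ =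
      gibbs β σ * f σ * (glauberOp β)^[t] f σ - c * (gibbs β σ * f σ) -
        c * (gibbs β σ * (glauberOp β)^[t] f σ) + c ^ 2 * gibbs β σ := by
    intro σ
    rw [hg, glauberOp_iterate_add, glauberOp_iterate_const hn]
    simp only [Pi.add_apply]
    ring
  simp only [h2, sum_add_distrib, sum_sub_distrib, ← mul_sum] at h1
  rw [gibbs_iterate hn, sum_gibbs, ← hc] at h1
  linarith

/-! ### Even functions of the magnetization -/

/-- Functions of the absolute value of the magnetization. -/
def IsLevel (φ : Config n → ℝ) : Prop :=
  (∀ σ, φ (-σ) = φ σ) ∧ ∃ γ : ℕ → ℝ, φ = fun σ => γ (plusCount σ)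

theorem IsLevel.glauberOp (hn : 1 ≤ n) {φ : Config n → ℝ} (h : IsLevel φ) :
    IsLevel (glauberOp β φ) := by
  obtain ⟨h1, γ, h2⟩ := h
  constructor
  · intro σ
    rw [glauberOp_neg]
    simp only [h1]
  · rw [h2]
    exact ⟨fun K => γ K + upProb n β K * (γ (K + 1) - γ K) + downProb n β K * (γ (K - 1) - γ K),
      funext fun σ => glauberOp_level hn γ σ⟩

theorem IsLevel.iterate (hn : 1 ≤ n) {φ : Config n → ℝ} (h : IsLevel φ) (t : ℕ) :
    IsLevel ((CurieWeiss.glauberOp β)^[t] φ) := by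
  induction t with
  | zero => exact h
  | succ t ih => rw [Function.iterate_succ_apply']; exact ih.glauberOp hn

theorem IsLevel.eq_of {φ : Config n → ℝ} (h : IsLevel φ) {σ τ : Config n}
    (hs : plusCount σ = plusCount τ ∨ plusCount σ = n - plusCount τ) : φ σ = φ τ := by
  obtain ⟨h1, γ, h2⟩ := h
  rcases hs with hs | hs
  · rw [h2]; simp only [hs]
  · have := plusCount_neg τ
    rw [← h1 τ, h2]
    simp only
    congr 1
    omega

theorem IsLevel.of_eq {φ : Config n → ℝ} (h : ∀ σ τ : Config n,
    plusCount σ = plusCount τ ∨ plusCount σ = n - plusCount τ → φ σ = φ τ) : IsLevel φ := by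
  classical
  refine ⟨fun σ => h _ _ ?_, fun K => if hK : ∃ σ : Config n, plusCount σ = K
    then φ hK.choose else 0, ?_⟩
  · have := plusCount_neg σ
    right; omega
  · ext σ
    have hK : ∃ τ : Config n, plusCount τ = plusCount σ := ⟨σ, rfl⟩
    simp only [dif_pos hK]
    exact h _ _ (Or.inl hK.choose_spec.symm)

/-- The two magnetization levels of configurations with `m` plus spins or `m` minus spins. -/
def InLevel (m : ℕ) (σ : Config n) : Prop := plusCount σ = m ∨ plusCount σ = n - m

theorem IsLevel.const_on {φ : Config n → ℝ} (h : IsLevel φ) {m : ℕ} (hm : m ≤ n)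
    {σ τ : Config n} (hσ : InLevel m σ) (hτ : InLevel m τ) : φ σ = φ τ := by
  refine h.eq_of ?_
  unfold InLevel at hσ hτ
  omega

instance (m : ℕ) (σ : Config n) : Decidable (InLevel m σ) :=
  inferInstanceAs (Decidable (_ ∨ _))

/-- The indicator function of `InLevel m`. -/
def levelInd (m : ℕ) (σ : Config n) : ℝ := if InLevel m σ then 1 else 0

theorem isLevel_levelInd {m : ℕ} (hm : m ≤ n) : IsLevel (levelInd m : Config n → ℝ) := by
  apply IsLevel.of_eq
  intro σ τ h
  have : InLevel m σ ↔ InLevel m τ := by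
    have := plusCount_le σ
    have := plusCount_le τ
    unfold InLevel
    omega
  simp only [levelInd, this]

theorem levelInd_nonneg (m : ℕ) (σ : Config n) : 0 ≤ levelInd m σ := by
  unfold levelInd; split_ifs <;> norm_num

/-! ### Hitting times -/

/-- The probability that the Glauber dynamics avoids the level `m` up to time `u`. -/
def avoidProb (β : ℝ) (m : ℕ) : ℕ → Config n → ℝ
  | 0 => fun σ => if InLevel m σ then 0 else 1
  | u + 1 => fun σ => if InLevel m σ then 0 else glauberOp β (avoidProb β m u) σ

theorem avoidProb_of_inLevel {m : ℕ} {σ : Config n} (h : InLevel m σ) (u : ℕ) :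
    avoidProb β m u σ = 0 := by
  cases u <;> simp [avoidProb, h]

theorem avoidProb_nonneg (hn : 1 ≤ n) (m u : ℕ) : 0 ≤ (avoidProb β m u : Config n → ℝ) := by
  induction u with
  | zero => intro σ; simp only [avoidProb, Pi.zero_apply]; split_ifs <;> norm_num
  | succ u ih =>
    intro σ
    simp only [avoidProb, Pi.zero_apply]
    split_ifs
    · norm_num
    · have := glauberOp_mono (β := β) ih σ
      have h0 := congrFun (glauberOp_const (β := β) hn 0) σ
      exact h0.symm.le.trans this

theorem avoidProb_anti (hn : 1 ≤ n) (m : ℕ) : Antitone (avoidProb β m : ℕ → Config n → ℝ) := by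
  refine antitone_nat_of_succ_le fun u => ?_
  induction u with
  | zero =>
    intro σ
    simp only [avoidProb]
    split_ifs
    · norm_num
    · have h1 : (avoidProb β m 0 : Config n → ℝ) ≤ fun _ => 1 := by
        intro σ; simp only [avoidProb]; split_ifs <;> norm_num
      have := glauberOp_mono (β := β) h1 σ
      rw [glauberOp_const hn] at this
      exact this
  | succ u ih =>
    intro σ
    show (if InLevel m σ then 0 else glauberOp β (avoidProb β m (u + 1)) σ) ≤
      (if InLevel m σ then 0 else glauberOp β (avoidProb β m u) σ)
    split_ifs
    · norm_num
    · exact glauberOp_mono ih σ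

/-- The sum of the avoidance probabilities is a truncated expected hitting time, which any
nonnegative g with Pg ≤ g - 1 off the level dominates. -/
theorem sum_avoidProb_le (hn : 1 ≤ n) {m : ℕ} {g : Config n → ℝ} (hg0 : 0 ≤ g)
    (hg : ∀ σ, ¬ InLevel m σ → glauberOp β g σ ≤ g σ - 1) (u : ℕ) :
    ∑ s ∈ range u, avoidProb β m s ≤ g := by
  induction u with
  | zero => simpa using hg0
  | succ u ih =>
    intro σ
    by_cases h : InLevel m σ
    · rw [Finset.sum_apply]
      simp only [avoidProb_of_inLevel h, sum_const_zero]
      exact hg0 σ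
    · have h1 : ∀ k, glauberOp β (∑ s ∈ range k, avoidProb β m s) σ =
          ∑ s ∈ range k, avoidProb β m (s + 1) σ := by
        intro k
        induction k with
        | zero =>
          rw [range_zero, sum_empty, sum_empty]
          exact congrFun (glauberOp_const (β := β) hn 0) σ
        | succ k ihk =>
          rw [sum_range_succ, sum_range_succ, glauberOp_add, Pi.add_apply, ihk]
          simp [avoidProb, h]
      rw [sum_range_succ', Pi.add_apply, Finset.sum_apply, ← h1]
      have h2 := glauberOp_mono (β := β) ih σ
      have h3 := hg σ h
      have h4 : avoidProb β m 0 σ = 1 := by simp [avoidProb, h]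
      linarith

/-- Markov's inequality for the hitting time, using that avoidance probabilities decrease in time.
-/
theorem avoidProb_le_half (hn : 1 ≤ n) {m : ℕ} {g : Config n → ℝ} {H : ℝ} (hg0 : 0 ≤ g)
    (hg : ∀ σ, ¬ InLevel m σ → glauberOp β g σ ≤ g σ - 1) (hH : 0 < H) (hgH : ∀ σ, g σ ≤ H)
    {u : ℕ} (hu : 2 * H ≤ u) (σ : Config n) : avoidProb β m u σ ≤ 1 / 2 := by
  have h1 := sum_avoidProb_le hn hg0 hg u σ
  rw [Finset.sum_apply] at h1
  have h2 : (u : ℝ) * avoidProb β m u σ ≤ ∑ s ∈ range u, avoidProb β m s σ := by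
    have := card_nsmul_le_sum (range u) (fun s => avoidProb β m s σ) (avoidProb β m u σ)
      fun s hs => avoidProb_anti hn m (mem_range.mp hs).le σ
    simpa using this
  have h3 := hgH σ
  have h4 : 0 ≤ avoidProb β m u σ := avoidProb_nonneg hn m u σ
  have h5 : 2 * H * avoidProb β m u σ ≤ u * avoidProb β m u σ :=
    mul_le_mul_of_nonneg_right hu h4
  by_contra! hc
  nlinarith

/-- The strong Markov property at the hitting time: if the level is hit by time u, at least u₀ steps
remain and the bound b applies; otherwise φ ≥ 0 is used. -/
theorem le_iterate_of_le_on_level (hn : 1 ≤ n) {m u₀ : ℕ} {φ : Config n → ℝ} (hφ : 0 ≤ φ)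
    {b : ℝ} (hb : ∀ u ≥ u₀, ∀ σ, InLevel m σ → b ≤ (glauberOp β)^[u] φ σ) (u : ℕ) (σ : Config n) :
    b * (1 - avoidProb β m u σ) ≤ (glauberOp β)^[u₀ + u] φ σ := by
  have hnn : ∀ u, 0 ≤ (glauberOp β)^[u] φ := by
    intro u
    have := glauberOp_iterate_mono (β := β) u hφ
    have h0 := glauberOp_iterate_const (n := n) (β := β) hn u 0
    exact h0.symm.le.trans this
  induction u generalizing σ with
  | zero =>
    by_cases h : InLevel m σ
    · rw [avoidProb_of_inLevel h, sub_zero, mul_one]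
      exact hb _ (by omega) σ h
    · have h4 : avoidProb β m 0 σ = 1 := by simp [avoidProb, h]
      rw [h4, sub_self, mul_zero]
      exact hnn _ σ
  | succ u ih =>
    by_cases h : InLevel m σ
    · rw [avoidProb_of_inLevel h, sub_zero, mul_one]
      exact hb _ (by omega) σ h
    · have h4 : avoidProb β m (u + 1) σ = glauberOp β (avoidProb β m u) σ := by
        simp [avoidProb, h]
      have h5 : (fun _ => b) + (-b) • avoidProb β m u ≤ (glauberOp β)^[u₀ + u] φ := by
        intro τ
        have := ih τ
        simp only [Pi.add_apply, Pi.smul_apply, smul_eq_mul]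
        linarith
      have h6 := glauberOp_mono (β := β) h5 σ
      rw [glauberOp_add, glauberOp_smul, glauberOp_const hn, ← Function.iterate_succ_apply' (glauberOp β)] at h6
      simp only [Pi.add_apply, Pi.smul_apply, smul_eq_mul] at h6
      rw [h4, ← add_assoc]
      linarith

theorem sum_levelInd_mul {m : ℕ} (hm : m ≤ n) {φ : Config n → ℝ} (h : IsLevel φ) {σ : Config n}
    (hσ : InLevel m σ) : ∑ τ, gibbs β τ * levelInd m τ * φ τ =
      (∑ τ : Config n, gibbs β τ * levelInd m τ) * φ σ := by
  rw [sum_mul]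
  refine sum_congr rfl fun τ _ => ?_
  unfold levelInd
  split_ifs with hτ
  · rw [h.const_on hm hτ hσ]
  · simp

/-- A level that is reached quickly from everywhere yields a minorization of the
dynamics of the magnetization by its equilibrium. -/
theorem quarter_le_iterate (hn : 1 ≤ n) {m : ℕ} (hm : m ≤ n) {g : Config n → ℝ} {H : ℝ}
    (hg0 : 0 ≤ g) (hg : ∀ σ, ¬ InLevel m σ → glauberOp β g σ ≤ g σ - 1) (hH : 0 < H)
    (hgH : ∀ σ, g σ ≤ H) {U : ℕ} (hU : 2 * H ≤ U) {φ : Config n → ℝ} (hφ0 : 0 ≤ φ)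
    (hφ : IsLevel φ) (σ : Config n) :
    (∑ τ, gibbs β τ * φ τ) / 4 ≤ (glauberOp β)^[2 * U] φ σ := by
  have havoid : ∀ u : ℕ, U ≤ u → ∀ σ : Config n, avoidProb β m u σ ≤ 1 / 2 := fun u hu σ =>
    avoidProb_le_half hn hg0 hg hH hgH (hU.trans (by exact_mod_cast hu)) σ
  set pA := ∑ τ : Config n, gibbs β τ * levelInd m τ with hpA
  have hpA0 : 0 ≤ pA := sum_nonneg fun τ _ => mul_nonneg (gibbs_pos _).le (levelInd_nonneg _ _)
  have hpos : ∀ σ : Config n, InLevel m σ → 0 < pA := by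
    intro σ hσ
    refine sum_pos' (fun τ _ => mul_nonneg (gibbs_pos _).le (levelInd_nonneg _ _))
      ⟨σ, mem_univ _, ?_⟩
    rw [levelInd, if_pos hσ, mul_one]
    exact gibbs_pos _
  -- The iterate of `levelInd m` is constant on the level, so `sq_gibbs_le` reads pA² ≤ pA · (that
  -- constant).
  have h1 : ∀ u ≥ 0, ∀ σ : Config n, InLevel m σ → pA ≤ (glauberOp β)^[u] (levelInd m) σ := by
    intro u _ σ hσ
    have h2 := sq_gibbs_le (β := β) hn u (levelInd m)
    rw [sum_levelInd_mul hm ((isLevel_levelInd hm).iterate hn u) hσ, ← hpA, sq] at h2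
    exact le_of_mul_le_mul_left h2 (hpos σ hσ)
  have h2 : ∀ u ≥ U, ∀ σ : Config n, pA / 2 ≤ (glauberOp β)^[u] (levelInd m) σ := by
    intro u hu σ
    have h3 := le_iterate_of_le_on_level hn (fun σ => levelInd_nonneg m σ) h1 u σ
    rw [zero_add] at h3
    nlinarith [havoid u hu σ]
  set a := ∑ τ, gibbs β τ * φ τ with ha
  have ha0 : 0 ≤ a := sum_nonneg fun τ _ => mul_nonneg (gibbs_pos _).le (hφ0 τ)
  -- Reversibility: pA times the value of P^u φ on the level is the pairing of φ with P^u of the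
  -- indicator, which is at least pA / 2 everywhere.
  have h3 : ∀ u ≥ U, ∀ σ : Config n, InLevel m σ → a / 2 ≤ (glauberOp β)^[u] φ σ := by
    intro u hu σ hσ
    refine le_of_mul_le_mul_left ?_ (hpos σ hσ)
    rw [hpA, ← sum_levelInd_mul hm (hφ.iterate hn u) hσ, gibbs_iterate_symm hn, ← hpA]
    have : pA * (a / 2) = ∑ τ, gibbs β τ * (pA / 2) * φ τ := by
      rw [show pA * (a / 2) = pA / 2 * a by ring, ha, mul_sum]
      exact sum_congr rfl fun τ _ => by ring
    rw [this]
    refine sum_le_sum fun τ _ => mul_le_mul_of_nonneg_right ?_ (hφ0 τ)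
    exact mul_le_mul_of_nonneg_left (h2 u hu τ) (gibbs_pos _).le
  have h4 := le_iterate_of_le_on_level hn hφ0 h3 U σ
  rw [← two_mul] at h4
  nlinarith [havoid U le_rfl σ]

theorem iterate_level_oscillation (hn : 1 ≤ n) {T : ℕ}
    (hT : ∀ φ : Config n → ℝ, 0 ≤ φ → IsLevel φ → ∀ σ,
      (∑ τ, gibbs β τ * φ τ) / 4 ≤ (glauberOp β)^[T] φ σ)
    {φ : Config n → ℝ} (hφ : IsLevel φ) {lo hi : ℝ} (hlo : ∀ σ, lo ≤ φ σ) (hhi : ∀ σ, φ σ ≤ hi)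
    (k : ℕ) (σ : Config n) :
    |(glauberOp β)^[T * k] φ σ - ∑ τ, gibbs β τ * φ τ| ≤ (3 / 4) ^ k * (hi - lo) := by
  have key : ∃ lo' hi' : ℝ, (∀ σ, lo' ≤ (glauberOp β)^[T * k] φ σ) ∧
      (∀ σ, (glauberOp β)^[T * k] φ σ ≤ hi') ∧ hi' - lo' ≤ (3 / 4) ^ k * (hi - lo) := by
    induction k with
    | zero => exact ⟨lo, hi, by simpa using hlo, by simpa using hhi, by simp⟩
    | succ k ih =>
      obtain ⟨l, h, hl, hh, hlh⟩ := ih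
      set ψ := (glauberOp β)^[T * k] φ with hψ
      have hlev : IsLevel ψ := hφ.iterate hn _
      set a := ∑ τ, gibbs β τ * ψ τ with ha
      -- The minorization is needed for ψ - l and for h - ψ; both have the form s ψ + c with s = ±1.
      have shift : ∀ (s c : ℝ), (∀ σ, 0 ≤ s * ψ σ + c) → ∀ σ, (s * a + c) / 4 ≤
          s * (glauberOp β)^[T] ψ σ + c := by
        intro s c h0 σ
        have := hT (s • ψ + fun _ => c) (fun σ => h0 σ) ?_ σ
        · rw [glauberOp_iterate_add, glauberOp_iterate_smul, glauberOp_iterate_const hn] at this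
          simp only [Pi.add_apply, Pi.smul_apply, smul_eq_mul, mul_add, sum_add_distrib] at this
          rw [← sum_mul, sum_gibbs, one_mul] at this
          rw [ha, mul_sum]
          refine le_trans (le_of_eq ?_) this
          congr 2
          exact sum_congr rfl fun τ _ => by ring
        · obtain ⟨h1, γ, h2⟩ := hlev
          exact ⟨fun σ => by simp only [Pi.add_apply, Pi.smul_apply, h1],
            fun K => s * γ K + c, by rw [h2]; rfl⟩
      have e : (glauberOp β)^[T * (k + 1)] φ = (glauberOp β)^[T] ψ := by
        rw [hψ, ← Function.iterate_add_apply]; congr 1; ring_nf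
      rw [e]
      refine ⟨l + (a - l) / 4, h - (h - a) / 4, fun σ => ?_, fun σ => ?_, ?_⟩
      · have := shift 1 (-l) (fun σ => by linarith [hl σ]) σ
        linarith
      · have := shift (-1) h (fun σ => by linarith [hh σ]) σ
        linarith
      · rw [pow_succ]; linarith
  obtain ⟨l, h, hl, hh, hlh⟩ := key
  rw [← gibbs_iterate hn (T * k) φ]
  have h1 : l ≤ ∑ τ, gibbs β τ * (glauberOp β)^[T * k] φ τ := by
    rw [← one_mul l, ← sum_gibbs (β := β) (n := n), sum_mul]
    exact sum_le_sum fun τ _ => mul_le_mul_of_nonneg_left (hl τ) (gibbs_pos _).le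
  have h2 : ∑ τ, gibbs β τ * (glauberOp β)^[T * k] φ τ ≤ h := by
    rw [← one_mul h, ← sum_gibbs (β := β) (n := n), sum_mul]
    exact sum_le_sum fun τ _ => mul_le_mul_of_nonneg_left (hh τ) (gibbs_pos _).le
  rw [abs_le]
  constructor <;> linarith [hl σ, hh σ]

/-! ### The ratio of transition probabilities across an edge -/

/-- Logarithm of the ratio of the up and down probabilities across the edge centred at `y`, where
`y` is the sum of the spins. -/
def logRatio (n β y : ℝ) : ℝ := 2 * β * y / n + Real.log (n + 1 - y) - Real.log (n + 1 + y)

theorem logRatio_zero (n β : ℝ) : logRatio n β 0 = 0 := by simp [logRatio]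

/-- The derivative is 2β/n - 2(n+1)/((n+1)² - y²), which decreases for y ≥ 0. -/
theorem concaveOn_logRatio {n β : ℝ} (hn : 0 < n) :
    ConcaveOn ℝ (Set.Ico 0 (n + 1)) (logRatio n β) := by
  have hd : ∀ y ∈ Set.Ico (0 : ℝ) (n + 1), HasDerivAt (logRatio n β)
      (2 * β / n - (1 / (n + 1 - y) + 1 / (n + 1 + y))) y := by
    intro y hy
    have h1 : n + 1 - y ≠ 0 := by linarith [hy.2]
    have h2 : n + 1 + y ≠ 0 := by linarith [hy.1]
    have h3 := ((hasDerivAt_id y).const_mul (2 * β)).div_const n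
    have h4 := ((hasDerivAt_id y).const_sub (n + 1)).log h1
    have h5 := ((hasDerivAt_id y).const_add (n + 1)).log h2
    refine ((h3.add h4).sub h5).congr_deriv ?_
    simp only [id]
    field_simp
    ring
  refine AntitoneOn.concaveOn_of_deriv (convex_Ico _ _)
    (fun y hy => (hd y hy).continuousAt.continuousWithinAt)
    (fun y hy => (hd y (interior_subset hy)).differentiableAt.differentiableWithinAt) ?_
  intro x hx y hy hxy
  rw [(hd x (interior_subset hx)).deriv, (hd y (interior_subset hy)).deriv]
  have hx' := interior_subset hx
  have hy' := interior_subset hy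
  rw [Set.mem_Ico] at hx' hy'
  have e : ∀ z ∈ Set.Ico (0 : ℝ) (n + 1), 1 / (n + 1 - z) + 1 / (n + 1 + z) =
      2 * (n + 1) / ((n + 1) ^ 2 - z ^ 2) := by
    intro z hz
    have h1 : n + 1 - z ≠ 0 := by linarith [hz.2]
    have h2 : n + 1 + z ≠ 0 := by linarith [hz.1]
    rw [show (n + 1) ^ 2 - z ^ 2 = (n + 1 - z) * (n + 1 + z) by ring]
    field_simp
    ring
  rw [e x hx', e y hy']
  have h3 : 0 < (n + 1) ^ 2 - y ^ 2 := by nlinarith [hy'.1, hy'.2]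
  have h4 : x ^ 2 ≤ y ^ 2 := by nlinarith [hx'.1]
  gcongr

theorem concaveOn_two_point {f : ℝ → ℝ} {s : Set ℝ} (h : ConcaveOn ℝ s f) {x y a b : ℝ}
    (hx : x ∈ s) (hy : y ∈ s) (ha : 0 ≤ a) (hb : 0 ≤ b) (hab : a + b = 1) :
    a * f x + b * f y ≤ f (a * x + b * y) := h.2 hx hy ha hb hab

/-- The location, as a fraction of `n`, at which the drift is bounded below. -/
def driftPoint (β : ℝ) : ℝ := (β - 1) / (2 * β)

/-- A lower bound for `logRatio` at `driftPoint`. -/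
def driftBound (β : ℝ) : ℝ := 2 * β * driftPoint β - 2 * driftPoint β / (1 - driftPoint β)

theorem driftPoint_pos {β : ℝ} (hβ : 1 < β) : 0 < driftPoint β :=
  div_pos (by linarith) (by linarith)

theorem driftPoint_lt_one {β : ℝ} (hβ : 1 < β) : driftPoint β < 1 := by
  unfold driftPoint
  rw [div_lt_one (by linarith)]
  linarith

/-- With u = `driftPoint β` one has β(1 - u) = (β + 1)/2 > 1, which is exactly 2βu > 2u/(1 - u).
This is where supercriticality enters. -/
theorem driftBound_pos {β : ℝ} (hβ : 1 < β) : 0 < driftBound β := by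
  have h0 := driftPoint_pos hβ
  have h1 := driftPoint_lt_one hβ
  unfold driftBound
  rw [sub_pos, div_lt_iff₀ (by linarith)]
  have h2 : β * (1 - driftPoint β) = (β + 1) / 2 := by
    unfold driftPoint
    have : β ≠ 0 := by linarith
    field_simp
    ring
  have h3 : 2 * β * driftPoint β * (1 - driftPoint β) =
      2 * driftPoint β * (β * (1 - driftPoint β)) := by ring
  rw [h3, h2]
  nlinarith

theorem driftBound_le_logRatio {n β : ℝ} (hβ : 1 < β) (hn : 0 < n) :
    driftBound β ≤ logRatio n β (driftPoint β * n) := by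
  have h0 := driftPoint_pos hβ
  have h1 := driftPoint_lt_one hβ
  set u := driftPoint β with hu
  have h2 : 0 < n + 1 - u * n := by nlinarith
  have h3 : 0 < n + 1 + u * n := by positivity
  unfold driftBound logRatio
  rw [← hu]
  have e1 : 2 * β * (u * n) / n = 2 * β * u := by field_simp
  have h4 : Real.log (n + 1 + u * n) - Real.log (n + 1 - u * n) ≤ 2 * u / (1 - u) := by
    rw [← Real.log_div h3.ne' h2.ne']
    refine (Real.log_le_sub_one_of_pos (div_pos h3 h2)).trans ?_
    have : (n + 1 + u * n) / (n + 1 - u * n) - 1 = 2 * (u * n) / (n + 1 - u * n) := by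
      rw [div_sub_one h2.ne']; ring
    rw [this, div_le_div_iff₀ h2 (by linarith)]
    nlinarith
  rw [e1]
  linarith

/-! ### Linear bounds on the log ratio from concavity -/

section ThreePoint

variable {n β : ℝ}

/-- Concavity on the chord from the zero at 0 to the drift point. -/
theorem le_logRatio_of_le_driftPoint (hβ : 1 < β) (hn : 0 < n) {y : ℝ} (hy0 : 0 ≤ y)
    (hy : y ≤ driftPoint β * n) : driftBound β * y / n ≤ logRatio n β y := by
  have h0 := driftPoint_pos hβ
  have h1 := driftPoint_lt_one hβ
  have hk := driftBound_pos hβ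
  have hb := driftBound_le_logRatio hβ hn
  set u := driftPoint β with hu
  have hun : 0 < u * n := by positivity
  have hc := concaveOn_two_point (concaveOn_logRatio (β := β) hn) (x := 0) (y := u * n) ⟨le_rfl, by linarith⟩
    ⟨hun.le, by nlinarith⟩ (a := 1 - y / (u * n)) (b := y / (u * n))
    (by rw [sub_nonneg, div_le_one hun]; exact hy) (by positivity) (by ring)
  simp only [mul_zero, zero_add, logRatio_zero] at hc
  rw [div_mul_cancel₀ _ hun.ne'] at hc
  refine le_trans ?_ hc
  have h3 : y / n ≤ y / (u * n) := by
    apply div_le_div_of_nonneg_left hy0 hun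
    nlinarith
  calc driftBound β * y / n = y / n * driftBound β := by ring
    _ ≤ y / (u * n) * logRatio n β (u * n) := by
        apply mul_le_mul h3 hb hk.le (by positivity)

/-- Concavity on the chord from the drift point to z, where the value is nonnegative. -/
theorem le_logRatio_of_driftPoint_le (hβ : 1 < β) (hn : 0 < n) {y z : ℝ}
    (hy : driftPoint β * n ≤ y) (hyz : y ≤ z) (hzn : z ≤ n) (hz : 0 ≤ logRatio n β z) :
    driftBound β * (z - y) / n ≤ logRatio n β y := by
  have h0 := driftPoint_pos hβ
  have h1 := driftPoint_lt_one hβ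
  have hk := driftBound_pos hβ
  have hb := driftBound_le_logRatio hβ hn
  set u := driftPoint β with hu
  have hun : 0 < u * n := by positivity
  rcases hyz.eq_or_lt with rfl | hlt
  · simpa using hz
  have hd : 0 < z - u * n := by linarith
  have hc := concaveOn_two_point (concaveOn_logRatio (β := β) hn) (x := u * n) (y := z)
    ⟨hun.le, by nlinarith⟩ ⟨by linarith, by linarith⟩
    (a := (z - y) / (z - u * n)) (b := (y - u * n) / (z - u * n))
    (div_nonneg (by linarith) hd.le) (div_nonneg (by linarith) hd.le)
    (by rw [← add_div, div_eq_one_iff_eq hd.ne']; ring)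
  have e : (z - y) / (z - u * n) * (u * n) + (y - u * n) / (z - u * n) * z = y := by
    field_simp; ring
  rw [e] at hc
  refine le_trans ?_ hc
  have h3 : (z - y) / n ≤ (z - y) / (z - u * n) :=
    div_le_div_of_nonneg_left (by linarith) hd (by linarith)
  have h4 : 0 ≤ (y - u * n) / (z - u * n) * logRatio n β z :=
    mul_nonneg (div_nonneg (by linarith) hd.le) hz
  have h5 : (z - y) / n * driftBound β ≤ (z - y) / (z - u * n) * logRatio n β (u * n) :=
    mul_le_mul h3 hb hk.le (div_nonneg (by linarith) hd.le)
  calc driftBound β * (z - y) / n = (z - y) / n * driftBound β := by ring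
    _ ≤ _ := by linarith

/-- Here z lies on the chord from the drift point to y. A concave function that falls from at least
`driftBound β` to at most 0 at z must keep falling at that slope or faster. -/
theorem logRatio_le_of_neg (hβ : 1 < β) (hn : 0 < n) {y z : ℝ}
    (hz : driftPoint β * n ≤ z) (hzy : z ≤ y) (hyn : y ≤ n) (hz0 : logRatio n β z ≤ 0) :
    logRatio n β y ≤ -(driftBound β * (y - z) / n) := by
  have h0 := driftPoint_pos hβ
  have h1 := driftPoint_lt_one hβ
  have hk := driftBound_pos hβ
  have hb := driftBound_le_logRatio hβ hn
  set u := driftPoint β with hu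
  have hun : 0 < u * n := by positivity
  have hne : u * n ≠ z := by
    intro h; rw [h] at hb; linarith
  have hzu : 0 < z - u * n := by
    rcases hz.lt_or_eq with h | h
    · linarith
    · exact absurd h hne
  have hd : 0 < y - u * n := by linarith
  have hc := concaveOn_two_point (concaveOn_logRatio (β := β) hn) (x := u * n) (y := y)
    ⟨hun.le, by nlinarith⟩ ⟨by linarith, by linarith⟩
    (a := (y - z) / (y - u * n)) (b := (z - u * n) / (y - u * n))
    (div_nonneg (by linarith) hd.le) (div_nonneg (by linarith) hd.le)
    (by rw [← add_div, div_eq_one_iff_eq hd.ne']; ring)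
  have e : (y - z) / (y - u * n) * (u * n) + (z - u * n) / (y - u * n) * y = z := by
    field_simp; ring
  rw [e] at hc
  have h2 : (y - z) / (y - u * n) * logRatio n β (u * n) +
      (z - u * n) / (y - u * n) * logRatio n β y ≤ 0 := hc.trans hz0
  have h3 : (y - z) * logRatio n β (u * n) + (z - u * n) * logRatio n β y ≤ 0 := by
    have := mul_le_mul_of_nonneg_right h2 hd.le
    rw [zero_mul, add_mul] at this
    field_simp at this
    linarith
  rw [← neg_div, le_div_iff₀ hn]
  have h4 : (y - z) * driftBound β ≤ (y - z) * logRatio n β (u * n) :=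
    mul_le_mul_of_nonneg_left hb (by linarith)
  have h5 : logRatio n β y ≤ 0 := by
    by_contra! h
    nlinarith [mul_pos hzu h, mul_nonneg (sub_nonneg.mpr hzy) hk.le]
  have h6 : logRatio n β y * n ≤ logRatio n β y * (z - u * n) :=
    mul_le_mul_of_nonpos_left (by linarith) h5
  linarith

end ThreePoint

/-! ### Edge ratios and the attracting level -/

/-- Ratio of the up probability at `K` and the down probability at `K + 1`. -/
def edgeRatio (n : ℕ) (β : ℝ) (K : ℕ) : ℝ :=
  (n - K) / (K + 1) * Real.exp (2 * β * (2 * K + 1 - n) / n)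

theorem upProb_eq (n : ℕ) (β : ℝ) (K : ℕ) :
    upProb n β K = edgeRatio n β K * downProb n β (K + 1) := by
  unfold upProb downProb edgeRatio
  have h : plusProb (β * (2 * K + 1 - n) / n) = Real.exp (2 * β * (2 * K + 1 - n) / n) *
      plusProb (-(β * (2 * K + 1 - n) / n)) := by
    unfold plusProb
    rw [neg_neg, add_comm (Real.exp (-_)), ← mul_div_assoc, ← Real.exp_add]
    congr 2
    ring
  push_cast
  have e : β * (2 * ((K : ℝ) + 1) - 1 - n) / n = β * (2 * K + 1 - n) / n := by ring
  rw [e, h]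
  have : (K : ℝ) + 1 ≠ 0 := by positivity
  field_simp

theorem edgeRatio_eq_exp {n : ℕ} {β : ℝ} {K : ℕ} (hK : K < n) :
    edgeRatio n β K = Real.exp (logRatio n β (2 * K + 1 - n)) := by
  have hK' : (K : ℝ) < n := by exact_mod_cast hK
  have h1 : (0 : ℝ) < n + 1 - (2 * K + 1 - n) := by linarith
  have h2 : (0 : ℝ) < n + 1 + (2 * K + 1 - n) := by ring_nf; positivity
  unfold logRatio edgeRatio
  rw [add_sub_assoc (_ / _), Real.exp_add, ← Real.log_div h1.ne' h2.ne', Real.exp_log (div_pos h1 h2),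
    mul_comm]
  congr 1
  rw [div_eq_div_iff (by positivity) h2.ne']
  ring

/-- The drift of the number of plus spins towards a level `M`. -/
structure DriftsTo (n : ℕ) (β : ℝ) (M : ℕ) : Prop where
  le : M ≤ n
  half_lt : n + 1 ≤ 2 * M
  low : ∀ K : ℕ, n ≤ 2 * K → K + 1 < M → (2 * K + 1 - n : ℝ) ≤ driftPoint β * n →
    Real.exp (driftBound β * (2 * K + 1 - n) / n) ≤ edgeRatio n β K
  mid : ∀ K : ℕ, K + 1 < M → driftPoint β * n ≤ (2 * K + 1 - n : ℝ) →
    Real.exp (driftBound β * (2 * (M - 1 - K)) / n) ≤ edgeRatio n β K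
  high : ∀ K : ℕ, M < K → K < n →
    edgeRatio n β K ≤ Real.exp (-(driftBound β * (2 * (K - M)) / n))
  last : 1 ≤ edgeRatio n β (M - 1)

theorem exists_driftsTo {n : ℕ} {β : ℝ} (hβ : 1 < β) (hn : 2 ≤ n) (hu : 1 ≤ driftPoint β * n) :
    ∃ M, DriftsTo n β M := by
  have hn0 : (0 : ℝ) < n := by positivity
  have hk := driftBound_pos hβ
  -- The argument 2K - 1 - n is the centre of the edge from K - 1 to K, so the greatest such K is
  -- the upper endpoint of the last edge with ratio at least 1.
  let P : ℕ → Prop := fun K => n + 1 ≤ 2 * K ∧ 0 ≤ logRatio n β (2 * K - 1 - n)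
  classical
  -- This is the smallest K allowed by the first condition; its edge centre lies in [0, 1], hence
  -- below the drift point by `hu`.
  have hP : P ((n + 2) / 2) := by
    refine ⟨by omega, ?_⟩
    have h1 : (0 : ℝ) ≤ 2 * ((n + 2) / 2 : ℕ) - 1 - n := by
      have : n + 1 ≤ 2 * ((n + 2) / 2) := by omega
      have : (n : ℝ) + 1 ≤ 2 * ((n + 2) / 2 : ℕ) := by exact_mod_cast this
      linarith
    have h2 : 2 * ((n + 2) / 2 : ℕ) - 1 - n ≤ (1 : ℝ) := by
      have : 2 * ((n + 2) / 2) ≤ n + 2 := by omega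
      have : 2 * (((n + 2) / 2 : ℕ) : ℝ) ≤ n + 2 := by exact_mod_cast this
      linarith
    refine le_trans ?_ (le_logRatio_of_le_driftPoint hβ hn0 h1 (h2.trans hu))
    positivity
  set M := Nat.findGreatest P n with hM
  have hMn : M ≤ n := Nat.findGreatest_le n
  have hPM : P M := Nat.findGreatest_spec (by omega : (n + 2) / 2 ≤ n) hP
  have hMn' : (M : ℝ) ≤ n := by exact_mod_cast hMn
  have hM1 : (n : ℝ) + 1 ≤ 2 * M := by exact_mod_cast hPM.1
  have hlast : M < n → logRatio n β (2 * M + 1 - n) < 0 := by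
    intro h
    by_contra! hc
    have : P (M + 1) := ⟨by omega, by push_cast; ring_nf at hc ⊢; exact hc⟩
    have := Nat.le_findGreatest (n := n) h this
    omega
  refine ⟨M, hMn, hPM.1, fun K hK hKM hy => ?_, fun K hKM hy => ?_, fun K hMK hKn => ?_, ?_⟩
  · rw [edgeRatio_eq_exp (by omega)]
    apply Real.exp_le_exp.mpr
    apply le_logRatio_of_le_driftPoint hβ hn0 _ hy
    have : (n : ℝ) ≤ 2 * K := by exact_mod_cast hK
    linarith
  · rw [edgeRatio_eq_exp (by omega)]
    apply Real.exp_le_exp.mpr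
    have h1 : (K : ℝ) + 1 < M := by exact_mod_cast hKM
    have := le_logRatio_of_driftPoint_le hβ hn0 hy (z := 2 * M - 1 - n) (by linarith)
      (by linarith) hPM.2
    convert this using 3
    ring
  · rw [edgeRatio_eq_exp hKn]
    apply Real.exp_le_exp.mpr
    have h1 : (M : ℝ) + 1 ≤ K := by exact_mod_cast hMK
    have h2 : (K : ℝ) + 1 ≤ n := by exact_mod_cast hKn
    have hl := hlast (by omega)
    have := logRatio_le_of_neg hβ hn0 (z := 2 * M + 1 - n) (y := 2 * K + 1 - n) ?_ (by linarith)
      (by linarith) hl.le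
    · convert this using 4
      ring
    -- If the edge above M were centred before the drift point, its log ratio would be nonnegative,
    -- against the maximality of M.
    · by_contra! hc
      have := le_logRatio_of_le_driftPoint hβ hn0 (y := 2 * M + 1 - n) (by linarith) hc.le
      have h3 : 0 ≤ driftBound β * (2 * M + 1 - n) / n :=
        div_nonneg (mul_nonneg hk.le (by linarith)) hn0.le
      linarith
  · have h1 : 1 ≤ M := by omega
    rw [edgeRatio_eq_exp (by omega)]
    apply Real.one_le_exp
    have := hPM.2
    push_cast [Nat.cast_sub h1]
    ring_nf at this ⊢
    exact this

/-! ### Growth of the hitting-time recursion -/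

/-- The barrier C n / d survives one step of the recursion as the distance d to the target drops by
one: the factor 1/(1 + κd/n) saves Cκ/(1 + κd/n), which is at least the added 1. -/
theorem inv_growth_step {κ n C d e ρ : ℝ} (hκ : 0 < κ) (hn : 0 < n) (hd : 0 < d) (hdn : d ≤ n)
    (hC : (1 + κ) / κ ≤ C) (hρ0 : 0 ≤ ρ) (hρ : ρ ≤ 1 / (1 + κ * d / n)) (he : e ≤ C * n / (d + 1)) :
    1 + ρ * e ≤ C * n / d := by
  have hC0 : 0 < C := lt_of_lt_of_le (by positivity) hC
  have h1 : e ≤ C * n / d := he.trans (by gcongr; linarith)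
  have h2 : ρ * e ≤ 1 / (1 + κ * d / n) * (C * n / d) :=
    (mul_le_mul_of_nonneg_left h1 hρ0).trans (by gcongr)
  have h3 : 1 + κ * d / n ≤ 1 + κ := by
    have : κ * d / n ≤ κ := by rw [div_le_iff₀ hn]; nlinarith
    linarith
  have h4 : C * n / d - 1 / (1 + κ * d / n) * (C * n / d) = C * κ / (1 + κ * d / n) := by
    field_simp
    ring
  have h5 : 1 ≤ C * κ / (1 + κ * d / n) := by
    rw [le_div_iff₀ (by positivity), one_mul]
    rw [div_le_iff₀ hκ] at hC
    linarith
  linarith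

/-- Since the coefficients are at most 1, e k ≤ k + 1, which is enough up to distance of order √n
from the middle. Beyond that the drift κx/n is strong enough to preserve the barrier C n / x as x
increases. -/
theorem growth_below {κ n : ℝ} {e ρ : ℕ → ℝ} {L k₀ : ℕ} (hκ : 0 < κ) (hn : 1 ≤ n)
    (hL : (L : ℝ) ≤ n) (he0 : e 0 = 1) (he : ∀ k, e (k + 1) = 1 + ρ k * e k) (hρ0 : ∀ k, 0 ≤ ρ k)
    (hρ : ∀ k, k + 1 < L → k < k₀ → ρ k ≤ 1 / (1 + κ * (k + 1) / n)) (k : ℕ) (hk : k < L)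
    (hk₀ : k ≤ k₀) : e k ≤ k + 1 ∧ e k ≤ 16 * (1 + κ) / κ * n / (k + 1) := by
  induction k with
  | zero =>
    refine ⟨by simp [he0], ?_⟩
    rw [he0]
    have : 1 ≤ 16 * (1 + κ) / κ := by rw [le_div_iff₀ hκ]; linarith
    simp only [Nat.cast_zero, zero_add, div_one]
    nlinarith
  | succ k ih =>
    obtain ⟨h1, h2⟩ := ih (by omega) (by omega)
    have h3 := hρ k hk (by omega)
    have hx : (0 : ℝ) < k + 1 := by positivity
    have hxn : (k : ℝ) + 1 ≤ n := by
      refine le_trans ?_ hL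
      exact_mod_cast (by omega : k + 1 ≤ L)
    have hz : 0 ≤ κ * (k + 1) / n := by positivity
    have h4 : ρ k ≤ 1 := h3.trans (by rw [div_le_one (by linarith)]; linarith)
    have h5 : e (k + 1) ≤ k + 1 + 1 := by
      rw [he]
      nlinarith [hρ0 k]
    push_cast
    refine ⟨h5, ?_⟩
    set x : ℝ := k + 1 with hxdef
    -- In the first case (x + 1)² ≤ 4x² ≤ 16n/κ, so the trivial bound lies below the barrier; this
    -- is the source of the 16.
    by_cases hc : κ * x ^ 2 ≤ 4 * n
    · refine h5.trans ?_
      rw [le_div_iff₀ (by positivity), div_mul_eq_mul_div, le_div_iff₀ hκ]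
      have : 1 ≤ x := by rw [hxdef]; linarith [(Nat.cast_nonneg k : (0 : ℝ) ≤ k)]
      nlinarith [mul_pos hκ hx]
    · push Not at hc
      set C := 16 * (1 + κ) / κ with hC
      have hC0 : 0 < C := by positivity
      have h6 : ρ k * e k ≤ 1 / (1 + κ * x / n) * (C * n / x) :=
        (mul_le_mul_of_nonneg_left h2 (hρ0 k)).trans (by gcongr)
      rw [he]
      have h7 : κ * x / n ≤ κ := by rw [div_le_iff₀ (by linarith)]; nlinarith
      have h8 : C * n / (x + 1) - 1 / (1 + κ * x / n) * (C * n / x) =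
          C * (κ * x ^ 2 - n) / (x * (x + 1) * (1 + κ * x / n)) := by
        have : n ≠ 0 := by linarith
        have : n + κ * x ≠ 0 := by positivity
        field_simp
        ring
      have h9 : 1 ≤ C * (κ * x ^ 2 - n) / (x * (x + 1) * (1 + κ * x / n)) := by
        rw [le_div_iff₀ (by positivity), one_mul]
        have h10 : x * (x + 1) * (1 + κ * x / n) ≤ 2 * x ^ 2 * (1 + κ) := by
          have : 1 ≤ x := by rw [hxdef]; linarith [(Nat.cast_nonneg k : (0 : ℝ) ≤ k)]
          apply mul_le_mul _ (by linarith) (by positivity) (by positivity)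
          nlinarith
        have h11 : C * (κ * x ^ 2 / 2) ≤ C * (κ * x ^ 2 - n) := by
          apply mul_le_mul_of_nonneg_left _ hC0.le
          linarith
        have h12 : C * (κ * x ^ 2 / 2) = 8 * (1 + κ) * x ^ 2 := by
          rw [hC]; field_simp; ring
        nlinarith [mul_pos (by positivity : 0 < 1 + κ) (by positivity : 0 < x ^ 2)]
      linarith

theorem growth_inv {κ n C : ℝ} {e ρ : ℕ → ℝ} {L k₀ : ℕ} (hκ : 0 < κ) (hn : 1 ≤ n)
    (hL : (L : ℝ) ≤ n) (hC : (1 + κ) / κ ≤ C) (he0 : e k₀ ≤ C)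
    (he : ∀ k, e (k + 1) = 1 + ρ k * e k) (hρ0 : ∀ k, 0 ≤ ρ k)
    (hρ : ∀ k, k + 1 < L → k₀ ≤ k → ρ k ≤ 1 / (1 + κ * (L - 1 - k) / n)) (k : ℕ) (hk : k < L)
    (hk₀ : k₀ ≤ k) : e k ≤ C * n / (L - k) := by
  have hC0 : 0 < C := lt_of_lt_of_le (by positivity) hC
  induction k, hk₀ using Nat.le_induction with
  | base =>
    refine he0.trans ?_
    have h1 : (k₀ : ℝ) < L := by exact_mod_cast hk
    rw [le_div_iff₀ (by linarith)]
    apply mul_le_mul_of_nonneg_left _ hC0.le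
    linarith [(Nat.cast_nonneg k₀ : (0 : ℝ) ≤ k₀)]
  | succ k hk' ih =>
    rw [he]
    have h1 : (k : ℝ) + 1 < L := by exact_mod_cast hk
    push_cast
    rw [show (L : ℝ) - (k + 1) = L - 1 - k by ring]
    refine inv_growth_step hκ (by linarith) (by linarith)
      (by linarith [(Nat.cast_nonneg k : (0 : ℝ) ≤ k)]) hC (hρ0 k) (hρ k hk hk') ?_
    have := ih (by omega)
    rwa [show (L : ℝ) - 1 - k + 1 = L - k by ring]

/-- The solution of `e (k + 1) = 1 + ρ k * e k` with `e 0 = 1`. -/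
def growth (ρ : ℕ → ℝ) : ℕ → ℝ
  | 0 => 1
  | k + 1 => 1 + ρ k * growth ρ k

theorem growth_nonneg {ρ : ℕ → ℝ} (h : ∀ k, 0 ≤ ρ k) (k : ℕ) : 0 ≤ growth ρ k := by
  induction k with
  | zero => exact zero_le_one
  | succ k ih => exact add_nonneg zero_le_one (mul_nonneg (h k) ih)

theorem sum_range_inv_le (L n : ℕ) (hL : L ≤ n) :
    ∑ k ∈ range L, 1 / ((k : ℝ) + 1) ≤ 1 + Real.log n := by
  have h := harmonic_le_one_add_log n
  refine le_trans ?_ h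
  rw [harmonic]
  push_cast
  refine (sum_le_sum_of_subset_of_nonneg (range_mono hL) fun _ _ _ => by positivity).trans
    (le_of_eq ?_)
  exact sum_congr rfl fun k _ => by rw [one_div]

theorem sum_range_inv_sub_le (L n : ℕ) (hL : L ≤ n) :
    ∑ k ∈ range L, 1 / ((L : ℝ) - k) ≤ 1 + Real.log n := by
  rw [← sum_range_reflect]
  refine le_trans (le_of_eq (sum_congr rfl fun k hk => ?_)) (sum_range_inv_le L n hL)
  have : k + 1 ≤ L := mem_range.mp hk
  rw [show L - 1 - k = L - (k + 1) by omega, Nat.cast_sub this]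
  push_cast
  ring_nf

/-! ### Crossing times and the hitting-time supersolution -/

section Supersolution

variable {n : ℕ} {β : ℝ} {M : ℕ}

/-- Coefficients of the recursion for upward crossing times below `M`. -/
def lowCoeff (n : ℕ) (β : ℝ) (M k : ℕ) : ℝ :=
  if k + 1 < M - (n + 1) / 2 then (edgeRatio n β ((n + 1) / 2 + k))⁻¹ else 0

/-- Coefficients of the recursion for downward crossing times above `M`. -/
def highCoeff (n : ℕ) (β : ℝ) (M k : ℕ) : ℝ :=
  if k + 1 < n - M then edgeRatio n β (n - (k + 1)) else 0

theorem edgeRatio_nonneg {K : ℕ} (hK : K ≤ n) : 0 ≤ edgeRatio n β K := by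
  have : (K : ℝ) ≤ n := by exact_mod_cast hK
  unfold edgeRatio
  exact mul_nonneg (div_nonneg (by linarith) (by positivity)) (Real.exp_pos _).le

theorem lowCoeff_nonneg (hM : M ≤ n) (k : ℕ) : 0 ≤ lowCoeff n β M k := by
  unfold lowCoeff
  split_ifs with h
  · exact inv_nonneg.mpr (edgeRatio_nonneg (by omega))
  · exact le_rfl

theorem highCoeff_nonneg (k : ℕ) : 0 ≤ highCoeff n β M k := by
  unfold highCoeff
  split_ifs with h
  · exact edgeRatio_nonneg (by omega)
  · exact le_rfl

theorem exp_neg_le_inv {x z : ℝ} (hx : 0 ≤ z) (hz : z ≤ x) : Real.exp (-x) ≤ 1 / (1 + z) := by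
  rw [Real.exp_neg, one_div]
  apply inv_anti₀ (by linarith)
  linarith [Real.add_one_le_exp x]

/-- Constant in the bounds for the crossing times. -/
def crossConst (β : ℝ) : ℝ :=
  16 * (1 + driftBound β) / driftBound β * (1 + 2 / driftPoint β)

theorem base_le_crossConst (hβ : 1 < β) :
    16 * (1 + driftBound β) / driftBound β ≤ crossConst β := by
  have h0 := driftPoint_pos hβ
  have hk := driftBound_pos hβ
  unfold crossConst
  refine le_mul_of_one_le_right (by positivity) ?_
  linarith [(by positivity : 0 ≤ 2 / driftPoint β)]

theorem inv_growth_le_crossConst (hβ : 1 < β) :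
    (1 + driftBound β) / driftBound β ≤ crossConst β := by
  refine le_trans ?_ (base_le_crossConst hβ)
  have hk := driftBound_pos hβ
  rw [div_le_div_iff_of_pos_right hk]
  linarith

/-- Let k₀ be the first index whose edge lies beyond the drift point. Up to k₀ the drift grows with
the distance from the middle (`growth_below`); from k₀ on it is governed by the distance to M
(`growth_inv`). Because k₀ + 1 ≥ `driftPoint β` * n / 2, the value at k₀ is bounded, which explains
the last factor in `crossConst`. -/
theorem growth_lowCoeff_le (hβ : 1 < β) (hn : 1 ≤ n) (D : DriftsTo n β M) {k : ℕ}
    (hk : k < M - (n + 1) / 2) :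
    growth (lowCoeff n β M) k ≤ crossConst β * n *
      (1 / ((k : ℝ) + 1) + 1 / ((M - (n + 1) / 2 : ℕ) - (k : ℝ))) := by
  have h0 := driftPoint_pos hβ
  have hκ := driftBound_pos hβ
  have hMn := D.le
  have hn1 : (1 : ℝ) ≤ n := by exact_mod_cast hn
  set L := M - (n + 1) / 2 with hL
  have hLn : (L : ℝ) ≤ n := by exact_mod_cast (by omega : L ≤ n)
  have hC0 : 0 < crossConst β := lt_of_lt_of_le (by positivity) (base_le_crossConst hβ)
  have hex : ∃ k : ℕ, driftPoint β * n ≤ 2 * (((n + 1) / 2 + k : ℕ) : ℝ) + 1 - n := by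
    refine ⟨⌈driftPoint β * n⌉₊, ?_⟩
    have h1 := Nat.le_ceil (driftPoint β * n)
    have h2 : (n : ℝ) ≤ 2 * ((n + 1) / 2 : ℕ) := by
      exact_mod_cast (by omega : n ≤ 2 * ((n + 1) / 2))
    push_cast
    linarith [(Nat.cast_nonneg _ : (0 : ℝ) ≤ (⌈driftPoint β * n⌉₊ : ℝ))]
  classical
  set k₀ := Nat.find hex with hk₀
  have hc1 : (n : ℝ) ≤ 2 * ((n + 1) / 2 : ℕ) := by
    exact_mod_cast (by omega : n ≤ 2 * ((n + 1) / 2))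
  have hc2 : 2 * ((n + 1) / 2 : ℕ) ≤ (n : ℝ) + 1 := by
    exact_mod_cast (by omega : 2 * ((n + 1) / 2) ≤ n + 1)
  have hspec := Nat.find_spec hex
  rw [← hk₀] at hspec
  rw [Nat.cast_add] at hspec
  have hlow : ∀ k, k + 1 < L → k < k₀ →
      lowCoeff n β M k ≤ 1 / (1 + driftBound β * (k + 1) / n) := by
    intro k hk hkk
    have h1 := Nat.find_min hex hkk
    push Not at h1
    have h2 := D.low ((n + 1) / 2 + k) (by omega) (by omega) h1.le
    rw [lowCoeff, if_pos hk]
    have h3 : (edgeRatio n β ((n + 1) / 2 + k))⁻¹ ≤ _ := inv_anti₀ (Real.exp_pos _) h2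
    rw [← Real.exp_neg] at h3
    refine h3.trans (exp_neg_le_inv (by positivity) ?_)
    gcongr
    rw [Nat.cast_add]
    linarith [(Nat.cast_nonneg k : (0 : ℝ) ≤ k)]
  have hmid : ∀ k, k + 1 < L → k₀ ≤ k →
      lowCoeff n β M k ≤ 1 / (1 + driftBound β * (L - 1 - k) / n) := by
    intro k hk hkk
    have hkk' : (k₀ : ℝ) ≤ k := by exact_mod_cast hkk
    have h2 := D.mid ((n + 1) / 2 + k) (by omega) (by rw [Nat.cast_add]; linarith)
    rw [lowCoeff, if_pos hk]
    have h3 : (edgeRatio n β ((n + 1) / 2 + k))⁻¹ ≤ _ := inv_anti₀ (Real.exp_pos _) h2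
    rw [← Real.exp_neg] at h3
    have hLk : (k : ℝ) + 1 < L := by exact_mod_cast hk
    have hLM : (L : ℝ) + ((n + 1) / 2 : ℕ) = M := by
      exact_mod_cast (by omega : L + (n + 1) / 2 = M)
    refine h3.trans (exp_neg_le_inv (div_nonneg (mul_nonneg hκ.le (by linarith)) (by linarith)) ?_)
    gcongr
    rw [Nat.cast_add]
    linarith
  have hbelow := fun k hk hk' => growth_below (e := growth (lowCoeff n β M)) (k₀ := k₀) hκ hn1 hLn
    rfl (fun _ => rfl) (lowCoeff_nonneg hMn) hlow k hk hk'
  have hkL : (k : ℝ) < L := by exact_mod_cast hk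
  have hp1 : 0 ≤ crossConst β * n * (1 / ((k : ℝ) + 1)) := by positivity
  have hp2 : 0 ≤ crossConst β * n * (1 / ((L : ℝ) - k)) :=
    mul_nonneg (by positivity) (div_nonneg zero_le_one (by linarith))
  rw [mul_add]
  rcases le_total k k₀ with h | h
  · have h1 := (hbelow k hk h).2
    have h2 : 16 * (1 + driftBound β) / driftBound β * n / (k + 1) ≤
        crossConst β * n * (1 / ((k : ℝ) + 1)) := by
      rw [mul_one_div]
      have := base_le_crossConst hβ
      gcongr
    linarith
  · have hb : growth (lowCoeff n β M) k₀ ≤ crossConst β := by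
      refine (hbelow k₀ (by omega) le_rfl).2.trans ?_
      unfold crossConst
      rw [mul_div_assoc]
      apply mul_le_mul_of_nonneg_left _ (by positivity)
      have h3 : driftPoint β * n ≤ 2 * (k₀ + 1) := by linarith
      have : (n : ℝ) / (k₀ + 1) ≤ 2 / driftPoint β := by
        rw [div_le_div_iff₀ (by positivity) h0]
        linarith
      linarith
    have h1 := growth_inv hκ hn1 hLn (inv_growth_le_crossConst hβ) hb (fun _ => rfl)
      (lowCoeff_nonneg hMn) hmid k hk h
    rw [← mul_one_div] at h1
    linarith

theorem growth_highCoeff_le (hβ : 1 < β) (hn : 1 ≤ n) (D : DriftsTo n β M) {k : ℕ}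
    (hk : k < n - M) :
    growth (highCoeff n β M) k ≤ crossConst β * n * (1 / ((n - M : ℕ) - (k : ℝ))) := by
  have h0 := driftPoint_pos hβ
  have hκ := driftBound_pos hβ
  have hn1 : (1 : ℝ) ≤ n := by exact_mod_cast hn
  have hLn : ((n - M : ℕ) : ℝ) ≤ n := by exact_mod_cast (by omega : n - M ≤ n)
  rw [mul_one_div]
  refine growth_inv (k₀ := 0) hκ hn1 hLn (inv_growth_le_crossConst hβ) ?_ (fun _ => rfl)
    highCoeff_nonneg ?_ k hk (Nat.zero_le _)
  · show (1 : ℝ) ≤ _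
    refine le_trans ?_ (base_le_crossConst hβ)
    rw [le_div_iff₀ hκ]
    linarith
  · intro k hk _
    rw [highCoeff, if_pos hk]
    refine (D.high (n - (k + 1)) (by omega) (by omega)).trans ?_
    have h1 : ((n - (k + 1) : ℕ) : ℝ) = n - (k + 1) := by
      rw [Nat.cast_sub (by omega)]; push_cast; ring
    have h2 : ((n - M : ℕ) : ℝ) = n - M := Nat.cast_sub D.le
    have h3 : (k : ℝ) + 1 < (n - M : ℕ) := by exact_mod_cast hk
    rw [h2] at h3 ⊢
    rw [h1]
    refine exp_neg_le_inv (div_nonneg (mul_nonneg hκ.le (by linarith)) (by linarith)) ?_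
    gcongr
    linarith

theorem half_le_plusProb {θ : ℝ} (h : 0 ≤ θ) : 1 / 2 ≤ plusProb θ := by
  have h1 := plusProb_add_neg θ
  have h2 : plusProb (-θ) ≤ plusProb θ := plusProb_mono (by linarith)
  linarith

/-- The condition `last` forces (n - M + 1)/M ≥ e^{-2β}, so a positive fraction of minus spins
remains below M; the field is nonnegative there, so an update yields plus with probability at least
1/2. -/
theorem upProb_ge (hβ : 1 < β) (hn : 1 ≤ n) (D : DriftsTo n β M) {K : ℕ} (hK : n ≤ 2 * K)
    (hKM : K < M) : Real.exp (-(2 * β)) / 4 ≤ upProb n β K := by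
  have hn0 : (0 : ℝ) < n := by positivity
  have h1 := D.last
  have hM := D.half_lt
  have hMn := D.le
  have hM' : (n : ℝ) + 1 ≤ 2 * M := by exact_mod_cast hM
  have hMn' : (M : ℝ) ≤ n := by exact_mod_cast hMn
  have hKM' : (K : ℝ) + 1 ≤ M := by exact_mod_cast hKM
  have hK' : (n : ℝ) ≤ 2 * K := by exact_mod_cast hK
  unfold edgeRatio at h1
  rw [Nat.cast_sub (by omega)] at h1
  push_cast at h1
  have h2 : Real.exp (2 * β * (2 * ((M : ℝ) - 1) + 1 - n) / n) ≤ Real.exp (2 * β) := by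
    apply Real.exp_le_exp.mpr
    rw [div_le_iff₀ hn0]
    nlinarith
  have h3 : 1 ≤ ((n : ℝ) - (M - 1)) / (M - 1 + 1) * Real.exp (2 * β) :=
    h1.trans (mul_le_mul_of_nonneg_left h2 (div_nonneg (by linarith) (by linarith)))
  have h4 : Real.exp (-(2 * β)) ≤ ((n : ℝ) - (M - 1)) / M := by
    rw [Real.exp_neg]
    rw [sub_add_cancel] at h3
    exact (inv_le_iff_one_le_mul₀ (Real.exp_pos _)).mpr h3
  have h5 : Real.exp (-(2 * β)) / 2 ≤ ((n : ℝ) - K) / n := by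
    rw [le_div_iff₀ (by linarith)] at h4
    rw [le_div_iff₀ hn0]
    have := Real.exp_pos (-(2 * β))
    nlinarith
  have h6 : 1 / 2 ≤ plusProb (β * (2 * K + 1 - n) / n) :=
    half_le_plusProb (div_nonneg (mul_nonneg (by linarith) (by linarith)) hn0.le)
  unfold upProb
  calc Real.exp (-(2 * β)) / 4 = Real.exp (-(2 * β)) / 2 * (1 / 2) := by ring
    _ ≤ _ := mul_le_mul h5 h6 (by norm_num) ((by positivity : _ ≤ _).trans h5)

theorem downProb_ge (hβ : 1 < β) (hn : 1 ≤ n) {K : ℕ} (hK : n ≤ 2 * K) (hKn : K ≤ n) :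
    Real.exp (-(2 * β)) / 4 ≤ downProb n β K := by
  have hn0 : (0 : ℝ) < n := by positivity
  have hK' : (n : ℝ) ≤ 2 * K := by exact_mod_cast hK
  have hKn' : (K : ℝ) ≤ n := by exact_mod_cast hKn
  have h5 : 1 / 2 ≤ (K : ℝ) / n := by
    rw [le_div_iff₀ hn0]; linarith
  have h6 : Real.exp (-(2 * β)) / 2 ≤ plusProb (-(β * (2 * K - 1 - n) / n)) := by
    apply plusProb_ge (by linarith)
    rw [neg_le_neg_iff, div_le_iff₀ hn0]
    nlinarith
  unfold downProb
  calc Real.exp (-(2 * β)) / 4 = 1 / 2 * (Real.exp (-(2 * β)) / 2) := by ring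
    _ ≤ _ := mul_le_mul h5 h6 (by positivity) ((by positivity : (0 : ℝ) ≤ 1 / 2).trans h5)

/-- Time to reach `M` from `K`, as a sum of crossing times. -/
def hitTime (n : ℕ) (β : ℝ) (M K : ℕ) : ℝ :=
  ∑ k ∈ Ico K M, growth (lowCoeff n β M) (k - (n + 1) / 2) / upProb n β k +
    ∑ k ∈ Ico M K, growth (highCoeff n β M) (n - (k + 1)) / downProb n β (k + 1)

theorem hitTime_nonneg (hM : M ≤ n) {K : ℕ} (hK : K ≤ n) : 0 ≤ hitTime n β M K := by
  refine add_nonneg (sum_nonneg fun k hk => div_nonneg (growth_nonneg (lowCoeff_nonneg hM) _) ?_)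
    (sum_nonneg fun k hk => div_nonneg (growth_nonneg highCoeff_nonneg _) ?_)
  · have : (k : ℝ) ≤ n := by
      exact_mod_cast (by have := (mem_Ico.mp hk).2; omega : k ≤ n)
    exact mul_nonneg (div_nonneg (by linarith) (by positivity)) (plusProb_pos _).le
  · exact mul_nonneg (by positivity) (plusProb_pos _).le

/-- The jump probabilities are bounded below, so crossing times are comparable to `growth`, whose
bounds add up to two harmonic sums below M and one above. -/
theorem hitTime_le (hβ : 1 < β) (hn : 1 ≤ n) (D : DriftsTo n β M) {K : ℕ} (hK : n ≤ 2 * K)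
    (hKn : K ≤ n) :
    hitTime n β M K ≤ 12 * Real.exp (2 * β) * crossConst β * (n * (1 + Real.log n)) := by
  have hMn := D.le
  have hM2 := D.half_lt
  have hκ := driftBound_pos hβ
  have hC0 : 0 < crossConst β := lt_of_lt_of_le (by positivity) (base_le_crossConst hβ)
  have hdiv : ∀ x p : ℝ, 0 ≤ x → Real.exp (-(2 * β)) / 4 ≤ p →
      x / p ≤ 4 * Real.exp (2 * β) * x := by
    intro x p hx hp
    have h1 : 0 < Real.exp (-(2 * β)) / 4 := by positivity
    rw [div_le_iff₀ (by linarith)]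
    have h2 : Real.exp (2 * β) * Real.exp (-(2 * β)) = 1 := by
      rw [← Real.exp_add]; simp
    have h3 : 1 ≤ 4 * Real.exp (2 * β) * p := by
      have := mul_le_mul_of_nonneg_left hp (by positivity : 0 ≤ 4 * Real.exp (2 * β))
      nlinarith
    nlinarith
  have hlow : ∑ k ∈ Ico K M, growth (lowCoeff n β M) (k - (n + 1) / 2) / upProb n β k ≤
      8 * Real.exp (2 * β) * crossConst β * (n * (1 + Real.log n)) := by
    calc ∑ k ∈ Ico K M, growth (lowCoeff n β M) (k - (n + 1) / 2) / upProb n β k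
        ≤ ∑ k ∈ Ico K M, 4 * Real.exp (2 * β) *
            growth (lowCoeff n β M) (k - (n + 1) / 2) := by
          refine sum_le_sum fun k hk => hdiv _ _ (growth_nonneg (lowCoeff_nonneg hMn) _) ?_
          have := mem_Ico.mp hk
          exact upProb_ge hβ hn D (by omega) this.2
      _ ≤ ∑ k ∈ Ico ((n + 1) / 2) M, 4 * Real.exp (2 * β) *
            growth (lowCoeff n β M) (k - (n + 1) / 2) := by
          refine sum_le_sum_of_subset_of_nonneg (Ico_subset_Ico_left (by omega)) fun k _ _ => ?_
          exact mul_nonneg (by positivity) (growth_nonneg (lowCoeff_nonneg hMn) _)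
      _ = ∑ j ∈ range (M - (n + 1) / 2), 4 * Real.exp (2 * β) *
            growth (lowCoeff n β M) j := by
          rw [sum_Ico_eq_sum_range]
          exact sum_congr rfl fun j _ => by rw [Nat.add_sub_cancel_left]
      _ ≤ ∑ j ∈ range (M - (n + 1) / 2), 4 * Real.exp (2 * β) * (crossConst β * n *
            (1 / ((j : ℝ) + 1) + 1 / ((M - (n + 1) / 2 : ℕ) - (j : ℝ)))) := by
          refine sum_le_sum fun j hj => mul_le_mul_of_nonneg_left
            (growth_lowCoeff_le hβ hn D (mem_range.mp hj)) (by positivity)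
      _ = 4 * Real.exp (2 * β) * (crossConst β * n *
            (∑ j ∈ range (M - (n + 1) / 2), 1 / ((j : ℝ) + 1) +
             ∑ j ∈ range (M - (n + 1) / 2), 1 / ((M - (n + 1) / 2 : ℕ) - (j : ℝ)))) := by
          rw [← mul_sum, ← mul_sum, sum_add_distrib]
      _ ≤ 4 * Real.exp (2 * β) * (crossConst β * n *
            ((1 + Real.log n) + (1 + Real.log n))) := by
          gcongr
          · exact sum_range_inv_le _ n (by omega)
          · exact sum_range_inv_sub_le _ n (by omega)
      _ = _ := by ring
  have hhigh : ∑ k ∈ Ico M K, growth (highCoeff n β M) (n - (k + 1)) / downProb n β (k + 1) ≤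
      4 * Real.exp (2 * β) * crossConst β * (n * (1 + Real.log n)) := by
    calc ∑ k ∈ Ico M K, growth (highCoeff n β M) (n - (k + 1)) / downProb n β (k + 1)
        ≤ ∑ k ∈ Ico M K, 4 * Real.exp (2 * β) * (crossConst β * n * (1 / (k + 1 - M))) := by
          refine sum_le_sum fun k hk => ?_
          have hk' := mem_Ico.mp hk
          refine (hdiv _ _ (growth_nonneg highCoeff_nonneg _)
            (downProb_ge hβ hn (by omega) (by omega))).trans
            (mul_le_mul_of_nonneg_left ?_ (by positivity))
          refine (growth_highCoeff_le hβ hn D (by omega)).trans (le_of_eq ?_)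
          rw [Nat.cast_sub D.le, Nat.cast_sub (by omega)]
          push_cast
          ring_nf
      _ ≤ ∑ k ∈ Ico M n, 4 * Real.exp (2 * β) * (crossConst β * n * (1 / (k + 1 - M))) := by
          refine sum_le_sum_of_subset_of_nonneg (Ico_subset_Ico_right hKn) fun k hk _ => ?_
          have : (M : ℝ) ≤ k := by exact_mod_cast (mem_Ico.mp hk).1
          have : 0 ≤ 1 / ((k : ℝ) + 1 - M) := div_nonneg zero_le_one (by linarith)
          positivity
      _ = 4 * Real.exp (2 * β) * (crossConst β * n *
            ∑ j ∈ range (n - M), 1 / ((j : ℝ) + 1)) := by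
          rw [sum_Ico_eq_sum_range, ← mul_sum, ← mul_sum]
          congr 2
          refine sum_congr rfl fun j _ => ?_
          push_cast
          ring_nf
      _ ≤ 4 * Real.exp (2 * β) * (crossConst β * n * (1 + Real.log n)) := by
          gcongr
          exact sum_range_inv_le _ n (by omega)
      _ = _ := by ring
  unfold hitTime
  linarith

theorem downProb_pos {K : ℕ} (hK : 1 ≤ K) (hn : 1 ≤ n) : 0 < downProb n β K := by
  unfold downProb
  exact mul_pos (by positivity) (plusProb_pos _)

theorem upProb_pos {K : ℕ} (hK : K < n) : 0 < upProb n β K := by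
  have : (K : ℝ) < n := by exact_mod_cast hK
  unfold upProb
  refine mul_pos (div_pos (by linarith) (by linarith [(Nat.cast_nonneg K : (0 : ℝ) ≤ K)]))
    (plusProb_pos _)

theorem hitTime_sub_of_lt {K : ℕ} (hK : K < M) :
    hitTime n β M (K + 1) - hitTime n β M K =
      -(growth (lowCoeff n β M) (K - (n + 1) / 2) / upProb n β K) := by
  unfold hitTime
  rw [sum_eq_sum_Ico_succ_bot hK, Ico_eq_empty_of_le hK.le, Ico_eq_empty_of_le (by omega : K + 1 ≤ M)]
  simp

theorem hitTime_sub_of_le {K : ℕ} (hK : M ≤ K) :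
    hitTime n β M (K + 1) - hitTime n β M K =
      growth (highCoeff n β M) (n - (K + 1)) / downProb n β (K + 1) := by
  unfold hitTime
  rw [sum_Ico_succ_top hK, Ico_eq_empty_of_le hK, Ico_eq_empty_of_le (by omega : M ≤ K + 1)]
  simp

/-- If h_K is the crossing time from K to K + 1, then p_K h_K = 1 + q_K h_{K-1}. As q_K / p_{K-1} is
the inverse edge ratio, this is the recursion for `growth` with value p_K h_K. The maximum folds a
step below the middle back by symmetry. -/
theorem hitTime_drift_low (hn : 1 ≤ n) (D : DriftsTo n β M) {K : ℕ} (hK : n ≤ 2 * K)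
    (hKM : K < M) :
    upProb n β K * (hitTime n β M (K + 1) - hitTime n β M K) + downProb n β K *
      (hitTime n β M (max (K - 1) (n - (K - 1))) - hitTime n β M K) ≤ -1 := by
  have hMn := D.le
  have hp := upProb_pos (β := β) (by omega : K < n)
  have hq := downProb_pos (β := β) (by omega : 1 ≤ K) hn
  have h1 := hitTime_sub_of_lt (n := n) (β := β) hKM
  have hg := growth_nonneg (lowCoeff_nonneg (β := β) hMn) (K - (n + 1) / 2)
  have h2 : upProb n β K * (hitTime n β M (K + 1) - hitTime n β M K) =
      -growth (lowCoeff n β M) (K - (n + 1) / 2) := by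
    rw [h1]; field_simp
  rw [h2]
  by_cases hc : n ≤ 2 * (K - 1)
  · rw [max_eq_left (by omega)]
    obtain ⟨j, rfl⟩ : ∃ j, K = j + 1 := ⟨K - 1, by omega⟩
    rw [Nat.add_sub_cancel] at hc ⊢
    have h3 := hitTime_sub_of_lt (n := n) (β := β) (by omega : j < M)
    have hpj := upProb_pos (β := β) (by omega : j < n)
    have h4 : hitTime n β M j - hitTime n β M (j + 1) =
      growth (lowCoeff n β M) (j - (n + 1) / 2) / upProb n β j := by linarith
    rw [h4]
    have h5 : j + 1 - (n + 1) / 2 = j - (n + 1) / 2 + 1 := by omega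
    rw [h5, growth, lowCoeff, if_pos (by omega), show (n + 1) / 2 + (j - (n + 1) / 2) = j by omega]
    have h6 := upProb_eq n β j
    have h7 : 0 < edgeRatio n β j := by
      by_contra! h
      nlinarith
    rw [h6]
    field_simp
    linarith
  -- At the middle the folded state is K for odd n and K + 1 for even n, so a down step does not
  -- increase the time to M.
  · have h3 : hitTime n β M (max (K - 1) (n - (K - 1))) ≤ hitTime n β M K := by
      have : max (K - 1) (n - (K - 1)) = K ∨ max (K - 1) (n - (K - 1)) = K + 1 := by omega
      rcases this with h | h
      · rw [h]
      · rw [h]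
        have : 0 ≤ growth (lowCoeff n β M) (K - (n + 1) / 2) / upProb n β K :=
          div_nonneg hg hp.le
        linarith
    have h4 : 1 ≤ growth (lowCoeff n β M) (K - (n + 1) / 2) := by
      rcases K - (n + 1) / 2 with _ | j
      · exact le_rfl
      · rw [growth]
        have := mul_nonneg (lowCoeff_nonneg (β := β) hMn j)
          (growth_nonneg (lowCoeff_nonneg (β := β) hMn) j)
        linarith
    nlinarith

theorem hitTime_drift_high (hn : 1 ≤ n) (D : DriftsTo n β M) {K : ℕ} (hKM : M < K) (hKn : K ≤ n) :
    upProb n β K * (hitTime n β M (K + 1) - hitTime n β M K) + downProb n β K *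
      (hitTime n β M (K - 1) - hitTime n β M K) ≤ -1 := by
  have hM2 := D.half_lt
  have hq := downProb_pos (β := β) (by omega : 1 ≤ K) hn
  have h2 : downProb n β K * (hitTime n β M (K - 1) - hitTime n β M K) =
      -growth (highCoeff n β M) (n - K) := by
    obtain ⟨j, rfl⟩ : ∃ j, K = j + 1 := ⟨K - 1, by omega⟩
    have h1 := hitTime_sub_of_le (n := n) (β := β) (by omega : M ≤ j)
    rw [Nat.add_sub_cancel, ← neg_sub, h1]
    field_simp
  rw [h2]
  -- At K = n there is no up step, matching the initial value 1 of `growth`.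
  rcases hKn.eq_or_lt with rfl | hlt
  · have : upProb K β K = 0 := by simp [upProb]
    rw [this, Nat.sub_self]
    simp [growth]
  · rw [hitTime_sub_of_le (by omega), upProb_eq]
    have hq' := downProb_pos (β := β) (by omega : 1 ≤ K + 1) hn
    have h5 : n - K = n - (K + 1) + 1 := by omega
    rw [h5, growth, highCoeff, if_pos (by omega), show n - (n - (K + 1) + 1) = K by omega]
    field_simp
    linarith

end Supersolution

/-- Some level is reached from everywhere within expected time of order `n log n`. -/
theorem exists_supersolution {β : ℝ} (hβ : 1 < β) : ∃ C : ℝ, 0 < C ∧ ∀ n : ℕ, 2 ≤ n →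
    1 ≤ driftPoint β * n → ∃ m ≤ n, ∃ g : Config n → ℝ, 0 ≤ g ∧
      (∀ σ, ¬ InLevel m σ → glauberOp β g σ ≤ g σ - 1) ∧
      ∀ σ, g σ ≤ C * (n * (1 + Real.log n)) := by
  have hκ := driftBound_pos hβ
  have hC0 : 0 < crossConst β := lt_of_lt_of_le (by positivity) (base_le_crossConst hβ)
  refine ⟨12 * Real.exp (2 * β) * crossConst β, by positivity, fun n hn hu => ?_⟩
  obtain ⟨M, D⟩ := exists_driftsTo hβ hn hu
  have hMn := D.le
  have hM2 := D.half_lt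
  set γ : ℕ → ℝ := fun K => hitTime n β M (max K (n - K)) with hγ
  refine ⟨M, hMn, fun σ => γ (plusCount σ), fun σ => ?_, ?_, fun σ => ?_⟩
  · have := plusCount_le σ
    exact hitTime_nonneg hMn (by omega)
  · have key : ∀ σ : Config n, n ≤ 2 * plusCount σ → ¬ InLevel M σ →
        glauberOp β (fun σ => γ (plusCount σ)) σ ≤ γ (plusCount σ) - 1 := by
      intro σ hK hσ
      rw [glauberOp_level (by omega)]
      have hKn := plusCount_le σ
      set K := plusCount σ with hKdef
      have hne : K ≠ M := fun h => hσ (Or.inl h)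
      have e1 : γ K = hitTime n β M K := by
        simp only [hγ]; rw [max_eq_left (by omega)]
      have e2 : γ (K + 1) = hitTime n β M (K + 1) := by
        simp only [hγ]; rw [max_eq_left (by omega)]
      rw [e1, e2]
      rcases lt_or_gt_of_ne hne with h | h
      · have := hitTime_drift_low (by omega) D hK h
        simp only [hγ]
        linarith
      · have := hitTime_drift_high (by omega) D h hKn
        have e3 : γ (K - 1) = hitTime n β M (K - 1) := by
          simp only [hγ]; rw [max_eq_left (by omega)]
        rw [e3]
        linarith
    have hγs : ∀ σ : Config n, γ (plusCount (-σ)) = γ (plusCount σ) := by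
      intro σ
      have := plusCount_neg σ
      simp only [hγ]
      congr 1
      omega
    intro σ hσ
    have hneg := plusCount_neg σ
    by_cases h : n ≤ 2 * plusCount σ
    · exact key σ h hσ
    · have h1 := key (-σ) (by omega) (by unfold InLevel at hσ ⊢; omega)
      rw [glauberOp_neg] at h1
      simp only [hγs] at h1
      exact h1
  · have := plusCount_le σ
    exact hitTime_le hβ (by omega) D (by omega) (by omega)

/-! ### Finite Markov chains -/

section Chain

variable {X : Type*} [Fintype X]

/-- The sign of μ - ν is the extremal test function. -/
theorem tvDist_le_of_forall {μ ν : X → ℝ} {b : ℝ}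
    (h : ∀ F : X → ℝ, (∀ x, |F x| ≤ 1) → ∑ x, μ x * F x - ∑ x, ν x * F x ≤ 2 * b) :
    tvDist μ ν ≤ b := by
  have h1 := h (fun x => if 0 ≤ μ x - ν x then 1 else -1)
    (fun x => by split_ifs <;> simp)
  rw [← sum_sub_distrib] at h1
  have h2 : ∑ x, |μ x - ν x| ≤ 2 * b := by
    refine le_trans (le_of_eq (sum_congr rfl fun x _ => ?_)) h1
    split_ifs with hx
    · rw [abs_of_nonneg hx]; ring
    · rw [abs_of_neg (not_le.mp hx)]; ring
  unfold tvDist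
  linarith

theorem sub_le_tvDist {μ ν : X → ℝ} {F : X → ℝ} (hF : ∀ x, |F x| ≤ 1) :
    ∑ x, μ x * F x - ∑ x, ν x * F x ≤ 2 * tvDist μ ν := by
  unfold tvDist
  rw [← sum_sub_distrib, ← mul_assoc, mul_one_div_cancel two_ne_zero, one_mul]
  refine sum_le_sum fun x _ => ?_
  rw [← sub_mul]
  refine (le_abs_self _).trans ?_
  rw [abs_mul]
  exact mul_le_of_le_one_right (abs_nonneg _) (hF x)

theorem sum_mul_mem_of_bounds {π G : X → ℝ} {lo hi : ℝ} (h0 : ∀ x, 0 ≤ π x) (h1 : ∑ x, π x = 1)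
    (hG : ∀ x, lo ≤ G x ∧ G x ≤ hi) : lo ≤ ∑ x, π x * G x ∧ ∑ x, π x * G x ≤ hi := by
  constructor
  · rw [← one_mul lo, ← h1, sum_mul]
    exact sum_le_sum fun x _ => mul_le_mul_of_nonneg_left (hG x).1 (h0 x)
  · rw [← one_mul hi, ← h1, sum_mul]
    exact sum_le_sum fun x _ => mul_le_mul_of_nonneg_left (hG x).2 (h0 x)

theorem IsStationary.sum_mulVec {P : Matrix X X ℝ} {π : X → ℝ} (h : IsStationary P π)
    (F : X → ℝ) : ∑ x, π x * P.mulVec F x = ∑ x, π x * F x := by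
  simp only [Matrix.mulVec, dotProduct, mul_sum]
  rw [sum_comm]
  refine sum_congr rfl fun y _ => ?_
  rw [← h.2.2 y, sum_mul]
  exact sum_congr rfl fun x _ => by ring

variable [DecidableEq X]

theorem tvDist_le_worstDist (P : Matrix X X ℝ) (π : X → ℝ) (t : ℕ) (x : X) :
    tvDist (fun y => (P ^ t) x y) π ≤ worstDist P π t :=
  le_ciSup (f := fun x => tvDist (fun y => (P ^ t) x y) π) (Set.finite_range _).bddAbove x

theorem worstDist_le [Nonempty X] {P : Matrix X X ℝ} {π : X → ℝ} {t : ℕ} {b : ℝ}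
    (h : ∀ (F : X → ℝ), (∀ x, |F x| ≤ 1) → ∀ x,
      ((P ^ t).mulVec F) x - ∑ y, π y * F y ≤ 2 * b) : worstDist P π t ≤ b :=
  ciSup_le fun x => tvDist_le_of_forall fun F hF => h F hF x

theorem IsStationary.sum_pow_mulVec {P : Matrix X X ℝ} {π : X → ℝ} (h : IsStationary P π)
    (t : ℕ) (F : X → ℝ) : ∑ x, π x * (P ^ t).mulVec F x = ∑ x, π x * F x := by
  induction t generalizing F with
  | zero => simp
  | succ t ih => rw [pow_succ, ← Matrix.mulVec_mulVec, ih, h.sum_mulVec]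

/-- Doeblin's condition gives geometric decay of oscillations. -/
theorem exists_oscillation_of_doeblin {Q : Matrix X X ℝ} {ε : ℝ} {y₀ : X}
    (h0 : ∀ x y, 0 ≤ Q x y) (h1 : ∀ x, ∑ y, Q x y = 1) (hε : ∀ x, ε ≤ Q x y₀)
    {F : X → ℝ} (hF : ∀ x, |F x| ≤ 1) (k : ℕ) :
    ∃ lo hi : ℝ, hi - lo ≤ (1 - ε) ^ k * 2 ∧
      ∀ x, lo ≤ (Q ^ k).mulVec F x ∧ (Q ^ k).mulVec F x ≤ hi := by
  induction k with
  | zero => exact ⟨-1, 1, by norm_num, fun x => by simpa using abs_le.mp (hF x)⟩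
  | succ k ih =>
    obtain ⟨lo, hi, hd, hb⟩ := ih
    have hε1 : ε ≤ 1 := (hε y₀).trans ((single_le_sum (fun y _ => h0 y₀ y) (mem_univ y₀)).trans
      (h1 y₀).le)
    set G := (Q ^ k).mulVec F with hG
    refine ⟨lo + ε * (G y₀ - lo), hi - ε * (hi - G y₀), ?_, fun x => ?_⟩
    · rw [pow_succ]
      nlinarith
    · rw [pow_succ', ← Matrix.mulVec_mulVec, ← hG]
      have hsum : ∀ c : ℝ, ∑ y, Q x y * (G y - c) = Q.mulVec G x - c := by
        intro c
        simp only [mul_sub, sum_sub_distrib, ← sum_mul, h1, one_mul]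
        rfl
      constructor
      · have h2 := single_le_sum (fun y _ => mul_nonneg (h0 x y) (sub_nonneg.mpr (hb y).1))
          (mem_univ y₀)
        rw [hsum] at h2
        have := mul_le_mul_of_nonneg_right (hε x) (sub_nonneg.mpr (hb y₀).1)
        linarith
      · have h2 := single_le_sum (f := fun y => -(Q x y * (G y - hi))) (fun y _ => by
          have := mul_nonneg (h0 x y) (sub_nonneg.mpr (hb y).2)
          show 0 ≤ -(Q x y * (G y - hi))
          linarith) (mem_univ y₀)
        simp only [sum_neg_distrib] at h2
        rw [hsum] at h2
        have := mul_le_mul_of_nonneg_right (hε x) (sub_nonneg.mpr (hb y₀).2)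
        linarith

theorem IsStationary.abs_sub_le_of_doeblin {P : Matrix X X ℝ} {N : ℕ} {ε : ℝ} {y₀ : X}
    (h0 : ∀ x y, 0 ≤ (P ^ N) x y) (h1 : ∀ x, ∑ y, (P ^ N) x y = 1) (hε : ∀ x, ε ≤ (P ^ N) x y₀)
    {π : X → ℝ} (hπ : IsStationary P π) {F : X → ℝ} (hF : ∀ x, |F x| ≤ 1) (k : ℕ)
    {ν : X → ℝ} (hν0 : ∀ x, 0 ≤ ν x) (hν1 : ∑ x, ν x = 1) :
    |∑ x, ν x * (P ^ (N * k)).mulVec F x - ∑ x, π x * F x| ≤ (1 - ε) ^ k * 2 := by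
  obtain ⟨lo, hi, hd, hb⟩ := exists_oscillation_of_doeblin h0 h1 hε hF k
  rw [← hπ.sum_pow_mulVec (N * k), pow_mul]
  have ha := sum_mul_mem_of_bounds hν0 hν1 hb
  have hb := sum_mul_mem_of_bounds hπ.1 hπ.2.1 hb
  rw [abs_le]
  constructor <;> linarith [ha.1, ha.2, hb.1, hb.2]

theorem IsStationary.eq_of_doeblin {P : Matrix X X ℝ} {N : ℕ} {ε : ℝ} {y₀ : X}
    (h0 : ∀ x y, 0 ≤ (P ^ N) x y) (h1 : ∀ x, ∑ y, (P ^ N) x y = 1) (hε0 : 0 < ε)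
    (hε : ∀ x, ε ≤ (P ^ N) x y₀) {π ν : X → ℝ} (hπ : IsStationary P π)
    (hν : IsStationary P ν) : ν = π := by
  ext y
  have hε1 : ε ≤ 1 := (hε y₀).trans ((single_le_sum (fun y _ => h0 y₀ y) (mem_univ y₀)).trans
    (h1 y₀).le)
  have hF : ∀ x, |(Pi.single y 1 : X → ℝ) x| ≤ 1 := by
    intro x
    by_cases h : x = y
    · subst h; simp
    · simp [h]
  have hb : ∀ k : ℕ, |ν y - π y| ≤ (1 - ε) ^ k * 2 := by
    intro k
    have := hπ.abs_sub_le_of_doeblin h0 h1 hε hF k hν.1 hν.2.1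
    rw [hν.sum_pow_mulVec] at this
    simpa [Pi.single_apply] using this
  have hlim : Filter.Tendsto (fun k : ℕ => (1 - ε) ^ k * 2) Filter.atTop (nhds (0 * 2)) :=
    (tendsto_pow_atTop_nhds_zero_of_lt_one (by linarith) (by linarith)).mul_const 2
  have := ge_of_tendsto' hlim hb
  rw [zero_mul] at this
  exact sub_eq_zero.mp (abs_eq_zero.mp (le_antisymm this (abs_nonneg _)))

theorem exists_worstDist_le_of_doeblin [Nonempty X] {P : Matrix X X ℝ} {N : ℕ} {ε : ℝ} {y₀ : X}
    (h0 : ∀ x y, 0 ≤ (P ^ N) x y) (h1 : ∀ x, ∑ y, (P ^ N) x y = 1) (hε0 : 0 < ε)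
    (hε : ∀ x, ε ≤ (P ^ N) x y₀) {π : X → ℝ} (hπ : IsStationary P π) {b : ℝ} (hb : 0 < b) :
    ∃ t, worstDist P π t ≤ b := by
  have hε1 : ε ≤ 1 := (hε y₀).trans ((single_le_sum (fun y _ => h0 y₀ y) (mem_univ y₀)).trans
    (h1 y₀).le)
  obtain ⟨k, hk⟩ := exists_pow_lt_of_lt_one hb (by linarith : 1 - ε < 1)
  refine ⟨N * k, worstDist_le fun F hF x => ?_⟩
  have := hπ.abs_sub_le_of_doeblin h0 h1 hε hF k (ν := Pi.single x 1)
    (fun y => by by_cases h : y = x <;> simp [h]) (by simp)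
  simp only [Pi.single_apply, ite_mul, one_mul, zero_mul, sum_ite_eq', mem_univ, if_true] at this
  linarith [(abs_le.mp this).2]

end Chain

/-! ### Stationarity of the restricted dynamics -/

theorem sum_odd_eq_zero {h : Config n → ℝ} (hh : ∀ σ, h (-σ) = -h σ) : ∑ σ, h σ = 0 := by
  have h1 := Equiv.sum_comp (Equiv.neg (Config n)) h
  simp only [Equiv.neg_apply, hh, sum_neg_distrib] at h1
  linarith

/-- Split F ∘ `reflect` into even and odd parts. The even part reduces to invariance of the Gibbs
measure. The odd part lives on zero magnetization, the only level where ζ and -ζ both belong to Ω⁺,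
and contributes zero to both sides. -/
theorem gibbsPlus_restrictedOp (hn : 1 ≤ n) (F : ConfigPlus n → ℝ) :
    ∑ σ, gibbsPlus n β σ * restrictedOp β F σ = ∑ σ, gibbsPlus n β σ * F σ := by
  rw [gibbsPlus_sum, gibbsPlus_sum]
  unfold restrictedOp
  set G : Config n → ℝ := fun ζ => F (reflect ζ) with hG
  set E : Config n → ℝ := fun ζ => (G ζ + G (-ζ)) / 2 with hE
  set O : Config n → ℝ := fun ζ => (G ζ - G (-ζ)) / 2 with hO
  have hGEO : G = E + O := by ext ζ; simp only [hE, hO, Pi.add_apply]; ring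
  have hEe : ∀ ζ, E (-ζ) = E ζ := by intro ζ; simp only [hE, neg_neg]; ring
  have hOo : ∀ ζ, O (-ζ) = -O ζ := by intro ζ; simp only [hO, neg_neg]; ring
  have hO0 : ∀ ζ, n ≠ 2 * plusCount ζ → O ζ = 0 := by
    intro ζ hζ
    have hneg := plusCount_neg ζ
    have : reflect ζ = reflect (-ζ) := by
      ext1
      unfold reflect
      by_cases h : 0 ≤ mag ζ
      · have h' : ¬ 0 ≤ mag (-ζ) := by
          rw [mag_nonneg_iff] at h ⊢; omega
        rw [dif_pos h, dif_neg h']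
        simp
      · have h' : 0 ≤ mag (-ζ) := by
          rw [mag_nonneg_iff] at h ⊢; omega
        rw [dif_neg h, dif_pos h']
    simp only [hO, hG, this, sub_self, zero_div]
  set s : ℕ → ℝ := fun K => if n ≤ 2 * K then 1 else -1 with hs
  have hglE : ∀ ζ, glauberOp β E (reflect ζ).1 = glauberOp β E ζ := by
    intro ζ
    rcases reflect_eq_or ζ with h | h <;> rw [h]
    rw [glauberOp_neg]
    simp only [hEe]
  have hneg1 : glauberOp β (fun η => O (-η)) = -glauberOp β O := by
    have : (fun η => O (-η)) = (-1 : ℝ) • O := by ext η; simp [hOo]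
    rw [this, glauberOp_smul]
    ext; simp
  have hglO : ∀ ζ, glauberOp β O (reflect ζ).1 = s (plusCount ζ) * glauberOp β O ζ := by
    intro ζ
    simp only [hs, reflect]
    simp only [← mag_nonneg_iff]
    split_ifs with h
    · simp
    · simp only [glauberOp_neg, hneg1]
      simp
  have hL : ∀ ζ, gibbs β ζ * glauberOp β G (reflect ζ).1 = gibbs β ζ * glauberOp β E ζ +
      gibbs β ζ * s (plusCount ζ) * glauberOp β O ζ := by
    intro ζ
    rw [hGEO, glauberOp_add, Pi.add_apply, hglE, hglO]
    ring
  have hR : ∀ ζ, gibbs β ζ * G ζ = gibbs β ζ * E ζ + gibbs β ζ * O ζ := by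
    intro ζ
    rw [hGEO, Pi.add_apply, mul_add]
  show ∑ ζ, gibbs β ζ * glauberOp β G (reflect ζ).1 = ∑ ζ, gibbs β ζ * G ζ
  simp only [hL, hR, sum_add_distrib]
  rw [gibbs_glauberOp hn, sum_odd_eq_zero (h := fun ζ => gibbs β ζ * O ζ)
    (fun ζ => by rw [gibbs_neg, hOo]; ring)]
  congr 1
  -- Moving P onto the sign s gives a function of the plus count, which agrees at ζ and -ζ when the
  -- magnetization is zero; its product with O is then odd.
  rw [gibbs_symm hn (fun ζ => s (plusCount ζ)) O]
  apply sum_odd_eq_zero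
  intro ζ
  by_cases h : n = 2 * plusCount ζ
  · have hneg := plusCount_neg ζ
    have h2 : plusCount (-ζ) = plusCount ζ := by omega
    rw [gibbs_neg, hOo, glauberOp_level hn, glauberOp_level hn, h2]
    ring
  · rw [hOo, hO0 ζ h]
    simp

theorem restrictedGlauber_apply (σ η : ConfigPlus n) :
    restrictedGlauber n β σ η = restrictedOp β (Pi.single η 1) σ := by
  rw [← restrictedGlauber_mulVec]
  simp

theorem isStationary_gibbsPlus (hn : 1 ≤ n) :
    IsStationary (restrictedGlauber n β) (gibbsPlus n β) := by
  refine ⟨fun η => ?_, ?_, fun η => ?_⟩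
  · unfold gibbsPlus
    refine sum_nonneg fun ζ _ => ?_
    split_ifs
    · exact (gibbs_pos _).le
    · exact le_rfl
  · have := gibbsPlus_sum (β := β) (n := n) (fun _ => 1)
    simpa [sum_gibbs] using this
  · simp only [restrictedGlauber_apply]
    rw [gibbsPlus_restrictedOp hn]
    simp [Pi.single_apply]

/-! ### Iterates of the restricted operator -/

theorem restrictedOp_mono {F G : ConfigPlus n → ℝ} (h : F ≤ G) :
    restrictedOp β F ≤ restrictedOp β G := fun σ => glauberOp_mono (fun ζ => h (reflect ζ)) σ.1

theorem restrictedOp_const (hn : 1 ≤ n) (c : ℝ) :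
    restrictedOp β (fun _ : ConfigPlus n => c) = fun _ => c := by
  ext σ
  exact congrFun (glauberOp_const hn c) σ.1

theorem restrictedOp_iterate_mono (t : ℕ) {F G : ConfigPlus n → ℝ} (h : F ≤ G) :
    (restrictedOp β)^[t] F ≤ (restrictedOp β)^[t] G := by
  induction t generalizing F G with
  | zero => exact h
  | succ t ih => exact ih (restrictedOp_mono h)

theorem restrictedOp_iterate_const (hn : 1 ≤ n) (t : ℕ) (c : ℝ) :
    (restrictedOp β)^[t] (fun _ : ConfigPlus n => c) = fun _ => c := by
  induction t with
  | zero => rfl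
  | succ t ih => rw [Function.iterate_succ_apply, restrictedOp_const hn, ih]

theorem restrictedOp_iterate_add (t : ℕ) (F G : ConfigPlus n → ℝ) :
    (restrictedOp β)^[t] (F + G) = (restrictedOp β)^[t] F + (restrictedOp β)^[t] G := by
  rw [← restrictedGlauber_pow_mulVec, Matrix.mulVec_add, restrictedGlauber_pow_mulVec,
    restrictedGlauber_pow_mulVec]

theorem restrictedGlauber_pow_nonneg (hn : 1 ≤ n) (t : ℕ) (σ η : ConfigPlus n) :
    0 ≤ (restrictedGlauber n β ^ t) σ η := by
  have h : (restrictedGlauber n β ^ t) σ η = (restrictedOp β)^[t] (Pi.single η 1) σ := by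
    rw [← restrictedGlauber_pow_mulVec]; simp
  rw [h]
  have h0 : (fun _ => 0 : ConfigPlus n → ℝ) ≤ Pi.single η 1 := by
    intro τ
    by_cases h : τ = η <;> simp [h]
  have := restrictedOp_iterate_mono (β := β) t h0 σ
  rwa [restrictedOp_iterate_const hn] at this

theorem restrictedGlauber_pow_sum (hn : 1 ≤ n) (t : ℕ) (σ : ConfigPlus n) :
    ∑ η, (restrictedGlauber n β ^ t) σ η = 1 := by
  have h := restrictedGlauber_pow_mulVec (n := n) (β := β) (fun _ => 1) t
  rw [restrictedOp_iterate_const hn] at h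
  simpa [Matrix.mulVec, dotProduct] using congrFun h σ

/-! ### Irreducibility -/

theorem plusCount_one : plusCount (1 : Config n) = n := by
  simp [plusCount]

/-- The configuration with all spins plus. -/
def allPlus (n : ℕ) : ConfigPlus n := ⟨1, by rw [mag_nonneg_iff, plusCount_one]; omega⟩

instance : Nonempty (ConfigPlus n) := ⟨allPlus n⟩

theorem eq_one_of_plusCount {σ : Config n} (h : plusCount σ = n) : σ = 1 := by
  unfold plusCount at h
  have : ({i | σ i = 1} : Finset (Fin n)) = univ := by
    rw [← card_eq_iff_eq_univ, h, Fintype.card_fin]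
  ext i
  have hi : i ∈ ({i | σ i = 1} : Finset (Fin n)) := by rw [this]; exact mem_univ i
  simp only [mem_filter, mem_univ, true_and] at hi
  rw [hi]; rfl

theorem update_le_glauberOp (hβ : 0 ≤ β) {f : Config n → ℝ} (hf : 0 ≤ f) (σ : Config n)
    (v : Fin n) (s : ℤˣ) :
    (n : ℝ)⁻¹ * (Real.exp (-(2 * β)) / 2) * f (Function.update σ v s) ≤ glauberOp β f σ := by
  unfold glauberOp
  rw [mul_assoc]
  refine mul_le_mul_of_nonneg_left ?_ (by positivity)
  have hs : ∀ u : Fin n, 0 ≤ siteAvg β u f σ := fun u => by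
    unfold siteAvg
    exact sum_nonneg fun s _ => mul_nonneg (updateProb_pos _ _ _).le (hf _)
  refine le_trans ?_ (single_le_sum (fun u _ => hs u) (mem_univ v))
  unfold siteAvg
  refine le_trans ?_ (single_le_sum (fun s _ =>
    mul_nonneg (updateProb_pos (β := β) σ v s).le (hf (Function.update σ v s))) (mem_univ s))
  exact mul_le_mul_of_nonneg_right (updateProb_ge hβ σ v s) (hf _)

/-- Setting one minus spin to plus at each step stays in Ω⁺ and reaches all plus within n steps; any
spare steps resample a plus spin to plus. -/
theorem doeblin_allPlus (hn : 1 ≤ n) (hβ : 0 ≤ β) (σ : ConfigPlus n) :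
    ((n : ℝ)⁻¹ * (Real.exp (-(2 * β)) / 2)) ^ n ≤
      (restrictedGlauber n β ^ n) σ (allPlus n) := by
  have h : (restrictedGlauber n β ^ n) σ (allPlus n) =
      (restrictedOp β)^[n] (Pi.single (allPlus n) 1) σ := by
    rw [← restrictedGlauber_pow_mulVec]; simp
  rw [h]
  set ε := (n : ℝ)⁻¹ * (Real.exp (-(2 * β)) / 2) with hε
  have hε0 : 0 ≤ ε := by positivity
  have hS0 : (fun _ => 0 : ConfigPlus n → ℝ) ≤ Pi.single (allPlus n) 1 := by
    intro τ
    by_cases h : τ = allPlus n <;> simp [h]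
  have key : ∀ k (σ : ConfigPlus n), n ≤ plusCount σ.1 + k →
      ε ^ k ≤ (restrictedOp β)^[k] (Pi.single (allPlus n) 1) σ := by
    intro k
    induction k with
    | zero =>
      intro σ hσ
      have : σ = allPlus n := by
        ext1
        have := plusCount_le σ.1
        exact eq_one_of_plusCount (by omega)
      simp [this]
    | succ k ih =>
      intro σ hσ
      rw [Function.iterate_succ_apply']
      have hnn : (0 : Config n → ℝ) ≤
          fun ζ => (restrictedOp β)^[k] (Pi.single (allPlus n) 1) (reflect ζ) := by
        intro ζ
        have := restrictedOp_iterate_mono (β := β) k hS0 (reflect ζ)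
        rwa [restrictedOp_iterate_const hn] at this
      have hex : ∃ v, n ≤ plusCount (Function.update σ.1 v 1) + k ∧
          0 ≤ mag (Function.update σ.1 v 1) := by
        have hσm := (mag_nonneg_iff σ.1).mp σ.2
        by_cases hc : plusCount σ.1 = n
        · refine ⟨⟨0, hn⟩, ?_⟩
          have h1 : Function.update σ.1 ⟨0, hn⟩ 1 = σ.1 := by
            have h2 := eq_one_of_plusCount hc
            conv_lhs => rw [show (1 : ℤˣ) = σ.1 ⟨0, hn⟩ by rw [h2]; rfl]
            exact Function.update_eq_self _ _
          rw [h1]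
          exact ⟨by omega, σ.2⟩
        · have : ∃ v, σ.1 v ≠ 1 := by
            by_contra! hall
            apply hc
            have : σ.1 = 1 := funext hall
            rw [this, plusCount_one]
          obtain ⟨v, hv⟩ := this
          have h1 := plusCount_update_plus ((Int.units_eq_one_or (σ.1 v)).resolve_left hv)
          refine ⟨v, by omega, ?_⟩
          rw [mag_nonneg_iff]
          omega
      obtain ⟨v, hv, hv'⟩ := hex
      have h1 := update_le_glauberOp hβ hnn σ.1 v 1
      refine le_trans ?_ h1
      rw [pow_succ']
      refine mul_le_mul_of_nonneg_left ?_ hε0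
      have h2 := ih (reflect (Function.update σ.1 v 1)) ?_
      · exact h2
      · unfold reflect
        rw [dif_pos hv']
        exact hv
  exact key n σ (by omega)

theorem stationary_iff (hn : 1 ≤ n) (hβ : 0 ≤ β) (π : ConfigPlus n → ℝ) :
    IsStationary (restrictedGlauber n β) π ↔ π = gibbsPlus n β := by
  constructor
  · intro h
    exact IsStationary.eq_of_doeblin (restrictedGlauber_pow_nonneg hn n)
      (restrictedGlauber_pow_sum hn n) (by positivity) (doeblin_allPlus hn hβ)
      (isStationary_gibbsPlus hn) h
  · rintro rfl
    exact isStationary_gibbsPlus hn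

theorem mixedTimes_nonempty (hn : 1 ≤ n) (hβ : 0 ≤ β) : (mixedTimes n β).Nonempty :=
  exists_worstDist_le_of_doeblin (restrictedGlauber_pow_nonneg hn n)
    (restrictedGlauber_pow_sum hn n) (by positivity) (doeblin_allPlus hn hβ)
    (isStationary_gibbsPlus hn) (by norm_num)

/-! ### Upper bound -/

theorem plusCount_reflect (ζ : Config n) :
    plusCount (reflect ζ).1 = max (plusCount ζ) (n - plusCount ζ) := by
  have h := (mag_nonneg_iff (reflect ζ).1).mp (reflect ζ).2
  have hneg := plusCount_neg ζ
  rcases reflect_eq_or ζ with h1 | h1 <;> rw [h1] at h ⊢ <;> omega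

/-- A function of the reflected configuration that varies little on each magnetization level is
close to an even function of the magnetization. -/
theorem exists_isLevel_near {F : ConfigPlus n → ℝ} {η : ℝ}
    (hF : ∀ σ τ : ConfigPlus n, plusCount σ.1 = plusCount τ.1 → |F σ - F τ| ≤ η)
    (hF1 : ∀ σ, |F σ| ≤ 1) :
    ∃ φ : Config n → ℝ, IsLevel φ ∧ (∀ σ, |φ σ| ≤ 1) ∧ ∀ ζ, |F (reflect ζ) - φ ζ| ≤ η := by
  classical
  set γ : ℕ → ℝ := fun K => if h : ∃ τ : ConfigPlus n, plusCount τ.1 = K then F h.choose else 0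
    with hγ
  refine ⟨fun ζ => γ (max (plusCount ζ) (n - plusCount ζ)), ⟨fun σ => ?_,
    fun K => γ (max K (n - K)), rfl⟩, fun σ => ?_, fun ζ => ?_⟩
  · have := plusCount_neg σ
    simp only
    congr 1
    omega
  · simp only [hγ]
    split_ifs
    · exact hF1 _
    · simp
  · have hex : ∃ τ : ConfigPlus n, plusCount τ.1 = max (plusCount ζ) (n - plusCount ζ) :=
      ⟨reflect ζ, plusCount_reflect ζ⟩
    simp only [hγ, dif_pos hex]
    apply hF
    rw [hex.choose_spec, plusCount_reflect]

theorem iterate_restrictedOp_abs_le (hn : 1 ≤ n) (t : ℕ) {F : ConfigPlus n → ℝ} {b : ℝ}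
    (hF : ∀ σ, |F σ| ≤ b) (σ : ConfigPlus n) : |(restrictedOp β)^[t] F σ| ≤ b := by
  have h1 := restrictedOp_iterate_mono (β := β) t (F := F) (G := fun _ => b)
    (fun σ => (abs_le.mp (hF σ)).2) σ
  have h2 := restrictedOp_iterate_mono (β := β) t (G := F) (F := fun _ => -b)
    (fun σ => (abs_le.mp (hF σ)).1) σ
  rw [restrictedOp_iterate_const hn] at h1 h2
  exact abs_le.mpr ⟨h2, h1⟩

theorem gibbsPlus_iterate (hn : 1 ≤ n) (t : ℕ) (F : ConfigPlus n → ℝ) :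
    ∑ σ, gibbsPlus n β σ * (restrictedOp β)^[t] F σ = ∑ σ, gibbsPlus n β σ * F σ := by
  rw [← restrictedGlauber_pow_mulVec, (isStationary_gibbsPlus hn).sum_pow_mulVec]

/-- The first T₂ applications of the operator bring F within η of an even level function φ. The
remaining T * k contract φ towards its mean. The error η enters twice, for the evolved function and
for its mean, and is halved by the total variation normalization. -/
theorem worstDist_le_of_bounds (hn : 1 ≤ n) (hβ : 0 ≤ β) {T k T₂ : ℕ}
    (hT : ∀ φ : Config n → ℝ, 0 ≤ φ → IsLevel φ → ∀ σ,
      (∑ τ, gibbs β τ * φ τ) / 4 ≤ (glauberOp β)^[T] φ σ) :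
    worstDist (restrictedGlauber n β) (gibbsPlus n β) (T * k + T₂) ≤
      2 * n * (1 - Real.exp (-(2 * β)) / n) ^ T₂ + (3 / 4) ^ k := by
  refine worstDist_le fun F hF σ => ?_
  rw [restrictedGlauber_pow_mulVec, Function.iterate_add_apply]
  set η := 2 * n * (1 - Real.exp (-(2 * β)) / n) ^ T₂ with hη
  set F₂ := (restrictedOp β)^[T₂] F with hF₂
  have hn' : (1 : ℝ) ≤ n := by exact_mod_cast hn
  have hc : 0 ≤ 1 - Real.exp (-(2 * β)) / n := by
    have : Real.exp (-(2 * β)) ≤ 1 := Real.exp_le_one_iff.mpr (by linarith)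
    rw [sub_nonneg, div_le_one (by linarith)]
    linarith
  have hswap : SwapBound (2 * (1 - Real.exp (-(2 * β)) / n) ^ T₂) (fun ζ => F₂ (reflect ζ)) := by
    apply SwapBound.restrictedOp_iterate hn hβ
    intro ζ v w
    have h1 := abs_le.mp (hF (reflect (ζ ∘ Equiv.swap v w)))
    have h2 := abs_le.mp (hF (reflect ζ))
    rw [abs_le]
    constructor <;> linarith
  have hosc : ∀ σ τ : ConfigPlus n, plusCount σ.1 = plusCount τ.1 → |F₂ σ - F₂ τ| ≤ η := by
    intro σ τ h
    have := hswap.abs_sub_le (by positivity) n σ.1 τ.1 h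
      ((card_le_univ _).trans (by simp))
    simp only [reflect_coe] at this
    rw [hη]
    linarith
  obtain ⟨φ, hφ, hφ1, hφF⟩ := exists_isLevel_near hosc
    (iterate_restrictedOp_abs_le hn T₂ hF)
  have h1 : |(restrictedOp β)^[T * k] F₂ σ - (glauberOp β)^[T * k] φ σ.1| ≤ η := by
    have e1 : F₂ = (fun σ => φ σ.1) + (fun σ => F₂ σ - φ σ.1) := by ext; simp
    have e2 := congrFun (restrictedOp_iterate_even (β := β) hφ.1 (T * k)) σ
    have e3 := iterate_restrictedOp_abs_le (β := β) hn (T * k) (F := fun σ => F₂ σ - φ σ.1)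
      (b := η) (fun σ => by simpa [reflect_coe] using hφF σ.1) σ
    rw [e1, restrictedOp_iterate_add, Pi.add_apply, e2, add_sub_cancel_left]
    exact e3
  have h2 := iterate_level_oscillation hn hT hφ (lo := -1) (hi := 1)
    (fun σ => (abs_le.mp (hφ1 σ)).1) (fun σ => (abs_le.mp (hφ1 σ)).2) k σ.1
  have h3 : ∑ τ, gibbs β τ * φ τ - ∑ σ, gibbsPlus n β σ * F σ ≤ η := by
    rw [← gibbsPlus_iterate hn T₂, gibbsPlus_sum, ← sum_sub_distrib]
    rw [← one_mul η, ← sum_gibbs (β := β) (n := n), sum_mul]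
    refine sum_le_sum fun τ _ => ?_
    rw [← mul_sub]
    refine mul_le_mul_of_nonneg_left ?_ (gibbs_pos _).le
    linarith [(abs_le.mp (hφF τ)).1]
  have h4 := (abs_le.mp h1).2
  have h5 := (abs_le.mp h2).2
  linarith

theorem one_sub_div_pow_le {c N : ℝ} (hN : 0 < N) (hc1 : c ≤ N) (t : ℕ) :
    (1 - c / N) ^ t ≤ Real.exp (-(c * t / N)) := by
  have h0 : 0 ≤ 1 - c / N := by
    rw [sub_nonneg, div_le_one hN]
    exact hc1
  have h1 : 1 - c / N ≤ Real.exp (-(c / N)) := by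
    linarith [Real.add_one_le_exp (-(c / N))]
  calc (1 - c / N) ^ t ≤ Real.exp (-(c / N)) ^ t := pow_le_pow_left₀ h0 h1 t
    _ = Real.exp (-(c * t / N)) := by
        rw [← Real.exp_nat_mul]; ring_nf

theorem half_le_log {n : ℕ} (hn : 2 ≤ n) : 1 / 2 ≤ Real.log n := by
  have h1 : Real.log 2 ≤ Real.log n :=
    Real.log_le_log (by norm_num) (by exact_mod_cast hn)
  linarith [Real.log_two_gt_d9]

theorem exists_tmix_le_of_large (hβ : 1 < β) : ∃ C : ℝ, 0 < C ∧ ∀ n : ℕ, 2 ≤ n →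
    1 ≤ driftPoint β * n → (tmix n β : ℝ) ≤ C * (n * Real.log n) := by
  obtain ⟨C, hC, hsup⟩ := exists_supersolution hβ
  set c := Real.exp (-(2 * β)) with hc
  have hc0 : 0 < c := Real.exp_pos _
  refine ⟨16 * (2 * C * 3 + 2) + (7 / c + 2), by positivity, fun n hn hu => ?_⟩
  have hn1 : 1 ≤ n := by omega
  have hn2 : (2 : ℝ) ≤ n := by exact_mod_cast hn
  have hlog := half_le_log hn
  obtain ⟨m, hm, g, hg0, hg, hgH⟩ := hsup n hn hu
  set H := C * (n * (1 + Real.log n)) with hH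
  have hH0 : 0 < H := by positivity
  set U := ⌈2 * H⌉₊ with hU
  have hU1 : 2 * H ≤ U := Nat.le_ceil _
  have hU2 : (U : ℝ) < 2 * H + 1 := Nat.ceil_lt_add_one (by positivity)
  -- Contraction at rate c/n for this long yields n⁻⁷, which beats the prefactor 2n of the swap
  -- bound.
  set s := n / c * (7 * Real.log n) with hs
  have hs0 : 0 ≤ s := by positivity
  set T₂ := ⌈s⌉₊ with hT₂
  have hT1 : s ≤ T₂ := Nat.le_ceil _
  have hT2 : (T₂ : ℝ) < s + 1 := Nat.ceil_lt_add_one hs0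
  -- With eight rounds the total error is at most (3/4)⁸ + 2/2⁶ < 1/4.
  have hd := worstDist_le_of_bounds (k := 8) (T₂ := T₂) hn1 (by linarith : 0 ≤ β)
    (fun φ h0 hφ σ => quarter_le_iterate hn1 hm hg0 hg hH0 hgH hU1 h0 hφ σ)
  have hc1 : c ≤ 1 := Real.exp_le_one_iff.mpr (by linarith)
  have h7 : (1 - c / n) ^ T₂ ≤ 1 / (n : ℝ) ^ 7 := by
    refine (one_sub_div_pow_le (by linarith) (by linarith) T₂).trans ?_
    rw [Real.exp_neg, one_div]
    apply inv_anti₀ (by positivity)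
    rw [← Real.exp_log (by positivity : (0 : ℝ) < (n : ℝ) ^ 7), Real.log_pow]
    apply Real.exp_le_exp.mpr
    rw [le_div_iff₀ (by linarith)]
    have : c * s = n * (7 * Real.log n) := by rw [hs]; field_simp
    push_cast
    nlinarith [mul_le_mul_of_nonneg_left hT1 hc0.le]
  have hmem : 2 * U * 8 + T₂ ∈ mixedTimes n β := by
    refine hd.trans ?_
    have h8 : 2 * (n : ℝ) * (1 - c / n) ^ T₂ ≤ 2 * n * (1 / (n : ℝ) ^ 7) :=
      mul_le_mul_of_nonneg_left h7 (by positivity)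
    have h9 : 2 * (n : ℝ) * (1 / (n : ℝ) ^ 7) = 2 / (n : ℝ) ^ 6 := by
      field_simp
    have h10 : 2 / (n : ℝ) ^ 6 ≤ 2 / 2 ^ 6 := by gcongr
    norm_num at h10 ⊢
    rw [h9] at h8
    linarith
  have hle : tmix n β ≤ 2 * U * 8 + T₂ := Nat.sInf_le hmem
  have hle' : (tmix n β : ℝ) ≤ 2 * U * 8 + T₂ := by exact_mod_cast hle
  have hx : 1 ≤ n * Real.log n := by nlinarith
  have hn_le : (n : ℝ) * (1 + Real.log n) ≤ 3 * (n * Real.log n) := by nlinarith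
  have h2H : 2 * H ≤ 2 * C * 3 * (n * Real.log n) := by
    rw [hH]
    nlinarith [mul_le_mul_of_nonneg_left hn_le hC.le]
  have hs' : s = 7 / c * (n * Real.log n) := by rw [hs]; ring
  have e : (16 * (2 * C * 3 + 2) + (7 / c + 2)) * (n * Real.log n) =
      16 * (2 * C * 3 * (n * Real.log n)) + 32 * (n * Real.log n) + 7 / c * (n * Real.log n) +
        2 * (n * Real.log n) := by ring
  rw [e, ← hs']
  linarith

/-- Needed exactly, because the upper bound is 0 at n = 1; Ω⁺ is then a single point. -/
theorem tmix_one (β : ℝ) : tmix 1 β = 0 := by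
  have hsub : ∀ σ : ConfigPlus 1, σ = allPlus 1 := by
    intro σ
    ext1
    have h1 := (mag_nonneg_iff σ.1).mp σ.2
    have h2 := plusCount_le σ.1
    exact eq_one_of_plusCount (by omega)
  have hmem : 0 ∈ mixedTimes 1 β := by
    refine worstDist_le fun F _ σ => ?_
    have h1 := (isStationary_gibbsPlus (β := β) (n := 1) le_rfl).2.1
    have h2 : ∑ y, gibbsPlus 1 β y * F y = F (allPlus 1) := by
      rw [← one_mul (F (allPlus 1)), ← h1, sum_mul]
      exact sum_congr rfl fun y _ => by rw [hsub y]
    rw [h2, pow_zero, Matrix.one_mulVec, hsub σ]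
    norm_num
  exact Nat.le_zero.mp (Nat.sInf_le hmem)

theorem exists_tmix_le (hβ : 1 < β) : ∃ C : ℝ, 0 < C ∧ ∀ n : ℕ, 1 ≤ n →
    (tmix n β : ℝ) ≤ C * (n * Real.log n) := by
  obtain ⟨C, hC, hl⟩ := exists_tmix_le_of_large hβ
  set N := ⌈1 / driftPoint β⌉₊ with hN
  -- The finitely many n with `driftPoint β` * n < 1 are absorbed into the constant, since n log n ≥
  -- 1 for n ≥ 2.
  refine ⟨C + ∑ n ∈ range N, (tmix n β : ℝ), by positivity, fun n hn => ?_⟩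
  rcases hn.eq_or_lt with rfl | hn
  · simp [tmix_one]
  have hlog := half_le_log hn
  have hn2 : (2 : ℝ) ≤ n := by exact_mod_cast hn
  have hx : 1 ≤ n * Real.log n := by nlinarith
  have hS : 0 ≤ ∑ n ∈ range N, (tmix n β : ℝ) := by positivity
  rw [add_mul]
  by_cases h : 1 ≤ driftPoint β * n
  · have := hl n hn h
    nlinarith
  · have hnN : n < N := by
      rw [hN, Nat.lt_ceil, lt_div_iff₀ (driftPoint_pos hβ)]
      linarith
    have := single_le_sum (f := fun n => (tmix n β : ℝ)) (fun _ _ => Nat.cast_nonneg _)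
      (mem_range.mpr hnN)
    have h0 : 0 ≤ C * (n * Real.log n) := by positivity
    nlinarith

/-! ### A slowly decaying linear statistic -/

/-- The linear statistic with weights `w`. -/
def linStat (w : Fin n → ℝ) (σ : Config n) : ℝ := ∑ v, w v * spin (σ v)

theorem linStat_neg (w : Fin n → ℝ) (σ : Config n) : linStat w (-σ) = -linStat w σ := by
  simp [linStat]

theorem linStat_update (w : Fin n → ℝ) (σ : Config n) (v : Fin n) (s : ℤˣ) :
    linStat w (Function.update σ v s) = linStat w σ + w v * (spin s - spin (σ v)) := by
  unfold linStat
  rw [← add_sum_erase _ _ (mem_univ v), ← add_sum_erase _ (fun u => w u * spin (σ u)) (mem_univ v)]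
  have : ∑ u ∈ univ.erase v, w u * spin (Function.update σ v s u) =
      ∑ u ∈ univ.erase v, w u * spin (σ u) :=
    sum_congr rfl fun u hu => by rw [Function.update_of_ne (ne_of_mem_erase hu)]
  rw [this, Function.update_self]
  ring

/-- The expected new spin at `v`. -/
def meanSpin (β : ℝ) (σ : Config n) (v : Fin n) : ℝ := 2 * plusProb (β * localField σ v) - 1

theorem siteAvg_linStat (w : Fin n → ℝ) (σ : Config n) (v : Fin n) :
    siteAvg β v (linStat w) σ = linStat w σ + w v * (meanSpin β σ v - spin (σ v)) := by
  unfold siteAvg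
  rw [sum_units]
  simp only [linStat_update, updateProb_eq, spin_neg, spin_one, mul_one, mul_neg, neg_mul]
  have := plusProb_add_neg (β * localField σ v)
  have h2 : plusProb (-(β * localField σ v)) = 1 - plusProb (β * localField σ v) := by linarith
  rw [h2, meanSpin]
  ring

theorem siteAvg_linStat_sq_le {w : Fin n → ℝ} (hw : ∀ v, |w v| ≤ 2) (σ : Config n) (v : Fin n) :
    siteAvg β v (fun η => linStat w η ^ 2) σ ≤
      linStat w σ ^ 2 + 2 * linStat w σ * (w v * (meanSpin β σ v - spin (σ v))) + 16 := by
  unfold siteAvg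
  rw [sum_units]
  simp only [linStat_update, updateProb_eq, spin_neg, spin_one, mul_one, mul_neg, neg_mul]
  have := plusProb_add_neg (β * localField σ v)
  have h2 : plusProb (-(β * localField σ v)) = 1 - plusProb (β * localField σ v) := by linarith
  rw [h2, meanSpin]
  have h0 := plusProb_pos (β * localField σ v)
  have h1 := plusProb_le_one (β * localField σ v)
  have hw2 : w v ^ 2 ≤ 4 := by
    have := abs_le.mp (hw v)
    nlinarith
  have hq : 0 ≤ w v ^ 2 := sq_nonneg _
  rcases spin_eq_or (σ v) with h | h <;> rw [h] <;> nlinarith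

/-- The local field at v depends on v only through the spin at v, so the mean takes two values,
which an affine function of that spin interpolates. The fields differ by 2/n, which makes the slope
O(1/n). -/
theorem exists_meanSpin_eq (hn : 1 ≤ n) (hβ : 0 ≤ β) (σ : Config n) :
    ∃ a b : ℝ, -(4 * β / n) ≤ b ∧ b ≤ 0 ∧ ∀ v, meanSpin β σ v = a + b * spin (σ v) := by
  have hn0 : (0 : ℝ) < n := by positivity
  set x : ℝ := 2 * plusCount σ - n with hx
  set p := plusProb (β * ((n : ℝ)⁻¹ * (x - 1))) with hp
  set q := plusProb (β * ((n : ℝ)⁻¹ * (x - -1))) with hq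
  have hle : β * ((n : ℝ)⁻¹ * (x - 1)) ≤ β * ((n : ℝ)⁻¹ * (x - -1)) := by
    gcongr
    norm_num
  have h1 : p ≤ q := plusProb_mono hle
  have h2 := plusProb_lipschitz hle
  rw [← hp, ← hq] at h2
  refine ⟨p + q - 1, p - q, ?_, by linarith, fun v => ?_⟩
  · have : 2 * (β * ((n : ℝ)⁻¹ * (x - -1)) - β * ((n : ℝ)⁻¹ * (x - 1))) = 4 * β / n := by
      field_simp
      ring
    linarith
  · unfold meanSpin
    rw [localField_eq, ← hx]
    rcases spin_eq_or (σ v) with h | h <;> rw [h]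
    · rw [← hp]; ring
    · rw [← hq]; ring

theorem abs_linStat_le {w : Fin n → ℝ} (hw : ∀ v, |w v| ≤ 2) (σ : Config n) :
    |linStat w σ| ≤ 2 * n := by
  unfold linStat
  refine (abs_sum_le_sum_abs _ _).trans ?_
  refine (sum_le_sum (g := fun _ => (2 : ℝ)) fun v _ => ?_).trans (by simp [mul_comm])
  rw [abs_mul, abs_spin, mul_one]
  exact hw v

/-- Zero total weight removes the common mean field a, leaving an almost exact eigenfunction. -/
theorem exists_glauberOp_linStat (hn : 1 ≤ n) (hβ : 0 ≤ β) {w : Fin n → ℝ} (hw0 : ∑ v, w v = 0)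
    (σ : Config n) : ∃ b : ℝ, -(4 * β / n) ≤ b ∧ b ≤ 0 ∧
      ∑ v, w v * (meanSpin β σ v - spin (σ v)) = (b - 1) * linStat w σ := by
  obtain ⟨a, b, hb1, hb2, h⟩ := exists_meanSpin_eq hn hβ σ
  refine ⟨b, hb1, hb2, ?_⟩
  have : ∀ v, w v * (meanSpin β σ v - spin (σ v)) = a * w v + (b - 1) * (w v * spin (σ v)) := by
    intro v
    rw [h]
    ring
  simp only [this, sum_add_distrib, ← mul_sum, hw0, mul_zero, zero_add]
  rfl

theorem glauberOp_linStat_ge (hn : 1 ≤ n) (hβ : 0 ≤ β) {w : Fin n → ℝ} (hw0 : ∑ v, w v = 0)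
    (hw : ∀ v, |w v| ≤ 2) (σ : Config n) :
    (1 - 1 / n) * linStat w σ - 8 * β / n ≤ glauberOp β (linStat w) σ := by
  have hn0 : (0 : ℝ) < n := by positivity
  obtain ⟨b, hb1, hb2, h⟩ := exists_glauberOp_linStat hn hβ hw0 σ
  unfold glauberOp
  simp only [siteAvg_linStat, sum_add_distrib, h]
  simp only [sum_const, card_univ, Fintype.card_fin, nsmul_eq_mul]
  have hM := abs_le.mp (abs_linStat_le hw σ)
  have h1 : -(8 * β) ≤ b * linStat w σ := by
    have h2 : |b * linStat w σ| ≤ 4 * β / n * (2 * n) := by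
      rw [abs_mul]
      refine mul_le_mul ?_ (abs_linStat_le hw σ) (abs_nonneg _) (by positivity)
      rw [abs_of_nonpos hb2]
      linarith
    have h3 : 4 * β / n * (2 * n) = 8 * β := by field_simp; ring
    rw [h3] at h2
    exact (abs_le.mp h2).1
  have e : (n : ℝ)⁻¹ * (n * linStat w σ + (b - 1) * linStat w σ) =
      (1 - 1 / n) * linStat w σ + b * linStat w σ / n := by
    field_simp
    ring
  rw [e]
  have : -(8 * β) / n ≤ b * linStat w σ / n := by gcongr
  rw [neg_div] at this
  linarith

/-- One update moves the statistic by at most 4, whence 16; the correction from b ≤ 0 only lowers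
the square. -/
theorem glauberOp_linStat_sq_le (hn : 1 ≤ n) (hβ : 0 ≤ β) {w : Fin n → ℝ} (hw0 : ∑ v, w v = 0)
    (hw : ∀ v, |w v| ≤ 2) (σ : Config n) :
    glauberOp β (fun η => linStat w η ^ 2) σ ≤ (1 - 2 / n) * linStat w σ ^ 2 + 16 := by
  have hn0 : (0 : ℝ) < n := by positivity
  obtain ⟨b, hb1, hb2, h⟩ := exists_glauberOp_linStat hn hβ hw0 σ
  unfold glauberOp
  rw [inv_mul_le_iff₀ hn0]
  refine (sum_le_sum fun v _ => siteAvg_linStat_sq_le hw σ v).trans ?_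
  simp only [sum_add_distrib, ← mul_sum, h]
  simp only [sum_const, card_univ, Fintype.card_fin, nsmul_eq_mul]
  have e : (n : ℝ) * ((1 - 2 / n) * linStat w σ ^ 2 + 16) =
      n * linStat w σ ^ 2 - 2 * linStat w σ ^ 2 + n * 16 := by
    field_simp
  rw [e]
  nlinarith [mul_nonneg (neg_nonneg.mpr hb2) (sq_nonneg (linStat w σ))]

theorem iterate_linStat_ge (hn : 1 ≤ n) (hβ : 0 ≤ β) {w : Fin n → ℝ} (hw0 : ∑ v, w v = 0)
    (hw : ∀ v, |w v| ≤ 2) (t : ℕ) (σ : Config n) :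
    (1 - 1 / n : ℝ) ^ t * linStat w σ - 8 * β * (1 - (1 - 1 / n : ℝ) ^ t) ≤
      (glauberOp β)^[t] (linStat w) σ := by
  have hn1 : (1 : ℝ) ≤ n := by exact_mod_cast hn
  have hx : 0 ≤ (1 - 1 / n : ℝ) := by
    rw [sub_nonneg, div_le_one (by linarith)]; exact hn1
  induction t with
  | zero => simp
  | succ t ih =>
    rw [Function.iterate_succ_apply]
    have h1 : (1 - 1 / n : ℝ) • linStat w + (fun _ => -(8 * β / n)) ≤ glauberOp β (linStat w) := by
      intro τ
      have := glauberOp_linStat_ge hn hβ hw0 hw τ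
      simp only [Pi.add_apply, Pi.smul_apply, smul_eq_mul]
      linarith
    have h2 := glauberOp_iterate_mono (β := β) t h1 σ
    rw [glauberOp_iterate_add, glauberOp_iterate_smul, glauberOp_iterate_const hn] at h2
    simp only [Pi.add_apply, Pi.smul_apply, smul_eq_mul] at h2
    refine le_trans ?_ h2
    have h3 := mul_le_mul_of_nonneg_left ih hx
    refine le_trans (le_of_eq ?_) (add_le_add_left h3 _)
    rw [pow_succ]
    ring

theorem iterate_linStat_sq_le (hn : 2 ≤ n) (hβ : 0 ≤ β) {w : Fin n → ℝ} (hw0 : ∑ v, w v = 0)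
    (hw : ∀ v, |w v| ≤ 2) (t : ℕ) (σ : Config n) :
    (glauberOp β)^[t] (fun η => linStat w η ^ 2) σ ≤
      (1 - 2 / n : ℝ) ^ t * linStat w σ ^ 2 + 8 * n * (1 - (1 - 2 / n : ℝ) ^ t) := by
  have hn1 : 1 ≤ n := by omega
  have hn2 : (2 : ℝ) ≤ n := by exact_mod_cast hn
  have hx : 0 ≤ (1 - 2 / n : ℝ) := by
    rw [sub_nonneg, div_le_one (by linarith)]; exact hn2
  induction t with
  | zero => simp
  | succ t ih =>
    rw [Function.iterate_succ_apply]
    have h1 : glauberOp β (fun η => linStat w η ^ 2) ≤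
        (1 - 2 / n : ℝ) • (fun η => linStat w η ^ 2) + (fun _ => (16 : ℝ)) := by
      intro τ
      exact glauberOp_linStat_sq_le hn1 hβ hw0 hw τ
    have h2 := glauberOp_iterate_mono (β := β) t h1 σ
    rw [glauberOp_iterate_add, glauberOp_iterate_smul, glauberOp_iterate_const hn1] at h2
    simp only [Pi.add_apply, Pi.smul_apply, smul_eq_mul] at h2
    refine h2.trans ?_
    have h3 := mul_le_mul_of_nonneg_left ih hx
    refine (add_le_add_left h3 _).trans (le_of_eq ?_)
    have h4 : 8 * n * (1 - 2 / n : ℝ) = 8 * n - 16 := by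
      field_simp
      ring
    rw [pow_succ]
    generalize (1 - 2 / n : ℝ) = x at h4 ⊢
    linear_combination h4

theorem gibbs_linStat_sq_le (hn : 2 ≤ n) (hβ : 0 ≤ β) {w : Fin n → ℝ} (hw0 : ∑ v, w v = 0)
    (hw : ∀ v, |w v| ≤ 2) : ∑ σ, gibbs β σ * linStat w σ ^ 2 ≤ 8 * n := by
  have hn1 : 1 ≤ n := by omega
  have hn0 : (0 : ℝ) < n := by positivity
  have h1 := gibbs_glauberOp (β := β) hn1 (fun η => linStat w η ^ 2)
  have h2 : ∑ σ, gibbs β σ * glauberOp β (fun η => linStat w η ^ 2) σ ≤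
      ∑ σ, gibbs β σ * ((1 - 2 / n) * linStat w σ ^ 2 + 16) :=
    sum_le_sum fun σ _ => mul_le_mul_of_nonneg_left (glauberOp_linStat_sq_le hn1 hβ hw0 hw σ)
      (gibbs_pos _).le
  rw [h1] at h2
  have h3 : ∑ σ : Config n, gibbs β σ * ((1 - 2 / n) * linStat w σ ^ 2 + 16) =
      (1 - 2 / n) * ∑ σ, gibbs β σ * linStat w σ ^ 2 + 16 := by
    have : ∀ σ : Config n, gibbs β σ * ((1 - 2 / n) * linStat w σ ^ 2 + 16) =
        (1 - 2 / n) * (gibbs β σ * linStat w σ ^ 2) + gibbs β σ * 16 := fun σ => by ring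
    simp only [this, sum_add_distrib, ← mul_sum, ← sum_mul, sum_gibbs, one_mul]
  rw [h3] at h2
  have h4 : 2 / (n : ℝ) * ∑ σ, gibbs β σ * linStat w σ ^ 2 ≤ 16 := by linarith
  rw [div_mul_eq_mul_div, div_le_iff₀ hn0] at h4
  linarith

/-! ### Lower bound -/

/-- B is the leading term of the mean of the statistic at time t. The test function F is even, so
both expectations pass to the unrestricted model, where the variance at time t is O(n + βB) and the
equilibrium second moment is at most 8n, both small compared with B². -/
theorem half_le_worstDist (hn : 2 ≤ n) (hβ : 0 ≤ β) {w : Fin n → ℝ} (hw0 : ∑ v, w v = 0)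
    (hw : ∀ v, |w v| ≤ 2) (σ : ConfigPlus n) (hσ0 : 0 < linStat w σ.1) (hσ : linStat w σ.1 ≤ n)
    (t : ℕ) (ht : 128 * (1 + β) * n ≤ ((1 - 1 / n : ℝ) ^ t * linStat w σ.1) ^ 2) :
    1 / 2 ≤ worstDist (restrictedGlauber n β) (gibbsPlus n β) t := by
  have hn1 : 1 ≤ n := by omega
  have hn2 : (2 : ℝ) ≤ n := by exact_mod_cast hn
  have hx : 0 < (1 - 1 / n : ℝ) := by
    rw [sub_pos, div_lt_one (by linarith)]; linarith
  have hx1 : (1 - 1 / n : ℝ) ^ t ≤ 1 := pow_le_one₀ hx.le (by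
    rw [sub_le_self_iff]; positivity)
  set y := (1 - 1 / n : ℝ) ^ t with hy
  have hy0 : 0 < y := pow_pos hx t
  set B := y * linStat w σ.1 with hB
  have hB0 : 0 < B := mul_pos hy0 hσ0
  have hBn : B ≤ n := by nlinarith
  set F : Config n → ℝ := fun η => if (B / 2) ^ 2 ≤ linStat w η ^ 2 then 1 else -1 with hF
  have hFe : ∀ η, F (-η) = F η := by
    intro η
    simp only [hF, linStat_neg, neg_sq]
  have hF1 : ∀ η : ConfigPlus n, |F η.1| ≤ 1 := by
    intro η
    simp only [hF]
    split_ifs <;> simp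
  have h1 := sub_le_tvDist (μ := fun η => (restrictedGlauber n β ^ t) σ η)
    (ν := gibbsPlus n β) hF1
  have h2 := tvDist_le_worstDist (restrictedGlauber n β) (gibbsPlus n β) t σ
  have e1 : ∑ η, (restrictedGlauber n β ^ t) σ η * F η.1 = (glauberOp β)^[t] F σ.1 := by
    have e2 := congrFun (restrictedOp_iterate_even (β := β) hFe t) σ
    rw [← e2, ← restrictedGlauber_pow_mulVec]
    rfl
  have e3 : ∑ η, gibbsPlus n β η * F η.1 = ∑ ζ, gibbs β ζ * F ζ := by
    rw [gibbsPlus_sum (fun η => F η.1)]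
    refine sum_congr rfl fun ζ _ => ?_
    rcases reflect_eq_or ζ with h | h <;> rw [h]
    rw [hFe]
  rw [e1, e3] at h1
  have hK : 0 < 8 / B ^ 2 := by positivity
  have hKB : 8 / B ^ 2 * B ^ 2 = 8 := by field_simp
  -- The minorant is 1 - (8/B²)(X - B)², expanded so that only the first two moments of X are
  -- needed. If |X| < B/2 then (X - B)² ≥ B²/4, which puts it below -1.
  have hlow : (fun _ => 1 - 8) + ((-(8 / B ^ 2)) • (fun η => linStat w η ^ 2) +
      (8 / B ^ 2 * (2 * B)) • linStat w) ≤ F := by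
    intro η
    simp only [Pi.add_apply, Pi.smul_apply, smul_eq_mul, hF]
    have e : 1 - 8 + (-(8 / B ^ 2) * linStat w η ^ 2 + 8 / B ^ 2 * (2 * B) * linStat w η) =
        1 - 8 / B ^ 2 * (linStat w η - B) ^ 2 := by
      linear_combination hKB
    rw [e]
    split_ifs with hc
    · have := mul_nonneg hK.le (sq_nonneg (linStat w η - B))
      linarith
    · have hlt : linStat w η < B / 2 := lt_of_pow_lt_pow_left₀ 2 (by positivity) (not_le.mp hc)
      have h3 : (B / 2) ^ 2 ≤ (linStat w η - B) ^ 2 := by nlinarith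
      have h4 := mul_le_mul_of_nonneg_left h3 hK.le
      have h5 : 8 / B ^ 2 * (B / 2) ^ 2 = 2 := by linear_combination hKB / 4
      linarith
  have h3 := glauberOp_iterate_mono (β := β) t hlow σ.1
  rw [glauberOp_iterate_add, glauberOp_iterate_add, glauberOp_iterate_smul,
    glauberOp_iterate_smul, glauberOp_iterate_const hn1] at h3
  simp only [Pi.add_apply, Pi.smul_apply, smul_eq_mul] at h3
  have h4 := iterate_linStat_ge hn1 hβ hw0 hw t σ.1
  have h5 := iterate_linStat_sq_le hn hβ hw0 hw t σ.1
  rw [← hy, ← hB] at h4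
  have hz0 : 0 ≤ (1 - 2 / n : ℝ) := by
    rw [sub_nonneg, div_le_one (by linarith)]; exact hn2
  have hz : (1 - 2 / n : ℝ) ^ t ≤ y ^ 2 := by
    rw [hy, ← pow_mul, mul_comm, pow_mul]
    refine pow_le_pow_left₀ hz0 ?_ t
    have : (1 - 1 / n : ℝ) ^ 2 = 1 - 2 / n + (1 / n) ^ 2 := by ring
    rw [this]
    have := sq_nonneg (1 / n : ℝ)
    linarith
  have h6 : (glauberOp β)^[t] (fun η => linStat w η ^ 2) σ.1 ≤ B ^ 2 + 8 * n := by
    refine h5.trans ?_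
    have h7 : (1 - 2 / n : ℝ) ^ t * linStat w σ.1 ^ 2 ≤ B ^ 2 := by
      rw [hB, mul_pow]
      exact mul_le_mul_of_nonneg_right hz (sq_nonneg _)
    have h8 := pow_nonneg hz0 t
    nlinarith
  have h7 : B - 8 * β ≤ (glauberOp β)^[t] (linStat w) σ.1 := by
    refine le_trans ?_ h4
    nlinarith
  have h8 : 1 - 8 / B ^ 2 * (8 * n + 16 * β * n) ≤ (glauberOp β)^[t] F σ.1 := by
    refine le_trans ?_ h3
    have h9 := mul_le_mul_of_nonneg_left h6 hK.le
    have h10 := mul_le_mul_of_nonneg_left h7 (by positivity : 0 ≤ 8 / B ^ 2 * (2 * B))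
    have h11 : 8 / B ^ 2 * (16 * β * B) ≤ 8 / B ^ 2 * (16 * β * n) := by gcongr
    nlinarith
  have hup : ∑ ζ, gibbs β ζ * F ζ ≤ 8 / B ^ 2 * (8 * n) - 1 := by
    have h9 : ∀ ζ, gibbs β ζ * F ζ ≤ 8 / B ^ 2 * (gibbs β ζ * linStat w ζ ^ 2) - gibbs β ζ := by
      intro ζ
      have h10 : F ζ ≤ 8 / B ^ 2 * linStat w ζ ^ 2 - 1 := by
        simp only [hF]
        split_ifs with hc
        · have h11 := mul_le_mul_of_nonneg_left hc hK.le
          have h5 : 8 / B ^ 2 * (B / 2) ^ 2 = 2 := by linear_combination hKB / 4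
          linarith
        · have := mul_nonneg hK.le (sq_nonneg (linStat w ζ))
          linarith
      have := mul_le_mul_of_nonneg_left h10 (gibbs_pos (β := β) ζ).le
      linarith
    refine (sum_le_sum fun ζ _ => h9 ζ).trans ?_
    rw [sum_sub_distrib, sum_gibbs, ← mul_sum]
    have := mul_le_mul_of_nonneg_left (gibbs_linStat_sq_le hn hβ hw0 hw) hK.le
    linarith
  have h9 : 8 / B ^ 2 * (8 * n + 16 * β * n) + 8 / B ^ 2 * (8 * n) ≤ 1 := by
    have h10 := mul_le_mul_of_nonneg_left ht hK.le
    rw [hKB] at h10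
    linarith
  linarith

theorem exists_plusCount_eq {k : ℕ} (hk : k ≤ n) : ∃ σ : Config n, plusCount σ = k := by
  obtain ⟨s, -, hs⟩ := exists_subset_card_eq (s := (univ : Finset (Fin n))) (n := k) (by simpa)
  refine ⟨fun i => if i ∈ s then 1 else -1, ?_⟩
  rw [plusCount, ← hs]
  congr 1
  ext i
  by_cases h : i ∈ s
  · simp [h]
  · simp only [mem_filter, mem_univ, true_and, h, if_false, iff_false]
    decide

/-- The weights are the spins of a nearly balanced configuration minus their average, and the chain
starts from that same configuration. -/
theorem exists_balanced (hn : 2 ≤ n) : ∃ (w : Fin n → ℝ) (σ : ConfigPlus n), ∑ v, w v = 0 ∧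
    (∀ v, |w v| ≤ 2) ∧ (n : ℝ) - 1 ≤ linStat w σ.1 ∧ linStat w σ.1 ≤ n := by
  have hn2 : (2 : ℝ) ≤ n := by exact_mod_cast hn
  obtain ⟨σ, hσ⟩ := exists_plusCount_eq (n := n) (k := (n + 1) / 2) (by omega)
  set x : ℝ := 2 * plusCount σ - n with hx
  have hx0 : 0 ≤ x := by
    have : (n : ℝ) ≤ 2 * plusCount σ := by exact_mod_cast (by omega : n ≤ 2 * plusCount σ)
    linarith
  have hx1 : x ≤ 1 := by
    have : 2 * (plusCount σ : ℝ) ≤ n + 1 := by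
      exact_mod_cast (by omega : 2 * plusCount σ ≤ n + 1)
    linarith
  have hsum := sum_spin σ
  rw [← hx] at hsum
  have hM : linStat (fun v => spin (σ v) - x / n) σ = n - x ^ 2 / n := by
    unfold linStat
    have : ∀ v, (spin (σ v) - x / n) * spin (σ v) = 1 - x / n * spin (σ v) := by
      intro v
      have := spin_sq (σ v)
      linear_combination this
    simp only [this, sum_sub_distrib, ← mul_sum, hsum]
    simp
    ring
  have hxn : x ^ 2 / n ≤ 1 := by
    rw [div_le_one (by linarith)]
    nlinarith
  refine ⟨fun v => spin (σ v) - x / n, ⟨σ, by rw [mag_nonneg_iff]; omega⟩, ?_, fun v => ?_, ?_, ?_⟩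
  · rw [sum_sub_distrib, hsum]
    simp only [sum_const, card_univ, Fintype.card_fin, nsmul_eq_mul]
    field_simp
    ring
  · have h1 : x / n ≤ 1 := by
      rw [div_le_one (by linarith)]
      linarith
    have h2 : 0 ≤ x / n := by positivity
    have h3 := abs_le.mp (abs_spin (σ v)).le
    rw [abs_le]
    constructor <;> linarith
  · simp only [hM]
    linarith
  · simp only [hM]
    have : 0 ≤ x ^ 2 / n := by positivity
    linarith

theorem eventually_lower (hβ : 1 < β) : ∀ᶠ n : ℕ in Filter.atTop,
    (1 / 4 : ℝ) * (n * Real.log n) ≤ (tmix n β : ℝ) := by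
  have hlim : Filter.Tendsto (fun n : ℕ => Real.log n) Filter.atTop Filter.atTop :=
    Real.tendsto_log_atTop.comp tendsto_natCast_atTop_atTop
  filter_upwards [Filter.eventually_ge_atTop 3,
    hlim.eventually_ge_atTop (4 * (512 * (1 + β)))] with n hn3 hL
  by_contra! hlt
  have hn1 : 1 ≤ n := by omega
  have hn3' : (3 : ℝ) ≤ n := by exact_mod_cast hn3
  have hn0 : (0 : ℝ) < n := by linarith
  obtain ⟨w, σ, hw0, hw, hM1, hM2⟩ := exists_balanced (by omega : 2 ≤ n)
  set t := tmix n β with ht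
  set L := Real.log n with hLdef
  have hmem : t ∈ mixedTimes n β := Nat.sInf_mem (mixedTimes_nonempty hn1 (by linarith))
  have hle : worstDist (restrictedGlauber n β) (gibbsPlus n β) t ≤ 1 / 4 := hmem
  have hbase : Real.exp (-(1 / (n - 1))) ≤ (1 - 1 / n : ℝ) := by
    have h1 := Real.add_one_le_exp (1 / ((n : ℝ) - 1))
    have h2 : 1 / ((n : ℝ) - 1) + 1 = n / (n - 1) := by
      have : (n : ℝ) - 1 ≠ 0 := by linarith
      field_simp
      ring
    rw [h2] at h1
    rw [Real.exp_neg]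
    refine (inv_anti₀ (div_pos hn0 (by linarith)) h1).trans (le_of_eq ?_)
    rw [inv_div]
    field_simp
  have hpow : Real.exp (-(3 / 4 * L)) ≤ ((1 - 1 / n : ℝ) ^ t) ^ 2 := by
    rw [← pow_mul]
    refine le_trans ?_ (pow_le_pow_left₀ (Real.exp_pos _).le hbase (t * 2))
    rw [← Real.exp_nat_mul]
    apply Real.exp_le_exp.mpr
    push_cast
    -- From t < nL/4, the left side is at most (n/(n-1)) · L/2, and n/(n-1) ≤ 3/2 for n ≥ 3.
    have h1 : (t : ℝ) * 2 * (1 / (n - 1)) ≤ 3 / 4 * L := by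
      rw [mul_one_div, div_le_iff₀ (by linarith)]
      have hL0 : 0 ≤ L := Real.log_nonneg (by linarith)
      nlinarith
    linarith
  have hexp : 512 * (1 + β) ≤ Real.exp (L / 4) := by
    linarith [Real.add_one_le_exp (L / 4)]
  have hcomb : Real.exp (-(3 / 4 * L)) * n = Real.exp (L / 4) := by
    calc Real.exp (-(3 / 4 * L)) * n = Real.exp (-(3 / 4 * L)) * Real.exp L := by
          rw [hLdef, Real.exp_log hn0]
      _ = Real.exp (L / 4) := by rw [← Real.exp_add]; ring_nf
  have key : 128 * (1 + β) * n ≤ ((1 - 1 / n : ℝ) ^ t * linStat w σ.1) ^ 2 := by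
    rw [mul_pow]
    have h1 : (n : ℝ) ^ 2 / 4 ≤ linStat w σ.1 ^ 2 := by nlinarith
    have h2 := mul_le_mul hpow h1 (by positivity) (by positivity)
    refine le_trans ?_ h2
    have h3 : Real.exp (-(3 / 4 * L)) * ((n : ℝ) ^ 2 / 4) = Real.exp (L / 4) * n / 4 := by
      rw [← hcomb]; ring
    rw [h3]
    nlinarith
  have := half_le_worstDist (by omega) (by linarith : 0 ≤ β) hw0 hw σ (by linarith) hM2 t key
  linarith

/-- Being mixed at time 0 would give every state mass at least 3/4, impossible with two distinct
states. -/
theorem one_le_tmix (hn : 2 ≤ n) (hβ : 0 ≤ β) : 1 ≤ tmix n β := by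
  by_contra! h
  have h0 : tmix n β = 0 := by omega
  have hmem : tmix n β ∈ mixedTimes n β := Nat.sInf_mem (mixedTimes_nonempty (by omega) hβ)
  rw [h0] at hmem
  have hst := isStationary_gibbsPlus (n := n) (β := β) (by omega)
  have hge : ∀ σ : ConfigPlus n, 3 / 4 ≤ gibbsPlus n β σ := by
    intro σ
    have h1 := (tvDist_le_worstDist (restrictedGlauber n β) (gibbsPlus n β) 0 σ).trans hmem
    have h2 := sub_le_tvDist (μ := fun η => (restrictedGlauber n β ^ 0) σ η) (ν := gibbsPlus n β)
      (F := fun η => if η = σ then 1 else -1) (fun η => by split_ifs <;> simp)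
    have h3 : ∑ η, gibbsPlus n β η * (if η = σ then (1 : ℝ) else -1) =
        2 * gibbsPlus n β σ - 1 := by
      have : ∀ η, gibbsPlus n β η * (if η = σ then (1 : ℝ) else -1) =
          2 * (if η = σ then gibbsPlus n β η else 0) - gibbsPlus n β η := by
        intro η
        split_ifs <;> ring
      simp only [this, sum_sub_distrib, ← mul_sum, hst.2.1]
      simp
    have h4 : ∑ η, (restrictedGlauber n β ^ 0) σ η * (if η = σ then (1 : ℝ) else -1) = 1 := by
      rw [pow_zero, sum_eq_single σ]
      · simp
      · intro η _ hη
        rw [Matrix.one_apply_ne (Ne.symm hη), zero_mul]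
      · simp
    rw [h3, h4] at h2
    linarith
  obtain ⟨σ, hσ⟩ := exists_plusCount_eq (n := n) (k := n - 1) (by omega)
  have hne : (⟨σ, by rw [mag_nonneg_iff]; omega⟩ : ConfigPlus n) ≠ allPlus n := by
    intro heq
    have : σ = 1 := congrArg Subtype.val heq
    rw [this, plusCount_one] at hσ
    omega
  have hle := sum_le_sum_of_subset_of_nonneg (f := gibbsPlus n β)
    (subset_univ {⟨σ, by rw [mag_nonneg_iff]; omega⟩, allPlus n}) (fun η _ _ => hst.1 η)
  rw [sum_pair hne, hst.2.1] at hle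
  linarith [hge ⟨σ, by rw [mag_nonneg_iff]; omega⟩, hge (allPlus n)]

theorem exists_le_tmix (hβ : 1 < β) : ∃ C : ℝ, 0 < C ∧ ∀ n : ℕ, 1 ≤ n →
    C * (n * Real.log n) ≤ (tmix n β : ℝ) := by
  obtain ⟨N, hN⟩ := Filter.eventually_atTop.mp (eventually_lower hβ)
  -- For n < N the second entry suffices, since n log n ≤ N² and the mixing time is at least 1 when
  -- n ≥ 2.
  refine ⟨min (1 / 4) (1 / ((N : ℝ) ^ 2 + 1)), by positivity, fun n hn => ?_⟩
  have hn1 : (1 : ℝ) ≤ n := by exact_mod_cast hn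
  have hlog : 0 ≤ Real.log n := Real.log_nonneg hn1
  have hx : 0 ≤ n * Real.log n := by positivity
  by_cases h : N ≤ n
  · exact (mul_le_mul_of_nonneg_right (min_le_left _ _) hx).trans (hN n h)
  · rcases hn.eq_or_lt with rfl | hn2
    · simp
    · have h1 : (1 : ℝ) ≤ tmix n β := by exact_mod_cast one_le_tmix hn2 (by linarith)
      refine le_trans ?_ h1
      refine (mul_le_mul_of_nonneg_right (min_le_right _ _) hx).trans ?_
      rw [one_div_mul_eq_div, div_le_one (by positivity)]
      have h2 : (n : ℝ) ≤ N := by exact_mod_cast (by omega : n ≤ N)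
      have h3 : Real.log n ≤ n := (Real.log_le_sub_one_of_pos (by linarith)).trans (by linarith)
      nlinarith

end CurieWeiss

end

theorem theorem3 (β : ℝ) (hβ : 1 < β) :
    -- for every `n ≥ 1`, `gibbsPlus` is the unique stationary distribution of the restricted
    -- dynamics and the mixing time is a genuine minimum
    (∀ n : ℕ, 1 ≤ n →
      (∀ π : CurieWeiss.ConfigPlus n → ℝ,
        CurieWeiss.IsStationary (CurieWeiss.restrictedGlauber n β) π ↔
          π = CurieWeiss.gibbsPlus n β) ∧
      IsLeast (CurieWeiss.mixedTimes n β) (CurieWeiss.tmix n β)) ∧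
    -- two-sided bound of order `n log n`
    (∃ C₃ C₄ : ℝ, 0 < C₃ ∧ 0 < C₄ ∧ ∀ n : ℕ, 1 ≤ n →
      C₃ * (n * Real.log n) ≤ (CurieWeiss.tmix n β : ℝ) ∧
      (CurieWeiss.tmix n β : ℝ) ≤ C₄ * (n * Real.log n)) ∧
    -- explicit constant in the lower bound, for all large `n`
    (∀ᶠ n : ℕ in Filter.atTop,
      (1 / 4 : ℝ) * (n * Real.log n) ≤ (CurieWeiss.tmix n β : ℝ)) := by
  have hβ0 : 0 ≤ β := by linarith
  refine ⟨fun n hn => ⟨CurieWeiss.stationary_iff hn hβ0,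
    Nat.sInf_mem (CurieWeiss.mixedTimes_nonempty hn hβ0), fun t ht => Nat.sInf_le ht⟩, ?_,
    CurieWeiss.eventually_lower hβ⟩
  obtain ⟨C₃, h3, hl⟩ := CurieWeiss.exists_le_tmix hβ
  obtain ⟨C₄, h4, hu⟩ := CurieWeiss.exists_tmix_le hβ
  exact ⟨C₃, C₄, h3, h4, fun n hn => ⟨hl n hn, hu n hn⟩⟩
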